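/- Let $T:\mathbb R/\mathbb Z\to\mathbb R/\mathbb Z$ be a real analytic, orientation-preserving map with $T(0)=0$ which is expanding: there are $C_*>0$, $\lambda_*>1$ with $|(T^n)'(x)|\ge C_*\lambda_*^n$ for all $x$ and all $n\ge 1$; fix such $C_*,\lambda_*$. Let $\mathcal H$ be a real Banach space of real analytic functions $\mathbb R/\mathbb Z\to\mathbb R$ whose inclusion into $\mathcal C^1=C^1(\mathbb R/\mathbb Z,\mathbb R)$ is continuous with dense image. *Maximization.* For $f\in\mathcal C^1$ let $\beta(f)=\sup_\mu\int f\,d\mu$ over $T$-invariant Borel probability measures; $\mu$ is maximizing if it attains the supremum, and periodic if it is supported on a periodic orbit. A (Lipschitz) calibrated sub-action is a Lipschitz $g$ with $g+f\le g\circ T+\beta(f)$ and $\sup_{T(y)=x}(g(y)+f(y))=g(x)+\beta(f)$ for all $x$. Put $E_g=\{g+f=g\circ T+\beta(f)\}$, $\Lambda_g^*=\bigcap_{n\ge0}T^{-n}(E_g)$, $\Lambda_g=\bigcap_{n\ge 0}T^n(\Lambda_g^*)$, and let $K(f)$ be the union of $\Lambda_g$ over all Lipschitz calibrated sub-actions $g$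 of $f$. A point $x\in K(f)$ is a critical value if $\#(T^{-1}(x)\cap K(f))>1$; it is regular if it has a connected neighbourhood $U$ such that on each component $B$ of $U\setminus\{x\}$ there is a continuous $\tau_B:B\to\mathbb R/\mathbb Z$ with $T\circ\tau_B=\mathrm{id}_B$ and $T^{-1}(y)\cap K(f)=\{\tau_B(y)\}$ for all $y\in K(f)\cap B$. $K(f)$ is Sturmian-like if all its critical values are regular. Let $P(f)$ be the set of critical values. *Marked frames.* Let $\tau$ be the inverse of the lift of $T$ to $\mathbb R$ fixing $0$, $\tau_i(x)=\tau(x+i)$, $d$ the degree of $T$, $\pi:\mathbb R\to\mathbb R/\mathbb Z$ the projection, and let $\mathcal P_n$ be the set of the arcs $\pi(\tau_{i_n}\circ\dots\circ\tau_{i_1}(0,1))$, $i_1,\dots,i_n\in\{0,\dots,d-1\}$. A marked frame $\mathcal M$ of type $p\ge1$ consists of a finite union $V$ of elements of $\mathcal P_N$ for some $N\ge1$, a union $V'\subset V$ of components of $T^{-1}(V)$, distinct components $V_1,\dots,V_p$ of $V$, and $V'_{\nu,\pm}\in\mathcal P_{N+1}$ ($1\le\nu\le p$; $V'_{\nu,+}=V'_{\nu,-}$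 is allowed) such that $T^{-1}(V_\nu)\cap V'=V'_{\nu,+}\cup V'_{\nu,-}$ for each $\nu$, and $T^{-1}(U)\cap V'\in\mathcal P_{N+1}$ for each component $U$ of $V\setminus\bigcup_\nu V_\nu$. With $V^n=\{x\in V':T(x),\dots,T^n(x)\in V\}$, its complexity is $\limsup_{n\to\infty}\frac1n\log\#\{\text{components of }V^n\}$. $\mathcal M$ is $f$-compatible if: $K(f)\subset T(V')$ and $\#P(f)=p$; each $V_\nu$ contains exactly one point $c_\nu$ of $P(f)$, and if $x\in K(f)$ lies in the right (resp. left) component of $V_\nu\setminus\{c_\nu\}$, then the only point of $T^{-1}(x)\cap K(f)$ is the preimage of $x$ in $V'_{\nu,+}$ (resp. $V'_{\nu,-}$); and $T^{-1}(U)\cap K(f)\subset V'$ for each component $U$ of $V\setminus\bigcup_\nu V_\nu$. Let $\mathcal H^{\mathcal M}$ be the set of $f\in\mathcal H$ which have a unique maximizing measure, have no periodic maximizing measure, have Sturmian-like $K(f)$, and are such that $\mathcal M$ is $f$-compatible. **Theorem.** Let $\mathcal M$ be a marked frame of type $p\ge1$ and of complexity less than $\frac1p\log\lambda_*$. For each $f_0\in\mathcal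 H^{\mathcal M}$ there exist $\varphi\in\mathcal H$ and an open neighbourhood $\mathcal U$ of $f_0$ in $\mathcal C^1$ such that for every $F\in\mathcal H$ the set $\{t\in[0,1]: F+t\varphi\in\mathcal U\cap\mathcal H^{\mathcal M}\}$ has Lebesgue measure zero. -/

import Mathlib

open Set Filter Topology MeasureTheory

noncomputable section

/-! ### The circle map -/

/-- A real analytic, orientation-preserving self-map `T` of the circle `ℝ/ℤ` with `T 0 = 0`,
together with its unique lift fixing `0` and its degree. -/
structure AnalyticCircleMap where
  toFun : UnitAddCircle → UnitAddCircle
  lift : ℝ → ℝ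
  degree : ℕ
  coe_lift : ∀ x : ℝ, ((lift x : ℝ) : UnitAddCircle) = toFun (x : UnitAddCircle)
  lift_zero : lift 0 = 0
  lift_add_one : ∀ x : ℝ, lift (x + 1) = lift x + degree
  strictMono_lift : StrictMono lift
  analytic_lift : AnalyticOnNhd ℝ lift univ

namespace AnalyticCircleMap

instance : CoeFun AnalyticCircleMap (fun _ => UnitAddCircle → UnitAddCircle) := ⟨toFun⟩

/-- `|(T^n)'(x)| ≥ C λ^n` for all points `x` and all positive integers `n`, where `C > 0` and
`λ > 1`. -/
def IsExpandingWith (T : AnalyticCircleMap) (C lam : ℝ) : Prop :=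
  0 < C ∧ 1 < lam ∧ ∀ n : ℕ, 1 ≤ n → ∀ x : ℝ, C * lam ^ n ≤ |deriv (T.lift^[n]) x|

theorem continuous_lift (T : AnalyticCircleMap) : Continuous T.lift :=
  continuousOn_univ.mp T.analytic_lift.continuousOn

theorem one_le_degree (T : AnalyticCircleMap) : (1 : ℝ) ≤ T.degree := by
  have h1 : T.lift 0 < T.lift (0 + 1) := T.strictMono_lift (by norm_num)
  rw [T.lift_add_one] at h1
  have h2 : (0 : ℝ) < T.degree := by linarith
  exact_mod_cast Nat.succ_le_of_lt (Nat.cast_pos.mp h2)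

theorem lift_natCast (T : AnalyticCircleMap) (n : ℕ) : T.lift n = n * T.degree := by
  induction n with
  | zero => simp [T.lift_zero]
  | succ k ih => push_cast; rw [T.lift_add_one, ih]; ring

theorem lift_neg_natCast (T : AnalyticCircleMap) (n : ℕ) : T.lift (-n) = -(n * T.degree) := by
  induction n with
  | zero => simp [T.lift_zero]
  | succ k ih =>
    have h := T.lift_add_one (-((k : ℝ) + 1))
    have e : -((k : ℝ) + 1) + 1 = -k := by ring
    rw [e, ih] at h
    push_cast
    linarith

theorem lift_bijective (T : AnalyticCircleMap) : Function.Bijective T.lift := by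
  have hd := T.one_le_degree
  refine ⟨T.strictMono_lift.injective, T.continuous_lift.surjective ?_ ?_⟩
  · refine T.strictMono_lift.monotone.tendsto_atTop_atTop fun b => ?_
    obtain ⟨n, hn⟩ := exists_nat_ge b
    exact ⟨n, by rw [T.lift_natCast]; nlinarith [(Nat.cast_nonneg n : (0 : ℝ) ≤ n)]⟩
  · refine T.strictMono_lift.monotone.tendsto_atBot_atBot fun b => ?_
    obtain ⟨n, hn⟩ := exists_nat_ge (-b)
    exact ⟨-n, by rw [T.lift_neg_natCast]; nlinarith [(Nat.cast_nonneg n : (0 : ℝ) ≤ n)]⟩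

/-- The inverse `τ` of the lift of `T`. -/
def tau (T : AnalyticCircleMap) : ℝ → ℝ := Function.invFun T.lift

theorem lift_tau (T : AnalyticCircleMap) (x : ℝ) : T.lift (T.tau x) = x :=
  Function.rightInverse_invFun T.lift_bijective.2 x

theorem tau_lift (T : AnalyticCircleMap) (x : ℝ) : T.tau (T.lift x) = x :=
  Function.leftInverse_invFun T.lift_bijective.1 x

/-- The inverse branch `τ_i(x) = τ(x + i)`. -/
def tauBranch (T : AnalyticCircleMap) (i : ℕ) (x : ℝ) : ℝ := T.tau (x + i)

/-- The composition `τ_{i_n} ∘ ⋯ ∘ τ_{i_1}` attached to the word `[i_n, …, i_1]`. -/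
def tauWord (T : AnalyticCircleMap) : List (Fin T.degree) → ℝ → ℝ
  | [] => id
  | i :: w => T.tauBranch i ∘ T.tauWord w

/-- The collection `𝒫_n` of the open arcs `π(τ_{i_n} ∘ ⋯ ∘ τ_{i_1} (0,1))`. -/
def arcs (T : AnalyticCircleMap) (n : ℕ) : Set (Set UnitAddCircle) :=
  {A | ∃ w : List (Fin T.degree), w.length = n ∧
    A = (fun x : ℝ => (x : UnitAddCircle)) '' (T.tauWord w '' Ioo (0 : ℝ) 1)}

end AnalyticCircleMap

/-! ### The space of `C¹` functions on the circle -/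

/-- The derivative of a function on the circle. -/
def circleDeriv (f : UnitAddCircle → ℝ) (x : UnitAddCircle) : ℝ :=
  deriv (fun t : ℝ => f (x + (t : UnitAddCircle))) 0

theorem circleDeriv_coe (f : UnitAddCircle → ℝ) (s : ℝ) :
    circleDeriv f (s : UnitAddCircle) = deriv (fun t : ℝ => f (t : UnitAddCircle)) s := by
  have h := deriv_comp_const_add (f := fun t : ℝ => f (t : UnitAddCircle)) s 0
  simpa [circleDeriv] using h

/-- The linear space of functions `ℝ/ℤ → ℝ` whose 1-periodic lift is `C¹`. -/
def c1Functions : Submodule ℝ (UnitAddCircle → ℝ) where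
  carrier := {f | ContDiff ℝ 1 (fun t : ℝ => f (t : UnitAddCircle))}
  add_mem' := fun {_ _} (hf : ContDiff ℝ 1 _) (hg : ContDiff ℝ 1 _) => hf.add hg
  zero_mem' := show ContDiff ℝ 1 (fun _ : ℝ => (0 : ℝ)) from contDiff_const
  smul_mem' := fun _ _ (hf : ContDiff ℝ 1 _) => contDiff_const.mul hf

/-- The space `C¹(ℝ/ℤ, ℝ)`; its norm is `max (sup |f|) (sup |f'|)`. -/
def C1Circle : Type := c1Functions

namespace C1Circle

instance : AddCommGroup C1Circle := inferInstanceAs (AddCommGroup c1Functions)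

instance : Module ℝ C1Circle := inferInstanceAs (Module ℝ c1Functions)

instance : CoeFun C1Circle (fun _ => UnitAddCircle → ℝ) := ⟨fun f => f.1⟩

theorem contDiff (f : C1Circle) : ContDiff ℝ 1 (fun t : ℝ => f (t : UnitAddCircle)) := f.2

theorem continuous (f : C1Circle) : Continuous (f : UnitAddCircle → ℝ) :=
  isQuotientMap_quotient_mk'.continuous_iff.mpr f.contDiff.continuous

theorem continuous_circleDeriv (f : C1Circle) : Continuous (circleDeriv f) := by
  refine isQuotientMap_quotient_mk'.continuous_iff.mpr ?_
  have h : (circleDeriv f ∘ fun s : ℝ => (s : UnitAddCircle)) =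
      deriv (fun t : ℝ => f (t : UnitAddCircle)) := funext fun s => circleDeriv_coe f s
  exact h ▸ f.contDiff.continuous_deriv le_rfl

/-- The map `f ↦ (f, f')` into pairs of continuous functions. -/
def jet : C1Circle →ₗ[ℝ] C(UnitAddCircle, ℝ) × C(UnitAddCircle, ℝ) where
  toFun f := (⟨f, f.continuous⟩, ⟨circleDeriv f, f.continuous_circleDeriv⟩)
  map_add' f g := by
    refine Prod.ext (ContinuousMap.ext fun x => rfl) (ContinuousMap.ext fun x => ?_)
    induction x using QuotientAddGroup.induction_on with
    | H s =>
      have hf := f.contDiff.differentiable one_ne_zero s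
      have hg := g.contDiff.differentiable one_ne_zero s
      have h := deriv_fun_add hf hg
      simp only [ContinuousMap.coe_mk, Prod.snd_add, ContinuousMap.add_apply]
      erw [circleDeriv_coe, circleDeriv_coe, circleDeriv_coe]
      exact h
  map_smul' c f := by
    refine Prod.ext (ContinuousMap.ext fun x => rfl) (ContinuousMap.ext fun x => ?_)
    induction x using QuotientAddGroup.induction_on with
    | H s =>
      have hf := f.contDiff.differentiable one_ne_zero s
      have h := deriv_fun_const_smul c hf
      simp only [ContinuousMap.coe_mk, Prod.smul_snd, ContinuousMap.smul_apply, RingHom.id_apply]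
      erw [circleDeriv_coe, circleDeriv_coe]
      exact h

theorem jet_injective : Function.Injective jet := fun f g h => by
  have h1 := congrArg Prod.fst h
  exact Subtype.ext (funext fun x => DFunLike.congr_fun h1 x)

instance : NormedAddCommGroup C1Circle :=
  NormedAddCommGroup.induced C1Circle (C(UnitAddCircle, ℝ) × C(UnitAddCircle, ℝ)) jet jet_injective

instance : NormedSpace ℝ C1Circle :=
  NormedSpace.induced ℝ C1Circle (C(UnitAddCircle, ℝ) × C(UnitAddCircle, ℝ)) jet

end C1Circle

/-- A function on the circle is real analytic if its 1-periodic lift is. -/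
def IsAnalyticOnCircle (f : UnitAddCircle → ℝ) : Prop :=
  AnalyticOnNhd ℝ (fun t : ℝ => f (t : UnitAddCircle)) univ

/-! ### Ergodic optimization -/

section ErgodicOptimization

variable (T : UnitAddCircle → UnitAddCircle) (f : UnitAddCircle → ℝ)

/-- The Borel probability measures invariant under `T`. -/
def invariantMeasures : Set (Measure UnitAddCircle) :=
  {μ | IsProbabilityMeasure μ ∧ MeasurePreserving T μ μ}

/-- `β(f, T)`, the supremum of `∫ f dμ` over all invariant probability measures. -/
def maxErgodicAverage : ℝ := sSup ((fun μ => ∫ x, f x ∂μ) '' invariantMeasures T)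

/-- The maximizing measures of `(f, T)`. -/
def maximizingMeasures : Set (Measure UnitAddCircle) :=
  {μ | μ ∈ invariantMeasures T ∧ ∫ x, f x ∂μ = maxErgodicAverage T f}

def HasUniqueMaximizingMeasure : Prop := ∃! μ, μ ∈ maximizingMeasures T f

/-- Some maximizing measure is supported on a periodic orbit. -/
def HasPeriodicMaximizingMeasure : Prop :=
  ∃ μ ∈ maximizingMeasures T f, ∃ x ∈ Function.periodicPts T,
    μ (range fun n : ℕ => T^[n] x)ᶜ = 0

/-- Continuous sub-actions. -/
def IsSubAction (g : UnitAddCircle → ℝ) : Prop :=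
  Continuous g ∧ ∀ x, g x + f x ≤ g (T x) + maxErgodicAverage T f

/-- Lipschitz calibrated sub-actions. -/
def IsCalibratedSubAction (g : UnitAddCircle → ℝ) : Prop :=
  IsSubAction T f g ∧ (∃ L, LipschitzWith L g) ∧
    ∀ x, IsLUB ((fun y => g y + f y) '' (T ⁻¹' {x})) (g x + maxErgodicAverage T f)

/-- The set `E_{f,T,g}` where the sub-action inequality is an equality. -/
def contactSet (g : UnitAddCircle → ℝ) : Set UnitAddCircle :=
  {x | g x + f x = g (T x) + maxErgodicAverage T f}

/-- `Λ*_{f,T,g}`: the points whose forward orbit stays in `E_{f,T,g}`. -/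
def forwardContactSet (g : UnitAddCircle → ℝ) : Set UnitAddCircle :=
  {x | ∀ n : ℕ, T^[n] x ∈ contactSet T f g}

/-- `Λ_{f,T,g} = ⋂_n T^n(Λ*_{f,T,g})`. -/
def invariantContactSet (g : UnitAddCircle → ℝ) : Set UnitAddCircle :=
  ⋂ n : ℕ, T^[n] '' forwardContactSet T f g

/-- `K(f, T)`: the union of `Λ_{f,T,g}` over all Lipschitz calibrated sub-actions `g`. -/
def maximizingSet : Set UnitAddCircle :=
  ⋃ g ∈ {g | IsCalibratedSubAction T f g}, invariantContactSet T f g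

end ErgodicOptimization

/-! ### Sturmian-like sets -/

/-- The connected components of a subset of the circle. -/
def components (U : Set UnitAddCircle) : Set (Set UnitAddCircle) :=
  (fun x => connectedComponentIn U x) '' U

section Sturmian

variable (T : UnitAddCircle → UnitAddCircle) (K : Set UnitAddCircle)

/-- The critical values of `K`: the points of `K` with more than one `T`-preimage in `K`. -/
def criticalValues : Set UnitAddCircle := {x | x ∈ K ∧ (T ⁻¹' {x} ∩ K).Nontrivial}

def IsRegularCriticalValue (x : UnitAddCircle) : Prop :=
  x ∈ criticalValues T K ∧ ∃ U ∈ 𝓝 x, IsConnected U ∧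
    ∀ B ∈ components (U \ {x}), ∃ τ : UnitAddCircle → UnitAddCircle,
      ContinuousOn τ B ∧ (∀ y ∈ B, T (τ y) = y) ∧ ∀ y ∈ K ∩ B, T ⁻¹' {y} ∩ K = {τ y}

def IsSturmianLike : Prop := ∀ x ∈ criticalValues T K, IsRegularCriticalValue T K x

end Sturmian

/-! ### Marked frames -/

/-- The points of the open arc `U ∋ c` (not the whole circle) lying to the right of `c`. -/
def rightPart (U : Set UnitAddCircle) (c : UnitAddCircle) : Set UnitAddCircle :=
  {x | ∃ s : ℝ, 0 < s ∧ x = c + (s : UnitAddCircle) ∧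
    ∀ u ∈ Icc 0 s, c + (u : UnitAddCircle) ∈ U}

/-- The points of the open arc `U ∋ c` (not the whole circle) lying to the left of `c`. -/
def leftPart (U : Set UnitAddCircle) (c : UnitAddCircle) : Set UnitAddCircle :=
  {x | ∃ s : ℝ, 0 < s ∧ x = c - (s : UnitAddCircle) ∧
    ∀ u ∈ Icc 0 s, c - (u : UnitAddCircle) ∈ U}

/-- A marked frame `(V, V')` of type `p`, with its marks `V_ν`, `V'_{ν,+}`, `V'_{ν,-}`. -/
structure MarkedFrame (T : AnalyticCircleMap) (p : ℕ) where
  N : ℕ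
  V : Set UnitAddCircle
  V' : Set UnitAddCircle
  mark : Fin p → Set UnitAddCircle
  markPlus : Fin p → Set UnitAddCircle
  markMinus : Fin p → Set UnitAddCircle
  N_pos : 0 < N
  V_eq : ∃ S ⊆ T.arcs N, S.Finite ∧ V = ⋃₀ S
  V'_eq : ∃ S ⊆ components (T ⁻¹' V), V' = ⋃₀ S
  V'_subset : V' ⊆ V
  mark_injective : Function.Injective mark
  mark_mem : ∀ ν, mark ν ∈ components V
  markPlus_mem : ∀ ν, markPlus ν ∈ T.arcs (N + 1)
  markMinus_mem : ∀ ν, markMinus ν ∈ T.arcs (N + 1)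
  preimage_mark : ∀ ν, T ⁻¹' (mark ν) ∩ V' = markPlus ν ∪ markMinus ν
  preimage_unmarked : ∀ U ∈ components (V \ ⋃ ν, mark ν), T ⁻¹' U ∩ V' ∈ T.arcs (N + 1)

namespace MarkedFrame

variable {T : AnalyticCircleMap} {p : ℕ}

/-- `V^n = {x ∈ V' : T x, …, T^n x ∈ V}`. -/
def survivors (M : MarkedFrame T p) (n : ℕ) : Set UnitAddCircle :=
  {x | x ∈ M.V' ∧ ∀ k ∈ Icc 1 n, T^[k] x ∈ M.V}

/-- The complexity: the upper exponential growth rate of the number of components of `V^n`. -/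
def complexity (M : MarkedFrame T p) : EReal :=
  limsup (fun n : ℕ =>
    ((1 / (n : ℝ) * Real.log ((components (M.survivors n)).ncard : ℝ) : ℝ) : EReal)) atTop

/-- The marked frame is compatible with `f`. -/
def IsCompatible (M : MarkedFrame T p) (f : UnitAddCircle → ℝ) : Prop :=
  maximizingSet T f ⊆ T '' M.V' ∧
  (criticalValues T (maximizingSet T f)).Finite ∧
  (criticalValues T (maximizingSet T f)).ncard = p ∧
  (∀ ν, ∃ c, M.mark ν ∩ criticalValues T (maximizingSet T f) = {c} ∧
    (∀ x ∈ maximizingSet T f ∩ rightPart (M.mark ν) c,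
      ∃ y ∈ M.markPlus ν, T ⁻¹' {x} ∩ maximizingSet T f = {y}) ∧
    (∀ x ∈ maximizingSet T f ∩ leftPart (M.mark ν) c,
      ∃ y ∈ M.markMinus ν, T ⁻¹' {x} ∩ maximizingSet T f = {y})) ∧
  ∀ U ∈ components (M.V \ ⋃ ν, M.mark ν), T ⁻¹' U ∩ maximizingSet T f ⊆ M.V'

/-- The functions with a unique maximizing measure, with `T|K(f)` Sturmian-like, without periodic
maximizing measure, with which the marked frame is compatible. -/
def compatibleFunctions (M : MarkedFrame T p) : Set (UnitAddCircle → ℝ) :=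
  {f | HasUniqueMaximizingMeasure T f ∧ IsSturmianLike T (maximizingSet T f) ∧
    ¬ HasPeriodicMaximizingMeasure T f ∧ M.IsCompatible f}

end MarkedFrame

end

/-! Let f be compatible, g a calibrated sub-action and K its forward contact set. On K one has g + f
= g ∘ T + β, and the backward dynamics on K follows inverse branches that the frame dictates once
the positions c = (c_ν) of the critical values are known. Iterating the relation along these
branches gives, for close x ≤ y in K, that g(y) - g(x) is the sum over n ≥ 1 of ∫ f' over the n-th
image of (x, y] (`IsAdapted.hullFunctional_apply`). Along a backward orbit (z_k) in K, on the other
hand, g(z_k) = g(z_0) + kβ - ∑_{i=1}^k f(z_i). Comparing both at a close pair z_l, z_r expresses (r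
- l)β linearly in f. Two such pairs eliminate β, so f lies in the kernel of a functional
(`relationFunctional`) depending only on c, a finite word of branches and four integers.

Fix the word and the integers. Each c_ν is the image of a point that survives forever in the frame,
so the k_n components of V^n sort the possible c into at most k_n^p classes of diameter O(λ^{-n}),
on which the functional varies by O(n² λ^{-n}). The bound on the complexity gives k_n^p n² λ^{-n} →
0: the family is thin (`isThinFamily_relationFunctional`). If φ lies in no kernel of a thin family,
then for every F the t with F + tφ in some kernel form a null set (`IsThinFamily.volume_kernels`). A
Baire argument provides one φ for countably many families
(`exists_forall_thinFamily_apply_ne_zero`).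

It remains to find a nonzero functional (`exists_relationFunctional_ne_zero`). After integration by
parts, vanishing means that a certain density is almost everywhere constant. Compare one fixed close
pair, at time distance n₀, with pairs ever closer in space and ever farther apart in time. By
Borel–Cantelli the interval terms of the latter disappear, so over windows of length m the number of
visits of the orbit to (s, t] is m/n₀ times an integer. Near a jump of that integer the orbit
returns within time 2n₀ at every scale, which yields a periodic point of K, hence a periodic
maximizing measure: a contradiction. -/

noncomputable section

/-! ### Thin families of functionals -/

section Thin

variable {E : Type*} [NormedAddCommGroup E] [NormedSpace ℝ E] {α : Type*}

/-- A family of functionals, indexed by a set `A`, is thin if it can be covered by `k` sets of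
diameter `r` with `k * r` arbitrarily small. -/
def IsThinFamily (A : Set α) (L : α → E →L[ℝ] ℝ) : Prop :=
  ∀ ε > 0, ∃ r > 0, ∃ k : ℕ, ∃ cls : α → Fin k,
    (∀ a ∈ A, ∀ a' ∈ A, cls a = cls a' → ‖L a - L a'‖ ≤ r) ∧ k * r < ε

theorem IsThinFamily.mono {A B : Set α} {L : α → E →L[ℝ] ℝ} (h : IsThinFamily A L)
    (hBA : B ⊆ A) : IsThinFamily B L := by
  intro ε hε
  obtain ⟨r, hr, k, cls, h1, h2⟩ := h ε hε
  exact ⟨r, hr, k, cls, fun a ha a' ha' => h1 a (hBA ha) a' (hBA ha'), h2⟩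

theorem IsThinFamily.bounded {A : Set α} {L : α → E →L[ℝ] ℝ} (h : IsThinFamily A L) :
    ∃ R, ∀ a ∈ A, ‖L a‖ ≤ R := by
  classical
  obtain ⟨r, hr, k, cls, h1, -⟩ := h 1 one_pos
  have key : ∀ i : Fin k, ∃ R, ∀ a ∈ A, cls a = i → ‖L a‖ ≤ R := by
    intro i
    by_cases hi : ∃ a ∈ A, cls a = i
    · obtain ⟨b, hb, hbi⟩ := hi
      refine ⟨‖L b‖ + r, fun a ha hai => ?_⟩
      have h3 := h1 a ha b hb (hai.trans hbi.symm)
      have h4 := norm_le_insert' (L a) (L b)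
      linarith
    · exact ⟨0, fun a ha hai => absurd ⟨a, ha, hai⟩ hi⟩
  choose R hR using key
  refine ⟨∑ i, |R i|, fun a ha => (hR (cls a) a ha rfl).trans ((le_abs_self _).trans ?_)⟩
  exact Finset.single_le_sum (f := fun i => |R i|) (fun i _ => abs_nonneg _) (Finset.mem_univ _)

/-- If a thin family is bounded away from zero on `ψ`, then almost every point of the segment
`F + t • ψ`, `t ∈ [0, 1]`, stays away from its kernels. -/
theorem IsThinFamily.volume_near_kernels {A : Set α} {L : α → E →L[ℝ] ℝ}
    (h : IsThinFamily A L) {ψ : E} {δ : ℝ} (hδ : 0 < δ) (hψ : ∀ a ∈ A, δ ≤ |L a ψ|) (F : E) :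
    volume {t : ℝ | t ∈ Icc (0 : ℝ) 1 ∧ ∀ η > 0, ∃ a ∈ A, |L a (F + t • ψ)| < η} = 0 := by
  classical
  set S := {t : ℝ | t ∈ Icc (0 : ℝ) 1 ∧ ∀ η > 0, ∃ a ∈ A, |L a (F + t • ψ)| < η}
  -- If t, t' belong to one class, then |t - t'| δ ≤ 2r + r(‖F‖ + ‖ψ‖), so each of the k classes
  -- costs measure at most rD.
  set D := (2 + ‖F‖ + ‖ψ‖) / δ with hD
  have hD0 : 0 < D := by positivity
  refine le_antisymm (ENNReal.le_of_forall_pos_le_add fun ε hε _ => ?_) zero_le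
  rw [zero_add]
  obtain ⟨r, hr, k, cls, h1, h2⟩ := h (ε / D) (by positivity)
  set P : Fin k → Set ℝ := fun i =>
    {t : ℝ | t ∈ Icc (0 : ℝ) 1 ∧ ∃ a ∈ A, cls a = i ∧ |L a (F + t • ψ)| < r}
  have hcov : S ⊆ ⋃ i, P i := by
    intro t ht
    obtain ⟨a, ha, hat⟩ := ht.2 r hr
    exact mem_iUnion.2 ⟨cls a, ht.1, a, ha, rfl, hat⟩
  have hP : ∀ i, volume (P i) ≤ ENNReal.ofReal (r * D) := by
    intro i
    refine (Real.volume_le_diam _).trans (Metric.ediam_le fun t ht t' ht' => ?_)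
    obtain ⟨ht0, a, ha, hai, hat⟩ := ht
    obtain ⟨ht0', a', ha', hai', hat'⟩ := ht'
    have h3 := h1 a ha a' ha' (hai.trans hai'.symm)
    have e : (t - t') * L a ψ =
        L a (F + t • ψ) - L a' (F + t' • ψ) - (L a - L a') (F + t' • ψ) := by
      simp only [map_add, map_smul, sub_apply, smul_eq_mul]
      ring
    have h4 : |(L a - L a') (F + t' • ψ)| ≤ r * (‖F‖ + ‖ψ‖) := by
      have h5 : ‖F + t' • ψ‖ ≤ ‖F‖ + ‖ψ‖ := by
        refine (norm_add_le _ _).trans ?_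
        rw [norm_smul, Real.norm_of_nonneg ht0'.1]
        have := mul_le_mul_of_nonneg_right ht0'.2 (norm_nonneg ψ)
        linarith
      calc |(L a - L a') (F + t' • ψ)| ≤ ‖L a - L a'‖ * ‖F + t' • ψ‖ := (L a - L a').le_opNorm _
        _ ≤ r * (‖F‖ + ‖ψ‖) := by gcongr
    have h6 : |t - t'| * δ ≤ r * (2 + ‖F‖ + ‖ψ‖) := by
      calc |t - t'| * δ ≤ |t - t'| * |L a ψ| := by gcongr; exact hψ a ha
        _ = |L a (F + t • ψ) - L a' (F + t' • ψ) - (L a - L a') (F + t' • ψ)| := by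
          rw [← abs_mul, e]
        _ ≤ |L a (F + t • ψ)| + |L a' (F + t' • ψ)| + |(L a - L a') (F + t' • ψ)| := by
          refine (abs_sub _ _).trans ?_
          gcongr
          exact abs_sub _ _
        _ ≤ r * (2 + ‖F‖ + ‖ψ‖) := by linarith
    rw [edist_dist, Real.dist_eq]
    refine ENNReal.ofReal_le_ofReal ?_
    rw [hD, ← mul_div_assoc, le_div_iff₀ hδ]
    exact h6
  calc volume S ≤ ∑ i, volume (P i) := (measure_mono hcov).trans (measure_iUnion_fintype_le _ _)
    _ ≤ ∑ _i : Fin k, ENNReal.ofReal (r * D) := Finset.sum_le_sum fun i _ => hP i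
    _ = ENNReal.ofReal (k * r * D) := by
      rw [Finset.sum_const, Finset.card_univ, Fintype.card_fin, nsmul_eq_mul,
        ← ENNReal.ofReal_natCast, ← ENNReal.ofReal_mul (Nat.cast_nonneg _), mul_assoc]
    _ ≤ ENNReal.ofReal ε := by
      refine ENNReal.ofReal_le_ofReal ?_
      rw [lt_div_iff₀ hD0] at h2
      exact h2.le
    _ = ε := ENNReal.ofReal_coe_nnreal

/-- A direction outside all the kernels of a thin family is transverse to all the kernels. -/
theorem IsThinFamily.volume_kernels {A : Set α} {L : α → E →L[ℝ] ℝ}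
    (h : IsThinFamily A L) {φ : E} (hφ : ∀ a ∈ A, L a φ ≠ 0) (F : E) :
    volume {t : ℝ | t ∈ Icc (0 : ℝ) 1 ∧ ∃ a ∈ A, L a (F + t • φ) = 0} = 0 := by
  have hsub : {t : ℝ | t ∈ Icc (0 : ℝ) 1 ∧ ∃ a ∈ A, L a (F + t • φ) = 0} ⊆
      ⋃ k : ℕ, {t : ℝ | t ∈ Icc (0 : ℝ) 1 ∧ ∀ η > 0,
        ∃ a ∈ {a ∈ A | 1 / ((k : ℝ) + 1) ≤ |L a φ|}, |L a (F + t • φ)| < η} := by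
    rintro t ⟨ht, a, ha, hat⟩
    obtain ⟨k, hk⟩ := exists_nat_one_div_lt (abs_pos.2 (hφ a ha))
    exact mem_iUnion.2 ⟨k, ht, fun η hη => ⟨a, ⟨ha, hk.le⟩, by rw [hat, abs_zero]; exact hη⟩⟩
  refine measure_mono_null hsub (measure_iUnion_null fun k => ?_)
  exact (h.mono (sep_subset _ _)).volume_near_kernels (by positivity) (fun a ha => ha.2) F

/-- Thinness makes the set of functionals totally bounded, hence Lindelöf, and the open sets of
functionals not vanishing at a given vector cover it. No separability of `E` is needed. -/
theorem IsThinFamily.exists_countable_separating {A : Set α} {L : α → E →L[ℝ] ℝ}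
    (h : IsThinFamily A L) (h0 : ∀ a ∈ A, L a ≠ 0) :
    ∃ ψ : ℕ → E, ∀ a ∈ A, ∃ i, L a (ψ i) ≠ 0 := by
  have htb : TotallyBounded (L '' A) := by
    rcases A.eq_empty_or_nonempty with rfl | ⟨a₀, -⟩
    · simp
    have : Nonempty α := ⟨a₀⟩
    refine Metric.totallyBounded_iff.2 fun ε hε => ?_
    classical
    obtain ⟨r, hr, k, cls, h1, h2⟩ := h ε hε
    choose! rep hrep using fun (i : Fin k) (hi : ∃ a ∈ A, cls a = i) => hi
    refine ⟨(fun i => L (rep i)) '' univ, finite_univ.image _, ?_⟩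
    rintro _ ⟨a, ha, rfl⟩
    refine mem_iUnion₂.2 ⟨L (rep (cls a)), ⟨cls a, mem_univ _, rfl⟩, ?_⟩
    have h3 := hrep (cls a) ⟨a, ha, rfl⟩
    rw [Metric.mem_ball, dist_eq_norm]
    refine (h1 a ha _ h3.1 h3.2.symm).trans_lt (lt_of_le_of_lt ?_ h2)
    have hk : (1 : ℝ) ≤ k := by
      have : 0 < k := (cls a).pos
      exact_mod_cast this
    nlinarith
  have hlin : IsLindelof (L '' A) := by
    have : SecondCountableTopology (L '' A) := htb.isSeparable.secondCountableTopology
    exact isLindelof_iff_lindelofSpace.2 inferInstance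
  have hopen : ∀ ψ : E, IsOpen {ℓ : E →L[ℝ] ℝ | ℓ ψ ≠ 0} := fun ψ =>
    isOpen_ne_fun (continuous_eval_const ψ) continuous_const
  obtain ⟨t, htc, ht⟩ := hlin.elim_countable_subcover (fun ψ : E => {ℓ : E →L[ℝ] ℝ | ℓ ψ ≠ 0})
    hopen (by
      rintro _ ⟨a, ha, rfl⟩
      obtain ⟨ψ, hψ⟩ := DFunLike.ne_iff.1 (h0 a ha)
      exact mem_iUnion.2 ⟨ψ, hψ⟩)
  have hc : (insert 0 t).Countable := htc.insert 0
  obtain ⟨ψ, hψ⟩ := hc.exists_eq_range (insert_nonempty _ _)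
  refine ⟨ψ, fun a ha => ?_⟩
  obtain ⟨x, hx, hx'⟩ := mem_iUnion₂.1 (ht ⟨a, ha, rfl⟩)
  obtain ⟨i, rfl⟩ : x ∈ range ψ := hψ ▸ mem_insert_of_mem _ hx
  exact ⟨i, hx'⟩

/-- A vector outside all the kernels of countably many thin families. -/
theorem exists_forall_thinFamily_apply_ne_zero [CompleteSpace E] {J : Type*} [Countable J]
    (A : J → Set α) (L : J → α → E →L[ℝ] ℝ) (hthin : ∀ j, IsThinFamily (A j) (L j))
    (h0 : ∀ j, ∀ a ∈ A j, L j a ≠ 0) : ∃ φ : E, ∀ j, ∀ a ∈ A j, L j a φ ≠ 0 := by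
  choose ψ hψ using fun j => (hthin j).exists_countable_separating (h0 j)
  -- Countably many pieces, on each of which one separating vector is bounded away from the kernels.
  -- Asking for a uniform lower bound on a piece, rather than mere nonvanishing, makes `O x` open.
  set B : J × ℕ × ℕ → Set α := fun x =>
    {a ∈ A x.1 | 1 / ((x.2.2 : ℝ) + 1) ≤ |L x.1 a (ψ x.1 x.2.1)|}
  set O : J × ℕ × ℕ → Set E := fun x => {φ | ∃ η > 0, ∀ a ∈ B x, η ≤ |L x.1 a φ|} with hO
  have hopen : ∀ x, IsOpen (O x) := by
    intro x
    obtain ⟨R, hR⟩ := (hthin x.1).bounded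
    refine Metric.isOpen_iff.2 ?_
    rintro φ ⟨η, hη, hφ⟩
    refine ⟨η / (2 * (|R| + 1)), by positivity, fun φ' hφ' =>
      ⟨η / 2, by positivity, fun a ha => ?_⟩⟩
    have h1 := hφ a ha
    have h2 : |L x.1 a (φ' - φ)| ≤ η / 2 := by
      calc |L x.1 a (φ' - φ)| ≤ ‖L x.1 a‖ * ‖φ' - φ‖ := (L x.1 a).le_opNorm _
        _ ≤ (|R| + 1) * (η / (2 * (|R| + 1))) := by
          gcongr
          · exact (hR a ha.1).trans ((le_abs_self R).trans (by linarith))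
          · exact (mem_ball_iff_norm.1 hφ').le
        _ = η / 2 := by field_simp
    rw [map_sub] at h2
    have h3 := abs_sub_abs_le_abs_sub (L x.1 a φ) (L x.1 a φ')
    rw [abs_sub_comm] at h3
    linarith
  have hdense : ∀ x, Dense (O x) := by
    intro x
    refine Metric.dense_iff.2 fun φ ε hε => ?_
    -- From any point, the segment in the separating direction leaves `O x` only on a null set of
    -- parameters, so arbitrarily small perturbations enter `O x`.
    have hnull := ((hthin x.1).mono (sep_subset _ _)).volume_near_kernels (A := B x)
      (ψ := ψ x.1 x.2.1) (δ := 1 / ((x.2.2 : ℝ) + 1)) (by positivity) (fun a ha => ha.2) φ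
    set S := {t : ℝ | t ∈ Icc (0 : ℝ) 1 ∧
      ∀ η > 0, ∃ a ∈ B x, |L x.1 a (φ + t • ψ x.1 x.2.1)| < η}
    set e := min 1 (ε / (‖ψ x.1 x.2.1‖ + 1))
    have he : 0 < e := by positivity
    have hne : (Ioo 0 e \ S).Nonempty := by
      by_contra hcon
      rw [not_nonempty_iff_eq_empty, sdiff_eq_empty] at hcon
      have h4 := measure_mono_null hcon hnull
      rw [Real.volume_Ioo, ENNReal.ofReal_eq_zero] at h4
      linarith
    obtain ⟨t, ⟨ht0, hte⟩, htS⟩ := hne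
    refine ⟨φ + t • ψ x.1 x.2.1, ?_, ?_⟩
    · rw [mem_ball_iff_norm, add_sub_cancel_left, norm_smul, Real.norm_of_nonneg ht0.le]
      calc t * ‖ψ x.1 x.2.1‖ ≤ t * (‖ψ x.1 x.2.1‖ + 1) := by gcongr; linarith
        _ < ε / (‖ψ x.1 x.2.1‖ + 1) * (‖ψ x.1 x.2.1‖ + 1) := by
          gcongr
          exact hte.trans_le (min_le_right _ _)
        _ = ε := by field_simp
    · by_contra hcon
      refine htS ⟨⟨ht0.le, hte.le.trans (min_le_left _ _)⟩, fun η hη => ?_⟩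
      by_contra hcon2
      push Not at hcon2
      exact hcon ⟨η, hη, hcon2⟩
  obtain ⟨φ, hφ⟩ := (dense_iInter_of_isOpen hopen hdense).nonempty
  refine ⟨φ, fun j a ha => ?_⟩
  obtain ⟨i, hi⟩ := hψ j a ha
  obtain ⟨k, hk⟩ := exists_nat_one_div_lt (abs_pos.2 hi)
  obtain ⟨η, hη, h5⟩ := mem_iInter.1 hφ (j, i, k)
  exact abs_pos.1 (hη.trans_le (h5 a ⟨ha, hk.le⟩))

end Thin

/-! ### Coordinates on the circle -/

/-- Needed for the components of the open set `V` to be open. -/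
instance : LocallyConnectedSpace UnitAddCircle :=
  have : LocallyPathConnectedSpace UnitAddCircle :=
    inferInstanceAs (LocallyPathConnectedSpace (Quotient _))
  inferInstance

theorem UnitAddCircle.continuous_coe : Continuous (fun s : ℝ => (s : UnitAddCircle)) :=
  AddCircle.continuous_mk' 1

theorem UnitAddCircle.isOpenMap_coe : IsOpenMap (fun s : ℝ => (s : UnitAddCircle)) :=
  QuotientAddGroup.isOpenMap_coe

theorem UnitAddCircle.coe_eq_coe_iff {s t : ℝ} :
    (s : UnitAddCircle) = (t : UnitAddCircle) ↔ ∃ m : ℤ, t = s + m := by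
  have h := AddCircle.coe_eq_zero_iff (1 : ℝ) (x := t - s)
  rw [AddCircle.coe_sub, sub_eq_zero, eq_comm] at h
  rw [h]
  refine exists_congr fun m => ?_
  rw [zsmul_eq_mul, mul_one, eq_comm, sub_eq_iff_eq_add, add_comm]

theorem UnitAddCircle.coe_add_intCast (s : ℝ) (m : ℤ) :
    ((s + m : ℝ) : UnitAddCircle) = (s : UnitAddCircle) :=
  (UnitAddCircle.coe_eq_coe_iff.2 ⟨m, rfl⟩).symm

theorem UnitAddCircle.coe_add_natCast (s : ℝ) (m : ℕ) :
    ((s + m : ℝ) : UnitAddCircle) = (s : UnitAddCircle) := by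
  exact_mod_cast UnitAddCircle.coe_add_intCast s m

theorem UnitAddCircle.injOn_coe : InjOn (fun s : ℝ => (s : UnitAddCircle)) (Ico 0 1) :=
  fun s hs t ht h => (AddCircle.coe_eq_coe_iff_of_mem_Ico (p := (1 : ℝ)) (a := 0)
    (by simpa using hs) (by simpa using ht)).1 h

theorem UnitAddCircle.coe_inj {s t : ℝ} (hs : s ∈ Ioo (0 : ℝ) 1) (ht : t ∈ Ioo (0 : ℝ) 1)
    (h : (s : UnitAddCircle) = t) : s = t :=
  UnitAddCircle.injOn_coe (Ioo_subset_Ico_self hs) (Ioo_subset_Ico_self ht) h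

theorem UnitAddCircle.dist_coe_le (s t : ℝ) :
    dist (s : UnitAddCircle) (t : UnitAddCircle) ≤ |s - t| := by
  rw [dist_eq_norm, ← AddCircle.coe_sub]
  rw [UnitAddCircle.norm_eq]
  simpa using round_le (s - t) 0

/-- The complement of `0` in the circle. -/
def UnitAddCircle.unitArc : Set UnitAddCircle := (fun s : ℝ => (s : UnitAddCircle)) '' Ioo 0 1

/-- The coordinate in `[0, 1)` of a point of the circle. -/
def UnitAddCircle.coord (x : UnitAddCircle) : ℝ := AddCircle.equivIco 1 0 x

theorem UnitAddCircle.coord_coe {s : ℝ} (hs : s ∈ Ico (0 : ℝ) 1) :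
    UnitAddCircle.coord (s : UnitAddCircle) = s := by
  rw [UnitAddCircle.coord, AddCircle.equivIco_coe_eq (by simpa using hs)]

theorem UnitAddCircle.coe_coord (x : UnitAddCircle) :
    ((UnitAddCircle.coord x : ℝ) : UnitAddCircle) = x :=
  (AddCircle.equivIco (1 : ℝ) 0).symm_apply_apply x

theorem UnitAddCircle.coord_mem {x : UnitAddCircle} (hx : x ∈ UnitAddCircle.unitArc) :
    UnitAddCircle.coord x ∈ Ioo (0 : ℝ) 1 := by
  obtain ⟨s, hs, rfl⟩ := hx
  simpa only [UnitAddCircle.coord_coe (Ioo_subset_Ico_self hs)] using hs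

theorem UnitAddCircle.continuousOn_coord :
    ContinuousOn UnitAddCircle.coord UnitAddCircle.unitArc := by
  rintro _ ⟨s, hs, rfl⟩
  refine (continuous_subtype_val.continuousAt.comp
    (AddCircle.continuousAt_equivIco (1 : ℝ) 0 ?_)).continuousWithinAt
  intro h
  have := UnitAddCircle.injOn_coe (Ioo_subset_Ico_self hs) (left_mem_Ico.2 one_pos) h
  exact hs.1.ne' this

/-- In coordinates, a connected subset of the circle without `0` is an interval. -/
theorem IsPreconnected.ordConnected_coe_preimage {A : Set UnitAddCircle} (hA : IsPreconnected A)
    (h : A ⊆ UnitAddCircle.unitArc) :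
    {s : ℝ | s ∈ Ioo (0 : ℝ) 1 ∧ (s : UnitAddCircle) ∈ A}.OrdConnected := by
  have e : {s : ℝ | s ∈ Ioo (0 : ℝ) 1 ∧ (s : UnitAddCircle) ∈ A} = UnitAddCircle.coord '' A := by
    ext s
    constructor
    · rintro ⟨hs, hsA⟩
      exact ⟨s, hsA, UnitAddCircle.coord_coe (Ioo_subset_Ico_self hs)⟩
    · rintro ⟨x, hx, rfl⟩
      exact ⟨UnitAddCircle.coord_mem (h hx), by rwa [UnitAddCircle.coe_coord]⟩
  rw [e]
  exact (hA.image _ (UnitAddCircle.continuousOn_coord.mono h)).ordConnected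

theorem isPreconnected_coe_image_Icc (s t : ℝ) :
    IsPreconnected ((fun s : ℝ => (s : UnitAddCircle)) '' Icc s t) :=
  isPreconnected_Icc.image _ UnitAddCircle.continuous_coe.continuousOn

theorem disjoint_of_mem_components {V A B : Set UnitAddCircle} (hA : A ∈ components V)
    (hB : B ∈ components V) (hAB : A ≠ B) : Disjoint A B := by
  obtain ⟨a, -, rfl⟩ := hA
  obtain ⟨b, -, rfl⟩ := hB
  refine disjoint_left.2 fun x hxa hxb => hAB ?_
  exact (connectedComponentIn_eq hxa).trans (connectedComponentIn_eq hxb).symm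

theorem subset_of_mem_components {V A : Set UnitAddCircle} (hA : A ∈ components V) : A ⊆ V := by
  obtain ⟨a, -, rfl⟩ := hA
  exact connectedComponentIn_subset _ _

theorem isOpen_of_mem_components {V A : Set UnitAddCircle} (hV : IsOpen V)
    (hA : A ∈ components V) : IsOpen A := by
  obtain ⟨a, -, rfl⟩ := hA
  exact hV.connectedComponentIn

theorem isPreconnected_of_mem_components {V A : Set UnitAddCircle}
    (hA : A ∈ components V) : IsPreconnected A := by
  obtain ⟨a, -, rfl⟩ := hA
  exact isPreconnected_connectedComponentIn

theorem IsPreconnected.subset_of_mem_components {V A S : Set UnitAddCircle} (hA : A ∈ components V)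
    (hS : IsPreconnected S) (hSV : S ⊆ V) {x : UnitAddCircle} (hxS : x ∈ S) (hxA : x ∈ A) :
    S ⊆ A := by
  obtain ⟨a, -, rfl⟩ := hA
  refine Subset.trans ?_ (connectedComponentIn_eq hxA).superset
  exact hS.subset_connectedComponentIn hxS hSV

/-! ### The lift and its inverse -/

namespace AnalyticCircleMap

variable (T : AnalyticCircleMap)

theorem continuous_toFun : Continuous T.toFun := by
  refine isQuotientMap_quotient_mk'.continuous_iff.mpr ?_
  have h : (T.toFun ∘ fun s : ℝ => (s : UnitAddCircle)) =
      fun s => ((T.lift s : ℝ) : UnitAddCircle) :=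
    funext fun s => (T.coe_lift s).symm
  exact h ▸ UnitAddCircle.continuous_coe.comp T.continuous_lift

theorem degree_pos : 0 < T.degree := by
  exact_mod_cast zero_lt_one.trans_le T.one_le_degree

theorem coe_lift_iterate (n : ℕ) (x : ℝ) :
    ((T.lift^[n] x : ℝ) : UnitAddCircle) = T^[n] (x : UnitAddCircle) := by
  induction n generalizing x with
  | zero => rfl
  | succ n ih => rw [Function.iterate_succ_apply, Function.iterate_succ_apply, ih, T.coe_lift]

theorem lift_add_natCast (x : ℝ) (m : ℕ) : T.lift (x + m) = T.lift x + m * T.degree := by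
  induction m with
  | zero => simp
  | succ m ih =>
    rw [Nat.cast_succ, ← add_assoc, T.lift_add_one, ih]
    ring

theorem tau_zero : T.tau 0 = 0 := by
  have h := T.tau_lift 0
  rwa [T.lift_zero] at h

theorem strictMono_tau : StrictMono T.tau := fun x y h => by
  rwa [← T.strictMono_lift.lt_iff_lt, T.lift_tau, T.lift_tau]

theorem surjective_tau : Function.Surjective T.tau := fun x => ⟨T.lift x, T.tau_lift x⟩

theorem continuous_tau : Continuous T.tau :=
  T.strictMono_tau.monotone.continuous_of_surjective T.surjective_tau

theorem tau_add_mul_degree (x : ℝ) (m : ℕ) : T.tau (x + m * T.degree) = T.tau x + m := by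
  apply T.strictMono_lift.injective
  rw [T.lift_tau, T.lift_add_natCast, T.lift_tau]

theorem tau_degree : T.tau T.degree = 1 := by
  have h := T.tau_add_mul_degree 0 1
  simpa [T.tau_zero] using h

/-- Moves integer translations through the iterates of τ: a composition of n inverse branches
becomes τⁿ after an integer translation, so the contraction of τⁿ applies to it. -/
theorem tau_iterate_add (n : ℕ) (x : ℝ) (m : ℕ) :
    T.tau^[n] (x + m * (T.degree : ℝ) ^ n) = T.tau^[n] x + m := by
  induction n generalizing x m with
  | zero => simp
  | succ n ih =>
    rw [Function.iterate_succ_apply, Function.iterate_succ_apply]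
    have h := T.tau_add_mul_degree x (m * T.degree ^ n)
    push_cast at h
    rw [pow_succ, ← mul_assoc, h]
    exact ih _ _

theorem tauBranch_mem {i : ℕ} (hi : i < T.degree) {s : ℝ} (hs : s ∈ Ioo (0 : ℝ) 1) :
    T.tauBranch i s ∈ Ioo (0 : ℝ) 1 := by
  have hi' : (i : ℝ) + 1 ≤ T.degree := by exact_mod_cast hi
  constructor
  · rw [← T.tau_zero]
    exact T.strictMono_tau (add_pos_of_pos_of_nonneg hs.1 (Nat.cast_nonneg i))
  · rw [← T.tau_degree]
    exact T.strictMono_tau (by linarith [hs.2])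

theorem lift_tauBranch (i : ℕ) (s : ℝ) : T.lift (T.tauBranch i s) = s + i := T.lift_tau _

theorem apply_tauBranch (i : ℕ) (s : ℝ) :
    T ((T.tauBranch i s : ℝ) : UnitAddCircle) = (s : UnitAddCircle) := by
  rw [← T.coe_lift, T.lift_tauBranch, UnitAddCircle.coe_add_natCast]

theorem strictMono_tauBranch (i : ℕ) : StrictMono (T.tauBranch i) := fun _ _ h =>
  T.strictMono_tau (by simpa using h)

theorem continuous_tauBranch (i : ℕ) : Continuous (T.tauBranch i) :=
  T.continuous_tau.comp (continuous_id.add continuous_const)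

theorem exists_eq_tauBranch {y : UnitAddCircle} {s : ℝ} (hs : s ∈ Ioo (0 : ℝ) 1)
    (h : T y = (s : UnitAddCircle)) :
    ∃ i < T.degree, y = ((T.tauBranch i s : ℝ) : UnitAddCircle) := by
  obtain ⟨t, ht, rfl⟩ : ∃ t ∈ Ico (0 : ℝ) 1, (t : UnitAddCircle) = y :=
    ⟨UnitAddCircle.coord y, by simpa [UnitAddCircle.coord] using (AddCircle.equivIco (1 : ℝ) 0 y).2,
      UnitAddCircle.coe_coord y⟩
  rw [← T.coe_lift, eq_comm, UnitAddCircle.coe_eq_coe_iff] at h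
  obtain ⟨m, hm⟩ := h
  have h0 : 0 ≤ T.lift t := by
    rw [← T.lift_zero]
    exact T.strictMono_lift.monotone ht.1
  have h1 : T.lift t < T.degree := by
    have := T.strictMono_lift ht.2
    have e := T.lift_add_one 0
    rw [zero_add, T.lift_zero, zero_add] at e
    rwa [e] at this
  have hm0 : -1 < m := by
    have : (-1 : ℝ) < m := by linarith [hs.2]
    exact_mod_cast this
  have hm1 : m < T.degree := by
    have : (m : ℝ) < T.degree := by linarith [hs.1]
    exact_mod_cast this
  lift m to ℕ using by linarith
  refine ⟨m, by exact_mod_cast hm1, ?_⟩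
  have e : T.tauBranch m s = t := by
    rw [tauBranch, show s + (m : ℝ) = T.lift t by exact_mod_cast hm.symm, T.tau_lift]
  rw [e]

/-! ### Arcs -/

theorem tauWord_mem (w : List (Fin T.degree)) {s : ℝ} (hs : s ∈ Ioo (0 : ℝ) 1) :
    T.tauWord w s ∈ Ioo (0 : ℝ) 1 := by
  induction w with
  | nil => exact hs
  | cons i w ih => exact T.tauBranch_mem i.2 ih

theorem isOpenMap_tauWord (w : List (Fin T.degree)) : IsOpenMap (T.tauWord w) := by
  induction w with
  | nil => exact IsOpenMap.id
  | cons i w ih =>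
    refine IsOpenMap.comp (g := T.tauBranch i) (fun U hU => ?_) ih
    have e : T.tauBranch i '' U = (fun x => T.lift x - i) ⁻¹' U := by
      ext x
      constructor
      · rintro ⟨u, hu, rfl⟩
        simpa [T.lift_tauBranch] using hu
      · intro hx
        exact ⟨_, hx, by simp [tauBranch, T.tau_lift]⟩
    rw [e]
    exact hU.preimage (T.continuous_lift.sub continuous_const)

theorem isOpen_of_mem_arcs {n : ℕ} {A : Set UnitAddCircle} (hA : A ∈ T.arcs n) : IsOpen A := by
  obtain ⟨w, -, rfl⟩ := hA
  exact UnitAddCircle.isOpenMap_coe _ (T.isOpenMap_tauWord w _ isOpen_Ioo)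

theorem subset_unitArc_of_mem_arcs {n : ℕ} {A : Set UnitAddCircle} (hA : A ∈ T.arcs n) :
    A ⊆ UnitAddCircle.unitArc := by
  obtain ⟨w, -, rfl⟩ := hA
  rintro _ ⟨_, ⟨s, hs, rfl⟩, rfl⟩
  exact ⟨_, T.tauWord_mem w hs, rfl⟩

/-- An arc of positive level lies in the image of one inverse branch. -/
theorem exists_branch_of_mem_arcs {n : ℕ} {A : Set UnitAddCircle} (hA : A ∈ T.arcs (n + 1)) :
    ∃ i < T.degree, ∀ y ∈ A, ∀ s ∈ Ioo (0 : ℝ) 1, T y = (s : UnitAddCircle) →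
      y = ((T.tauBranch i s : ℝ) : UnitAddCircle) := by
  obtain ⟨w, hw, rfl⟩ := hA
  obtain ⟨i, w, rfl⟩ := List.exists_cons_of_length_eq_add_one hw
  refine ⟨i, i.2, ?_⟩
  rintro _ ⟨_, ⟨u, hu, rfl⟩, rfl⟩ s hs h
  have h2 : T.tauWord w u = s := by
    refine UnitAddCircle.coe_inj (T.tauWord_mem w hu) hs ?_
    rw [← h]
    exact (T.apply_tauBranch i _).symm
  rw [← h2]
  rfl

/-! ### Expansion -/

section Expansion

variable {T} {C lam : ℝ}

theorem analytic_lift_iterate (n : ℕ) : AnalyticOnNhd ℝ (T.lift^[n]) univ := by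
  induction n with
  | zero => exact analyticOnNhd_id
  | succ n ih =>
    rw [Function.iterate_succ]
    exact ih.comp T.analytic_lift (mapsTo_univ _ _)

theorem differentiable_lift_iterate (n : ℕ) : Differentiable ℝ (T.lift^[n]) := fun x =>
  (T.analytic_lift_iterate n x (mem_univ x)).differentiableAt

/-- The multiplicative constant in the uniform contraction of the inverse branches. -/
def contractionConst (C : ℝ) : ℝ := max 1 C⁻¹

theorem contractionConst_pos (C : ℝ) : 0 < contractionConst C := lt_max_of_lt_left one_pos

theorem one_le_contractionConst (C : ℝ) : 1 ≤ contractionConst C := le_max_left _ _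

theorem IsExpandingWith.sub_le (hT : T.IsExpandingWith C lam) (n : ℕ) {x y : ℝ} (hxy : x ≤ y) :
    y - x ≤ contractionConst C * (lam ^ n)⁻¹ * (T.lift^[n] y - T.lift^[n] x) := by
  obtain ⟨hC, hl, h⟩ := hT
  have hmono : Monotone (T.lift^[n]) := T.strictMono_lift.monotone.iterate n
  have h0 : 0 ≤ T.lift^[n] y - T.lift^[n] x := sub_nonneg.2 (hmono hxy)
  have hp : 0 < lam ^ n := by positivity
  rcases Nat.eq_zero_or_pos n with rfl | hn
  -- Expansion is only assumed for n ≥ 1; the maximum with 1 in `contractionConst` serves n = 0.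
  · simpa using le_mul_of_one_le_left (sub_nonneg.2 hxy) (one_le_contractionConst C)
  · have h1 := mul_sub_le_image_sub_of_le_deriv (T.differentiable_lift_iterate n)
      (C := C * lam ^ n) (fun x => (h n hn x).trans_eq (abs_of_nonneg hmono.deriv_nonneg)) hxy
    calc y - x = C⁻¹ * (lam ^ n)⁻¹ * (C * lam ^ n * (y - x)) := by field_simp
      _ ≤ C⁻¹ * (lam ^ n)⁻¹ * (T.lift^[n] y - T.lift^[n] x) := by gcongr
      _ ≤ _ := by gcongr; exact le_max_right _ _

theorem lift_iterate_tau_iterate (n : ℕ) (x : ℝ) : T.lift^[n] (T.tau^[n] x) = x :=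
  (Function.LeftInverse.iterate T.lift_tau n) x

theorem IsExpandingWith.lipschitz_tau_iterate (hT : T.IsExpandingWith C lam) (n : ℕ) (x y : ℝ) :
    |T.tau^[n] x - T.tau^[n] y| ≤ contractionConst C * (lam ^ n)⁻¹ * |x - y| := by
  wlog h : y ≤ x generalizing x y
  · rw [abs_sub_comm, abs_sub_comm x]
    exact this y x (le_of_not_ge h)
  have h1 := hT.sub_le n (T.strictMono_tau.monotone.iterate n h)
  rw [lift_iterate_tau_iterate, lift_iterate_tau_iterate] at h1
  rwa [abs_of_nonneg (sub_nonneg.2 h),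
    abs_of_nonneg (sub_nonneg.2 (T.strictMono_tau.monotone.iterate n h))]

end Expansion

theorem exists_lipschitz_lift : ∃ Λ > 0, ∀ x ∈ Icc (0 : ℝ) 1, ∀ y ∈ Icc (0 : ℝ) 1,
    |T.lift x - T.lift y| ≤ Λ * |x - y| := by
  have hd : ContDiff ℝ 1 T.lift :=
    contDiff_iff_contDiffAt.2 fun x => (T.analytic_lift x (mem_univ x)).contDiffAt
  obtain ⟨B, hB⟩ := isCompact_Icc.exists_bound_of_continuousOn
    (hd.continuous_deriv le_rfl).continuousOn (s := Icc (0 : ℝ) 1)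
  refine ⟨|B| + 1, by positivity, fun x hx y hy => ?_⟩
  have h := (convex_Icc (0 : ℝ) 1).norm_image_sub_le_of_norm_deriv_le
    (fun z _ => hd.differentiable one_ne_zero z) (fun z hz => (hB z hz).trans
      ((le_abs_self B).trans (by linarith : |B| ≤ |B| + 1))) hy hx
  simpa [Real.norm_eq_abs] using h

end AnalyticCircleMap

/-! ### Functionals on the space of `C¹` functions -/

namespace C1Circle

theorem abs_apply_le (f : C1Circle) (x : UnitAddCircle) : |f x| ≤ ‖f‖ :=
  ((jet f).1.norm_coe_le_norm x).trans (norm_fst_le (jet f))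

theorem abs_circleDeriv_le (f : C1Circle) (x : UnitAddCircle) : |circleDeriv f x| ≤ ‖f‖ :=
  ((jet f).2.norm_coe_le_norm x).trans (norm_snd_le (jet f))

theorem circleDeriv_add (f g : C1Circle) (x : UnitAddCircle) :
    circleDeriv (f + g : C1Circle) x = circleDeriv f x + circleDeriv g x :=
  DFunLike.congr_fun (congrArg Prod.snd (jet.map_add f g)) x

theorem circleDeriv_smul (c : ℝ) (f : C1Circle) (x : UnitAddCircle) :
    circleDeriv (c • f : C1Circle) x = c * circleDeriv f x :=
  DFunLike.congr_fun (congrArg Prod.snd (jet.map_smul c f)) x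

theorem continuous_circleDeriv_coe (f : C1Circle) :
    Continuous fun s : ℝ => circleDeriv f (s : UnitAddCircle) :=
  f.continuous_circleDeriv.comp UnitAddCircle.continuous_coe

theorem hasDerivAt_coe (f : C1Circle) (s : ℝ) :
    HasDerivAt (fun t : ℝ => f (t : UnitAddCircle)) (circleDeriv f (s : UnitAddCircle)) s := by
  rw [circleDeriv_coe]
  exact (f.contDiff.differentiable one_ne_zero s).hasDerivAt

theorem abs_sub_le (f : C1Circle) (s t : ℝ) :
    |f (s : UnitAddCircle) - f (t : UnitAddCircle)| ≤ ‖f‖ * |s - t| := by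
  have h := convex_univ.norm_image_sub_le_of_norm_hasDerivWithin_le
    (f := fun t : ℝ => f (t : UnitAddCircle)) (C := ‖f‖)
    (fun x _ => (f.hasDerivAt_coe x).hasDerivWithinAt)
    (fun x _ => f.abs_circleDeriv_le x) (mem_univ t) (mem_univ s)
  simpa [Real.norm_eq_abs] using h

theorem setIntegral_circleDeriv (f : C1Circle) {s t : ℝ} (h : s ≤ t) :
    ∫ x in Ioc s t, circleDeriv f (x : UnitAddCircle) =
      f (t : UnitAddCircle) - f (s : UnitAddCircle) := by
  rw [← intervalIntegral.integral_of_le h]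
  exact intervalIntegral.integral_eq_sub_of_hasDerivAt (fun x _ => f.hasDerivAt_coe x)
    (f.continuous_circleDeriv_coe.intervalIntegrable _ _)

theorem integrableOn_circleDeriv (f : C1Circle) {D : Set ℝ} (hD : D ⊆ Ioo 0 1) :
    IntegrableOn (fun s : ℝ => circleDeriv f (s : UnitAddCircle)) D :=
  (f.continuous_circleDeriv_coe.integrableOn_Icc (a := 0) (b := 1)).mono_set
    (hD.trans Ioo_subset_Icc_self)

theorem volume_lt_top_of_subset {D : Set ℝ} (hD : D ⊆ Ioo 0 1) : volume D < ⊤ :=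
  (measure_mono hD).trans_lt (by simp)

theorem abs_setIntegral_circleDeriv_le (f : C1Circle) {D : Set ℝ} (hD : D ⊆ Ioo 0 1) :
    |∫ s in D, circleDeriv f (s : UnitAddCircle)| ≤ volume.real D * ‖f‖ := by
  rw [mul_comm, ← Real.norm_eq_abs]
  exact norm_setIntegral_le_of_norm_le_const (C := ‖f‖) (volume_lt_top_of_subset hD)
    (fun x _ => f.abs_circleDeriv_le (x : UnitAddCircle))

/-- The evaluation functional at the point with coordinate `s`. -/
def evalCLM (s : ℝ) : C1Circle →L[ℝ] ℝ :=
  LinearMap.mkContinuous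
    { toFun := fun f => f (s : UnitAddCircle)
      map_add' := fun _ _ => rfl
      map_smul' := fun _ _ => rfl } 1 fun f => by
        rw [one_mul]; exact f.abs_apply_le _

theorem evalCLM_apply (s : ℝ) (f : C1Circle) : evalCLM s f = f (s : UnitAddCircle) := rfl

theorem norm_evalCLM_sub_le (s t : ℝ) : ‖evalCLM s - evalCLM t‖ ≤ |s - t| :=
  ContinuousLinearMap.opNorm_le_bound _ (abs_nonneg _) fun f => by
    rw [mul_comm]
    exact f.abs_sub_le s t

/-- The functional `f ↦ ∫ f'` over a subset of the unit interval. -/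
def integralCLM (D : Set ℝ) : C1Circle →L[ℝ] ℝ :=
  LinearMap.mkContinuous
    -- Cutting with the unit interval makes the functional bounded for every `D`.
    { toFun := fun f => ∫ s in D ∩ Ioo 0 1, circleDeriv f (s : UnitAddCircle)
      map_add' := fun f g => by
        simp only [circleDeriv_add]
        exact integral_add (f.integrableOn_circleDeriv inter_subset_right)
          (g.integrableOn_circleDeriv inter_subset_right)
      map_smul' := fun c f => by
        simp only [circleDeriv_smul]
        exact integral_const_mul _ _ } (volume.real (D ∩ Ioo 0 1)) fun f =>
          f.abs_setIntegral_circleDeriv_le inter_subset_right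

theorem integralCLM_apply {D : Set ℝ} (hD : D ⊆ Ioo 0 1) (f : C1Circle) :
    integralCLM D f = ∫ s in D, circleDeriv f (s : UnitAddCircle) := by
  change ∫ s in D ∩ Ioo 0 1, circleDeriv f (s : UnitAddCircle) = _
  rw [inter_eq_self_of_subset_left hD]

theorem norm_integralCLM_le {D : Set ℝ} (hD : D ⊆ Ioo 0 1) : ‖integralCLM D‖ ≤ volume.real D :=
  ContinuousLinearMap.opNorm_le_bound _ measureReal_nonneg fun f => by
    rw [integralCLM_apply hD]
    exact f.abs_setIntegral_circleDeriv_le hD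

theorem norm_integralCLM_sub_le {D D' : Set ℝ} (hD : D ⊆ Ioo 0 1) (hD' : D' ⊆ Ioo 0 1)
    (hm : MeasurableSet D) (hm' : MeasurableSet D') :
    ‖integralCLM D - integralCLM D'‖ ≤ volume.real (D \ D') + volume.real (D' \ D) := by
  refine ContinuousLinearMap.opNorm_le_bound _
    (add_nonneg measureReal_nonneg measureReal_nonneg) fun f => ?_
  have h1 := integral_inter_add_sdiff hm' (f.integrableOn_circleDeriv hD)
  have h2 := integral_inter_add_sdiff hm (f.integrableOn_circleDeriv hD')
  rw [inter_comm D' D] at h2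
  rw [sub_apply, integralCLM_apply hD, integralCLM_apply hD', ← h1, ← h2,
    add_sub_add_left_eq_sub, add_mul]
  exact (abs_sub _ _).trans (add_le_add
    (f.abs_setIntegral_circleDeriv_le (sdiff_subset.trans hD))
    (f.abs_setIntegral_circleDeriv_le (sdiff_subset.trans hD')))

end C1Circle

/-! ### Measurable selections of inverse branches -/

namespace AnalyticCircleMap

variable (T : AnalyticCircleMap)

/-- The map `s ↦ τ_{b(s)}(s)` attached to a choice `b` of inverse branches. -/
def selection (b : ℝ → ℕ) (s : ℝ) : ℝ := T.tauBranch (b s) s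

/-- A measurable choice of inverse branches. -/
structure IsBranchChoice (b : ℝ → ℕ) : Prop where
  measurable : Measurable b
  lt_degree : ∀ s, b s < T.degree

variable {T} {b b' : ℝ → ℕ} {C lam : ℝ}

theorem IsBranchChoice.measurable_selection (hb : T.IsBranchChoice b) :
    Measurable (T.selection b) :=
  T.continuous_tau.measurable.comp (measurable_id.add (measurable_from_nat.comp hb.measurable))

theorem IsBranchChoice.mapsTo (hb : T.IsBranchChoice b) (n : ℕ) :
    MapsTo (T.selection b)^[n] (Ioo 0 1) (Ioo 0 1) :=
  MapsTo.iterate (fun s hs => T.tauBranch_mem (hb.lt_degree s) hs) n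

/-- On the circle, T undoes the selection whichever branch was chosen. -/
theorem selection_injOn : InjOn (T.selection b) (Ioo 0 1) := by
  intro s hs t ht h
  refine UnitAddCircle.coe_inj hs ht ?_
  rw [← T.apply_tauBranch (b s) s, ← T.apply_tauBranch (b t) t]
  exact congrArg (fun x : ℝ => T (x : UnitAddCircle)) h

theorem IsBranchChoice.injOn (hb : T.IsBranchChoice b) (n : ℕ) :
    InjOn (T.selection b)^[n] (Ioo 0 1) := by
  induction n with
  | zero => exact injOn_id _
  | succ n ih =>
    rw [Function.iterate_succ']
    exact selection_injOn.comp ih (hb.mapsTo n)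

theorem IsBranchChoice.image_subset (hb : T.IsBranchChoice b) (n : ℕ) {A : Set ℝ}
    (hA : A ⊆ Ioo 0 1) : (T.selection b)^[n] '' A ⊆ Ioo 0 1 :=
  ((hb.mapsTo n).mono_left hA).image_subset

theorem IsBranchChoice.measurableSet_image (hb : T.IsBranchChoice b) (n : ℕ) {A : Set ℝ}
    (hA : A ⊆ Ioo 0 1) (hm : MeasurableSet A) : MeasurableSet ((T.selection b)^[n] '' A) :=
  hm.image_of_measurable_injOn (hb.measurable_selection.iterate n) ((hb.injOn n).mono hA)

/-- All the discontinuity of an iterated selection sits in an integer translation `m`; on each level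
set of `m` the iterate is a translate followed by τⁿ. -/
theorem IsBranchChoice.exists_iterate_eq (hb : T.IsBranchChoice b) (n : ℕ) :
    ∃ m : ℝ → ℕ, Measurable m ∧ ∀ s, (T.selection b)^[n] s = T.tau^[n] (s + m s) := by
  induction n with
  | zero => exact ⟨fun _ => 0, measurable_const, fun s => by simp⟩
  | succ n ih =>
    obtain ⟨m, hm, h⟩ := ih
    refine ⟨fun s => m s + b ((T.selection b)^[n] s) * T.degree ^ n,
      hm.add ((hb.measurable.comp (hb.measurable_selection.iterate n)).mul_const _), fun s => ?_⟩
    rw [Function.iterate_succ_apply', Function.iterate_succ_apply']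
    push_cast
    rw [← add_assoc, T.tau_iterate_add, ← h]
    rfl

theorem IsExpandingWith.volume_tau_image_le (hT : T.IsExpandingWith C lam) (n : ℕ) (A : Set ℝ) :
    volume (T.tau^[n] '' A) ≤ ENNReal.ofReal (contractionConst C * (lam ^ n)⁻¹) * volume A := by
  have h : LipschitzOnWith (Real.toNNReal (contractionConst C * (lam ^ n)⁻¹)) (T.tau^[n]) A := by
    refine LipschitzOnWith.of_dist_le_mul fun x _ y _ => ?_
    have := zero_lt_one.trans hT.2.1
    have := contractionConst_pos C
    rw [Real.dist_eq, Real.dist_eq, Real.coe_toNNReal _ (by positivity)]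
    exact hT.lipschitz_tau_iterate n x y
  have h2 := h.hausdorffMeasure_image_le (d := 1) zero_le_one
  rwa [hausdorffMeasure_real, ENNReal.rpow_one] at h2

/-- The iterate is not Lipschitz, but it contracts each of the countably many level sets of the
integer translation, and the measures of these add up to that of `A`. -/
theorem IsExpandingWith.volume_image_le (hT : T.IsExpandingWith C lam) (hb : T.IsBranchChoice b)
    (n : ℕ) {A : Set ℝ} (hm : MeasurableSet A) :
    volume ((T.selection b)^[n] '' A) ≤
      ENNReal.ofReal (contractionConst C * (lam ^ n)⁻¹) * volume A := by
  obtain ⟨m, hmm, h⟩ := hb.exists_iterate_eq n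
  have hcov : (T.selection b)^[n] '' A ⊆
      ⋃ k : ℕ, T.tau^[n] '' ((fun s => (k : ℝ) + s) '' (A ∩ m ⁻¹' {k})) := by
    rintro _ ⟨s, hs, rfl⟩
    refine mem_iUnion.2 ⟨m s, _, ⟨s, ⟨hs, rfl⟩, rfl⟩, ?_⟩
    rw [h, add_comm]
  have hA : volume A = ∑' k : ℕ, volume (A ∩ m ⁻¹' {k}) := by
    rw [← measure_iUnion]
    · congr 1
      ext s
      simp
    · intro i j hij
      refine disjoint_left.2 fun s hs hs' => hij ?_
      exact hs.2.symm.trans hs'.2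
    · exact fun k => hm.inter (hmm (measurableSet_singleton k))
  calc volume ((T.selection b)^[n] '' A)
      ≤ ∑' k : ℕ, volume (T.tau^[n] '' ((fun s => (k : ℝ) + s) '' (A ∩ m ⁻¹' {k}))) :=
        (measure_mono hcov).trans (measure_iUnion_le _)
    _ ≤ ∑' k : ℕ, ENNReal.ofReal (contractionConst C * (lam ^ n)⁻¹) * volume (A ∩ m ⁻¹' {k}) := by
        refine ENNReal.tsum_le_tsum fun k => (hT.volume_tau_image_le n _).trans_eq ?_
        rw [image_add_left, measure_preimage_add]
    _ = _ := by rw [ENNReal.tsum_mul_left, ← hA]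

theorem IsExpandingWith.volumeReal_image_le (hT : T.IsExpandingWith C lam)
    (hb : T.IsBranchChoice b) (n : ℕ) {A : Set ℝ} (hA : A ⊆ Ioo 0 1) (hm : MeasurableSet A) :
    volume.real ((T.selection b)^[n] '' A) ≤ contractionConst C * (lam ^ n)⁻¹ * volume.real A := by
  have := zero_lt_one.trans hT.2.1
  have := contractionConst_pos C
  have h := ENNReal.toReal_mono (ENNReal.mul_lt_top ENNReal.ofReal_lt_top
    (C1Circle.volume_lt_top_of_subset hA)).ne (hT.volume_image_le hb n hm)
  rwa [ENNReal.toReal_mul, ENNReal.toReal_ofReal (by positivity)] at h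

theorem IsExpandingWith.inv_pow_le_one (hT : T.IsExpandingWith C lam) (n : ℕ) :
    (lam ^ n)⁻¹ ≤ 1 := inv_le_one_of_one_le₀ (one_le_pow₀ hT.2.1.le)

/-- Iterated images under two selections differ only by images of the set where the two choices
of branches differ. -/
theorem image_iterate_subset {I A : Set ℝ} (hb' : T.IsBranchChoice b')
    (hI : ∀ s ∈ Ioo (0 : ℝ) 1, b s ≠ b' s → s ∈ I) (hA : A ⊆ Ioo 0 1) (n : ℕ) :
    (T.selection b)^[n] '' A ⊆ (T.selection b')^[n] '' A ∪
      ⋃ i ∈ Finset.range n, (T.selection b)^[i + 1] '' (I ∩ Ioo 0 1) := by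
  induction n with
  | zero => simp
  | succ n ih =>
    rintro _ ⟨a, ha, rfl⟩
    rw [Function.iterate_succ_apply']
    rcases ih ⟨a, ha, rfl⟩ with h | h
    · by_cases hs : b ((T.selection b)^[n] a) = b' ((T.selection b)^[n] a)
      · left
        obtain ⟨a', ha', h'⟩ := h
        refine ⟨a', ha', ?_⟩
        rw [Function.iterate_succ_apply', h', selection, selection, hs]
      · right
        have h01 : (T.selection b)^[n] a ∈ Ioo (0 : ℝ) 1 := hb'.image_subset n hA h
        refine mem_iUnion₂.2 ⟨0, by simp, (T.selection b)^[n] a, ⟨hI _ h01 hs, h01⟩, rfl⟩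
    · right
      obtain ⟨i, hi, s, hs, h⟩ := mem_iUnion₂.1 h
      refine mem_iUnion₂.2 ⟨i + 1, by simpa using hi, s, hs, ?_⟩
      rw [← h, Function.iterate_succ_apply' _ (i + 1)]

/-- A change of branches on `I` is felt at each of the n steps, and each time its further images
have measure at most κ|I|. The growth in n is only linear, which the exponential gain elsewhere
absorbs. -/
theorem IsExpandingWith.volumeReal_image_diff_le (hT : T.IsExpandingWith C lam)
    (hb : T.IsBranchChoice b) (hb' : T.IsBranchChoice b') {I A A' : Set ℝ}
    (hI : ∀ s ∈ Ioo (0 : ℝ) 1, b s ≠ b' s → s ∈ I) (hIm : MeasurableSet I)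
    (hA : A ⊆ Ioo 0 1) (hm : MeasurableSet A) (hm' : MeasurableSet A') (n : ℕ) :
    volume.real ((T.selection b)^[n] '' A \ (T.selection b')^[n] '' A') ≤
      n * contractionConst C * volume.real (I ∩ Ioo 0 1) +
        contractionConst C * volume.real (A \ A') := by
  have hκ := contractionConst_pos C
  have hcoef : ∀ k : ℕ, contractionConst C * (lam ^ k)⁻¹ ≤ contractionConst C := fun k =>
    mul_le_of_le_one_right hκ.le (hT.inv_pow_le_one k)
  have hbound : ∀ (c : ℝ → ℕ), T.IsBranchChoice c → ∀ (k : ℕ) (B : Set ℝ), B ⊆ Ioo 0 1 →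
      MeasurableSet B →
      volume.real ((T.selection c)^[k] '' B) ≤ contractionConst C * volume.real B := by
    intro c hc k B hB hBm
    refine (hT.volumeReal_image_le hc k hB hBm).trans ?_
    gcongr
    exact hcoef k
  have hsub : (T.selection b)^[n] '' A \ (T.selection b')^[n] '' A' ⊆
      (⋃ i ∈ Finset.range n, (T.selection b)^[i + 1] '' (I ∩ Ioo 0 1)) ∪
        (T.selection b')^[n] '' (A \ A') := by
    rintro z ⟨hz, hz'⟩
    rcases image_iterate_subset hb' hI hA n hz with ⟨a, ha, rfl⟩ | h
    · exact Or.inr ⟨a, ⟨ha, fun h => hz' ⟨a, h, rfl⟩⟩, rfl⟩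
    · exact Or.inl h
  have h01 : (⋃ i ∈ Finset.range n, (T.selection b)^[i + 1] '' (I ∩ Ioo 0 1)) ⊆ Ioo 0 1 :=
    iUnion₂_subset fun i _ => hb.image_subset _ inter_subset_right
  refine (measureReal_mono hsub (C1Circle.volume_lt_top_of_subset (union_subset h01
    (hb'.image_subset n (sdiff_subset.trans hA)))).ne).trans ((measureReal_union_le _ _).trans ?_)
  refine add_le_add ((measureReal_biUnion_finset_le _ _).trans ?_)
    (hbound b' hb' n _ (sdiff_subset.trans hA) (hm.diff hm'))
  refine (Finset.sum_le_sum fun i _ => hbound b hb (i + 1) _ inter_subset_right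
    (hIm.inter measurableSet_Ioo)).trans_eq ?_
  rw [Finset.sum_const, Finset.card_range, nsmul_eq_mul, mul_assoc]

/-! ### The integrals of the derivatives of calibrated sub-actions -/

variable (T) in
/-- The functional `f ↦ ∑_{n ≥ 1} ∫ f'` over the `n`-th images of `(x, y]` under a selection. -/
def hullFunctional (b : ℝ → ℕ) (x y : ℝ) : C1Circle →L[ℝ] ℝ :=
  ∑' n : ℕ, C1Circle.integralCLM ((T.selection b)^[n + 1] '' Ioc x y)

theorem Ioc_subset_unit {x y : ℝ} (hx : x ∈ Ioo (0 : ℝ) 1) (hy : y ∈ Ioo (0 : ℝ) 1) :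
    Ioc x y ⊆ Ioo 0 1 := fun _ hs => ⟨hx.1.trans hs.1, hs.2.trans_lt hy.2⟩

theorem IsExpandingWith.norm_integralCLM_image_le (hT : T.IsExpandingWith C lam)
    (hb : T.IsBranchChoice b) {x y : ℝ} (hx : x ∈ Ioo (0 : ℝ) 1) (hy : y ∈ Ioo (0 : ℝ) 1) (n : ℕ) :
    ‖C1Circle.integralCLM ((T.selection b)^[n] '' Ioc x y)‖ ≤ contractionConst C * lam⁻¹ ^ n := by
  have hs := Ioc_subset_unit hx hy
  have := zero_lt_one.trans hT.2.1
  have := contractionConst_pos C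
  refine (C1Circle.norm_integralCLM_le (hb.image_subset n hs)).trans
    ((hT.volumeReal_image_le hb n hs measurableSet_Ioc).trans ?_)
  rw [inv_pow]
  refine mul_le_of_le_one_right (by positivity) ?_
  calc volume.real (Ioc x y) ≤ volume.real (Ioo (0 : ℝ) 1) := measureReal_mono hs (by simp)
    _ = 1 := by simp

theorem IsExpandingWith.inv_lt_one (hT : T.IsExpandingWith C lam) : lam⁻¹ < 1 :=
  inv_lt_one_of_one_lt₀ hT.2.1

theorem IsExpandingWith.inv_nonneg (hT : T.IsExpandingWith C lam) : 0 ≤ lam⁻¹ :=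
  _root_.inv_nonneg.2 (zero_le_one.trans hT.2.1.le)

theorem IsExpandingWith.summable_bound (hT : T.IsExpandingWith C lam) :
    Summable fun n : ℕ => contractionConst C * lam⁻¹ ^ (n + 1) :=
  ((summable_nat_add_iff 1).2 (summable_geometric_of_lt_one hT.inv_nonneg hT.inv_lt_one)).mul_left _

theorem IsExpandingWith.summable_integralCLM (hT : T.IsExpandingWith C lam)
    (hb : T.IsBranchChoice b) {x y : ℝ} (hx : x ∈ Ioo (0 : ℝ) 1) (hy : y ∈ Ioo (0 : ℝ) 1) :
    Summable fun n : ℕ => C1Circle.integralCLM ((T.selection b)^[n + 1] '' Ioc x y) :=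
  Summable.of_norm_bounded hT.summable_bound fun n => hT.norm_integralCLM_image_le hb hx hy (n + 1)

theorem IsExpandingWith.hasSum_hullFunctional (hT : T.IsExpandingWith C lam)
    (hb : T.IsBranchChoice b) {x y : ℝ} (hx : x ∈ Ioo (0 : ℝ) 1) (hy : y ∈ Ioo (0 : ℝ) 1)
    (f : C1Circle) :
    HasSum (fun n : ℕ => ∫ s in (T.selection b)^[n + 1] '' Ioc x y,
      circleDeriv f (s : UnitAddCircle)) (T.hullFunctional b x y f) := by
  have h := (hT.summable_integralCLM hb hx hy).hasSum.mapL (ContinuousLinearMap.apply ℝ ℝ f)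
  exact h.congr_fun fun n => (C1Circle.integralCLM_apply
    (hb.image_subset (n + 1) (Ioc_subset_unit hx hy)) f).symm

theorem volumeReal_Ioc_diff_le (x y x' y' : ℝ) :
    volume.real (Ioc x y \ Ioc x' y') ≤ |x - x'| + |y - y'| := by
  have hsub : Ioc x y \ Ioc x' y' ⊆ Ioc x x' ∪ Ioc y' y := by
    rintro s ⟨hs, hs'⟩
    by_cases h : x' < s
    · exact Or.inr ⟨not_le.1 fun h' => hs' ⟨h, h'⟩, hs.2⟩
    · exact Or.inl ⟨hs.1, not_lt.1 h⟩
  refine (measureReal_mono hsub (by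
    exact ((measure_union_le _ _).trans_lt (by simp)).ne)).trans
    ((measureReal_union_le _ _).trans (add_le_add ?_ ?_))
  · rw [Real.volume_real_Ioc, abs_sub_comm]
    exact max_le (le_abs_self _) (abs_nonneg _)
  · rw [Real.volume_real_Ioc]
    exact max_le (le_abs_self _) (abs_nonneg _)

/-- The first `N` terms are compared one by one, at a cost of order nε each, and the tails are
bounded separately by geometric series. With ε of order λ^{-N} the total is O(N² λ^{-N}). The
endpoints may differ by κε because they will be points of two backward orbits starting ε apart. -/
theorem IsExpandingWith.norm_hullFunctional_sub_le (hT : T.IsExpandingWith C lam)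
    (hb : T.IsBranchChoice b) (hb' : T.IsBranchChoice b') {I : Set ℝ} {ε : ℝ}
    (hI : ∀ s ∈ Ioo (0 : ℝ) 1, b s ≠ b' s → s ∈ I) (hIm : MeasurableSet I)
    (hIε : volume.real (I ∩ Ioo 0 1) ≤ ε) {x y x' y' : ℝ} (hx : x ∈ Ioo (0 : ℝ) 1)
    (hy : y ∈ Ioo (0 : ℝ) 1) (hx' : x' ∈ Ioo (0 : ℝ) 1) (hy' : y' ∈ Ioo (0 : ℝ) 1)
    (hxε : |x - x'| ≤ contractionConst C * ε) (hyε : |y - y'| ≤ contractionConst C * ε) (N : ℕ) :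
    ‖T.hullFunctional b x y - T.hullFunctional b' x' y'‖ ≤
      6 * contractionConst C ^ 2 * N ^ 2 * ε + 2 * contractionConst C / (lam - 1) * lam⁻¹ ^ N := by
  have hκ := one_le_contractionConst C
  have hε : 0 ≤ ε := measureReal_nonneg.trans hIε
  set κ := contractionConst C
  set a : ℕ → C1Circle →L[ℝ] ℝ := fun n =>
    C1Circle.integralCLM ((T.selection b)^[n + 1] '' Ioc x y) -
      C1Circle.integralCLM ((T.selection b')^[n + 1] '' Ioc x' y')
  have hsum : T.hullFunctional b x y - T.hullFunctional b' x' y' = ∑' n, a n :=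
    ((hT.summable_integralCLM hb hx hy).tsum_sub (hT.summable_integralCLM hb' hx' hy')).symm
  have ha1 : ∀ n, ‖a n‖ ≤ 6 * κ ^ 2 * (n + 1) * ε := by
    intro n
    have hs := Ioc_subset_unit hx hy
    have hs' := Ioc_subset_unit hx' hy'
    have hone : ∀ (c c' : ℝ → ℕ) (u v u' v' : ℝ), T.IsBranchChoice c → T.IsBranchChoice c' →
        (∀ s ∈ Ioo (0 : ℝ) 1, c s ≠ c' s → s ∈ I) → Ioc u v ⊆ Ioo 0 1 → Ioc u' v' ⊆ Ioo 0 1 →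
        |u - u'| ≤ κ * ε → |v - v'| ≤ κ * ε →
        volume.real ((T.selection c)^[n + 1] '' Ioc u v \ (T.selection c')^[n + 1] '' Ioc u' v') ≤
          3 * κ ^ 2 * (n + 1) * ε := by
      intro c c' u v u' v' hc hc' hcI h1 h2 hu hv
      refine (hT.volumeReal_image_diff_le hc hc' hcI hIm h1 measurableSet_Ioc
        measurableSet_Ioc (n + 1)).trans ?_
      have h3 : volume.real (Ioc u v \ Ioc u' v') ≤ 2 * (κ * ε) :=
        (volumeReal_Ioc_diff_le u v u' v').trans (by linarith)
      have hn : (0 : ℝ) ≤ n := Nat.cast_nonneg n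
      calc ((n + 1 : ℕ) : ℝ) * κ * volume.real (I ∩ Ioo 0 1) +
            κ * volume.real (Ioc u v \ Ioc u' v')
          ≤ ((n + 1 : ℕ) : ℝ) * κ * ε + κ * (2 * (κ * ε)) := by gcongr
        _ = κ * 1 * ((n + 1) * ε) + 2 * κ ^ 2 * (1 * ε) := by push_cast; ring
        _ ≤ κ * κ * ((n + 1) * ε) + 2 * κ ^ 2 * ((n + 1) * ε) := by
          gcongr
          linarith
        _ = 3 * κ ^ 2 * (n + 1) * ε := by ring
    refine (C1Circle.norm_integralCLM_sub_le (hb.image_subset _ hs) (hb'.image_subset _ hs')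
      (hb.measurableSet_image _ hs measurableSet_Ioc)
      (hb'.measurableSet_image _ hs' measurableSet_Ioc)).trans ?_
    have h1 := hone b b' x y x' y' hb hb' hI hs hs' hxε hyε
    have h2 := hone b' b x' y' x y hb' hb (fun s hs h => hI s hs h.symm) hs' hs
      (by rwa [abs_sub_comm]) (by rwa [abs_sub_comm])
    linarith
  have ha2 : ∀ n, ‖a n‖ ≤ 2 * (κ * lam⁻¹ ^ (n + 1)) := by
    intro n
    refine (norm_sub_le _ _).trans ?_
    have h1 := hT.norm_integralCLM_image_le hb hx hy (n + 1)
    have h2 := hT.norm_integralCLM_image_le hb' hx' hy' (n + 1)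
    linarith
  have hsa : Summable fun n => ‖a n‖ :=
    Summable.of_nonneg_of_le (fun n => norm_nonneg _) ha2 (hT.summable_bound.mul_left 2)
  have hgeo : HasSum (fun n : ℕ => 2 * (κ * lam⁻¹ ^ (n + N + 1)))
      (2 * κ / (lam - 1) * lam⁻¹ ^ N) := by
    have h := (hasSum_geometric_of_lt_one hT.inv_nonneg hT.inv_lt_one).mul_left
      (2 * κ * lam⁻¹ ^ (N + 1))
    have h1 : lam ≠ 0 := (zero_lt_one.trans hT.2.1).ne'
    have h2 : lam - 1 ≠ 0 := (sub_pos.2 hT.2.1).ne'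
    have h3 : 1 - lam⁻¹ = (lam - 1) / lam := by field_simp
    have h4 : 2 * κ * lam⁻¹ ^ (N + 1) * (1 - lam⁻¹)⁻¹ = 2 * κ / (lam - 1) * lam⁻¹ ^ N := by
      rw [h3, pow_succ]
      field_simp
    rw [← h4]
    exact h.congr_fun fun n => by ring
  rw [hsum]
  refine (norm_tsum_le_tsum_norm hsa).trans ?_
  rw [← hsa.sum_add_tsum_nat_add N]
  refine add_le_add ?_ ?_
  · calc ∑ n ∈ Finset.range N, ‖a n‖ ≤ ∑ _n ∈ Finset.range N, 6 * κ ^ 2 * N * ε := by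
          refine Finset.sum_le_sum fun n hn => (ha1 n).trans ?_
          have : (n : ℝ) + 1 ≤ N := by exact_mod_cast Finset.mem_range.1 hn
          gcongr
      _ = 6 * κ ^ 2 * N ^ 2 * ε := by
          rw [Finset.sum_const, Finset.card_range, nsmul_eq_mul]
          ring
  · refine (((summable_nat_add_iff N).2 hsa).tsum_le_tsum (fun n => ha2 (n + N))
      hgeo.summable).trans_eq
      hgeo.tsum_eq

/-! ### Orbit functionals -/

variable (T) in
/-- The backward orbit of `s` along the inverse branches `w 0, w 1, …`. -/
def backwardOrbit (w : ℕ → ℕ) (s : ℝ) : ℕ → ℝ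
  | 0 => s
  | k + 1 => T.tauBranch (w k) (backwardOrbit w s k)

theorem backwardOrbit_eq (w : ℕ → ℕ) (k : ℕ) :
    ∃ m : ℕ, ∀ s, T.backwardOrbit w s k = T.tau^[k] (s + m) := by
  induction k with
  | zero => exact ⟨0, fun s => by simp [backwardOrbit]⟩
  | succ k ih =>
    obtain ⟨m, h⟩ := ih
    refine ⟨m + w k * T.degree ^ k, fun s => ?_⟩
    rw [backwardOrbit, h, Function.iterate_succ_apply', tauBranch]
    push_cast
    rw [← add_assoc, T.tau_iterate_add]

theorem IsExpandingWith.abs_backwardOrbit_sub_le (hT : T.IsExpandingWith C lam) (w : ℕ → ℕ)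
    (k : ℕ) (s t : ℝ) :
    |T.backwardOrbit w s k - T.backwardOrbit w t k| ≤ contractionConst C * |s - t| := by
  obtain ⟨m, h⟩ := T.backwardOrbit_eq w k
  rw [h, h]
  refine (hT.lipschitz_tau_iterate k _ _).trans ?_
  rw [add_sub_add_right_eq_sub]
  have := contractionConst_pos C
  gcongr
  exact mul_le_of_le_one_right this.le (hT.inv_pow_le_one k)

theorem backwardOrbit_mem {w : ℕ → ℕ} (hw : ∀ k, w k < T.degree) {s : ℝ}
    (hs : s ∈ Ioo (0 : ℝ) 1) (k : ℕ) : T.backwardOrbit w s k ∈ Ioo (0 : ℝ) 1 := by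
  induction k with
  | zero => exact hs
  | succ k ih => exact T.tauBranch_mem (hw k) ih

variable (T) in
/-- The functional comparing the values of a calibrated sub-action at two points `z_l`, `z_r` of a
backward orbit: it computes the difference along the orbit and along a chain of intervals. -/
def pairFunctional (b : ℝ → ℕ) (w : ℕ → ℕ) (s : ℝ) (l r : ℕ) : C1Circle →L[ℝ] ℝ :=
  ∑ i ∈ Finset.range r, C1Circle.evalCLM (T.backwardOrbit w s (i + 1)) -
    ∑ i ∈ Finset.range l, C1Circle.evalCLM (T.backwardOrbit w s (i + 1)) +
    T.hullFunctional b (T.backwardOrbit w s l) (T.backwardOrbit w s r)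

theorem IsExpandingWith.norm_pairFunctional_sub_le (hT : T.IsExpandingWith C lam)
    (hb : T.IsBranchChoice b) (hb' : T.IsBranchChoice b') {I : Set ℝ} {ε : ℝ}
    (hI : ∀ s ∈ Ioo (0 : ℝ) 1, b s ≠ b' s → s ∈ I) (hIm : MeasurableSet I)
    (hIε : volume.real (I ∩ Ioo 0 1) ≤ ε) {w : ℕ → ℕ} (hw : ∀ k, w k < T.degree) {s t : ℝ}
    (hs : s ∈ Ioo (0 : ℝ) 1) (ht : t ∈ Ioo (0 : ℝ) 1) (hst : |s - t| ≤ ε) (l r N : ℕ) :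
    ‖T.pairFunctional b w s l r - T.pairFunctional b' w t l r‖ ≤
      ((r + l) * contractionConst C + 6 * contractionConst C ^ 2 * N ^ 2) * ε +
        2 * contractionConst C / (lam - 1) * lam⁻¹ ^ N := by
  have hκ := contractionConst_pos C
  have hz : ∀ k, |T.backwardOrbit w s k - T.backwardOrbit w t k| ≤ contractionConst C * ε :=
    fun k => (hT.abs_backwardOrbit_sub_le w k s t).trans (by gcongr)
  have hsum : ∀ m : ℕ, ‖∑ i ∈ Finset.range m, C1Circle.evalCLM (T.backwardOrbit w s (i + 1)) -
      ∑ i ∈ Finset.range m, C1Circle.evalCLM (T.backwardOrbit w t (i + 1))‖ ≤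
        m * (contractionConst C * ε) := by
    intro m
    rw [← Finset.sum_sub_distrib]
    refine (norm_sum_le_of_le _ fun i _ =>
      (C1Circle.norm_evalCLM_sub_le _ _).trans (hz (i + 1))).trans_eq ?_
    rw [Finset.sum_const, Finset.card_range, nsmul_eq_mul]
  have hhull := hT.norm_hullFunctional_sub_le hb hb' hI hIm hIε (backwardOrbit_mem hw hs l)
    (backwardOrbit_mem hw hs r) (backwardOrbit_mem hw ht l) (backwardOrbit_mem hw ht r)
    (hz l) (hz r) N
  have e : ∀ a a' c c' h h' : C1Circle →L[ℝ] ℝ,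
      a - c + h - (a' - c' + h') = (a - a') - (c - c') + (h - h') := fun _ _ _ _ _ _ => by abel
  rw [pairFunctional, pairFunctional, e]
  refine (norm_add_le _ _).trans ((add_le_add ((norm_sub_le _ _).trans
    (add_le_add (hsum r) (hsum l))) hhull).trans_eq ?_)
  ring

variable (T) in
/-- The combination of two pair functionals which does not involve the maximal ergodic average. -/
def relationFunctional (b : ℝ → ℕ) (w : ℕ → ℕ) (s : ℝ) (P Q : ℕ × ℕ) : C1Circle →L[ℝ] ℝ :=
  ((Q.2 : ℝ) - Q.1) • T.pairFunctional b w s P.1 P.2 -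
    ((P.2 : ℝ) - P.1) • T.pairFunctional b w s Q.1 Q.2

/-- The constant is uniform in the branch choices, the base points and the truncation `N`, as
required to estimate all classes of a covering at once. -/
theorem IsExpandingWith.norm_relationFunctional_sub_le (hT : T.IsExpandingWith C lam)
    {w : ℕ → ℕ} (hw : ∀ k, w k < T.degree) (P Q : ℕ × ℕ) :
    ∃ R > 0, ∀ b b' : ℝ → ℕ, T.IsBranchChoice b → T.IsBranchChoice b' → ∀ (I : Set ℝ) (ε : ℝ),
    (∀ s ∈ Ioo (0 : ℝ) 1, b s ≠ b' s → s ∈ I) → MeasurableSet I →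
    volume.real (I ∩ Ioo 0 1) ≤ ε → ∀ s ∈ Ioo (0 : ℝ) 1, ∀ t ∈ Ioo (0 : ℝ) 1, |s - t| ≤ ε →
    ∀ N : ℕ, ‖T.relationFunctional b w s P Q - T.relationFunctional b' w t P Q‖ ≤
      R * ((1 + N ^ 2) * ε + lam⁻¹ ^ N) := by
  have hκ := contractionConst_pos C
  have hl : 0 < lam - 1 := sub_pos.2 hT.2.1
  have hl0 := hT.inv_nonneg
  set κ := contractionConst C
  set R₀ : ℕ × ℕ → ℝ := fun P => (P.2 + P.1) * κ + 6 * κ ^ 2 + 2 * κ / (lam - 1)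
  have hR₀ : ∀ P, 0 < R₀ P := fun P => by positivity
  refine ⟨|(Q.2 : ℝ) - Q.1| * R₀ P + |(P.2 : ℝ) - P.1| * R₀ Q + 1, by positivity, ?_⟩
  intro b b' hb hb' I ε hI hIm hIε s hs t ht hst N
  have hε : 0 ≤ ε := (abs_nonneg _).trans hst
  have hpair : ∀ P : ℕ × ℕ, ‖T.pairFunctional b w s P.1 P.2 - T.pairFunctional b' w t P.1 P.2‖ ≤
      R₀ P * ((1 + N ^ 2) * ε + lam⁻¹ ^ N) := by
    intro P
    refine (hT.norm_pairFunctional_sub_le hb hb' hI hIm hIε hw hs ht hst P.1 P.2 N).trans ?_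
    have h1 : ((P.2 : ℝ) + P.1) * κ + 6 * κ ^ 2 * N ^ 2 ≤ R₀ P * (1 + N ^ 2) := by
      have h2 : 0 ≤ ((P.2 : ℝ) + P.1) * κ * N ^ 2 := by positivity
      have h3 : 0 ≤ 6 * κ ^ 2 + 2 * κ / (lam - 1) * (1 + (N : ℝ) ^ 2) := by positivity
      simp only [R₀]
      linarith
    have h4 : 2 * κ / (lam - 1) ≤ R₀ P := by
      have h5 : 0 ≤ ((P.2 : ℝ) + P.1) * κ + 6 * κ ^ 2 := by positivity
      simp only [R₀]
      linarith
    rw [mul_add, ← mul_assoc]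
    gcongr
  have e : ∀ (x y : ℝ) (u u' v v' : C1Circle →L[ℝ] ℝ),
      x • u - y • v - (x • u' - y • v') = x • (u - u') - y • (v - v') := fun _ _ _ _ _ _ => by
    rw [smul_sub, smul_sub]; abel
  rw [relationFunctional, relationFunctional, e]
  refine (norm_sub_le _ _).trans ?_
  rw [norm_smul, norm_smul, Real.norm_eq_abs, Real.norm_eq_abs]
  have hX : 0 ≤ (1 + (N : ℝ) ^ 2) * ε + lam⁻¹ ^ N := by positivity
  have h1 := mul_le_mul_of_nonneg_left (hpair P) (abs_nonneg ((Q.2 : ℝ) - Q.1))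
  have h2 := mul_le_mul_of_nonneg_left (hpair Q) (abs_nonneg ((P.2 : ℝ) - P.1))
  rw [add_mul, add_mul, one_mul, mul_assoc, mul_assoc]
  linarith

end AnalyticCircleMap

/-- The class map of `IsThinFamily` is defined on all of `α`; indices outside `A` go to one
additional class, whence the + 1. -/
theorem IsThinFamily.of_classes {E : Type*} [NormedAddCommGroup E] [NormedSpace ℝ E] {α : Type*}
    {A : Set α} {L : α → E →L[ℝ] ℝ}
    (h : ∀ ε > 0, ∃ r > 0, ∃ (X : Type) (_ : Finite X) (cls : A → X),
      (∀ a a', cls a = cls a' → ‖L a - L a'‖ ≤ r) ∧ ((Nat.card X : ℝ) + 1) * r < ε) :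
    IsThinFamily A L := by
  classical
  intro ε hε
  obtain ⟨r, hr, X, _, cls, h1, h2⟩ := h ε hε
  obtain ⟨e⟩ : Nonempty (X ≃ Fin (Nat.card X)) := ⟨Finite.equivFin X⟩
  have h3 : ∀ a : α, ∃ i : Fin (Nat.card X + 1), ∀ ha : a ∈ A, i = (e (cls ⟨a, ha⟩)).castSucc := by
    intro a
    by_cases ha : a ∈ A
    · exact ⟨(e (cls ⟨a, ha⟩)).castSucc, fun _ => rfl⟩
    · exact ⟨Fin.last _, fun h => absurd h ha⟩
  choose k hk using h3
  refine ⟨r, hr, Nat.card X + 1, k, fun a ha a' ha' h4 => h1 ⟨a, ha⟩ ⟨a', ha'⟩ ?_, ?_⟩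
  · rw [hk a ha, hk a' ha'] at h4
    exact e.injective (Fin.castSucc_injective _ h4)
  · rw [Nat.cast_add, Nat.cast_one]
    exact h2

namespace AnalyticCircleMap

variable {T : AnalyticCircleMap}

/-! ### The nested structure of arcs -/

theorem image_arc_cons (i : Fin T.degree) (w : List (Fin T.degree)) :
    T.toFun '' ((fun x : ℝ => (x : UnitAddCircle)) '' (T.tauWord (i :: w) '' Ioo (0 : ℝ) 1)) =
      (fun x : ℝ => (x : UnitAddCircle)) '' (T.tauWord w '' Ioo (0 : ℝ) 1) := by
  simp only [image_image]
  exact image_congr fun x _ => T.apply_tauBranch i _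

theorem image_iterate_mem_arcs (k n : ℕ) {A : Set UnitAddCircle} (hA : A ∈ T.arcs (n + k)) :
    T.toFun^[k] '' A ∈ T.arcs n := by
  induction k generalizing A with
  | zero => simpa using hA
  | succ k ih =>
    obtain ⟨w, hw, rfl⟩ := hA
    obtain ⟨i, w, rfl⟩ := List.exists_cons_of_length_eq_add_one hw
    rw [Function.iterate_succ, image_comp, image_arc_cons]
    exact ih ⟨w, by simpa [← add_assoc] using hw, rfl⟩

theorem preimage_mem_arcs {n : ℕ} {B : Set UnitAddCircle} (hB : B ∈ T.arcs n) (k : ℕ)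
    {x : UnitAddCircle} (hx : T.toFun^[k] x ∈ B) : ∃ A ∈ T.arcs (n + k), x ∈ A := by
  induction k generalizing x with
  | zero => exact ⟨B, hB, hx⟩
  | succ k ih =>
    obtain ⟨A, ⟨w, hw, rfl⟩, hA⟩ := ih (x := T x) hx
    obtain ⟨_, ⟨s, hs, rfl⟩, hxs⟩ := hA
    obtain ⟨i, hi, hxi⟩ := T.exists_eq_tauBranch (T.tauWord_mem w hs) hxs.symm
    exact ⟨_, ⟨⟨i, hi⟩ :: w, by simp [hw, add_assoc], rfl⟩, _, ⟨s, hs, rfl⟩, hxi.symm⟩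

theorem arc_eq_of_inter {n : ℕ} {w v : List (Fin T.degree)} (hw : w.length = n)
    (hv : v.length = n) {s t : ℝ} (hs : s ∈ Ioo (0 : ℝ) 1) (ht : t ∈ Ioo (0 : ℝ) 1)
    (h : T.tauWord w s = T.tauWord v t) : w = v := by
  induction n generalizing w v with
  | zero => rw [List.length_eq_zero_iff.1 hw, List.length_eq_zero_iff.1 hv]
  | succ n ih =>
    obtain ⟨i, w, rfl⟩ := List.exists_cons_of_length_eq_add_one hw
    obtain ⟨j, v, rfl⟩ := List.exists_cons_of_length_eq_add_one hv
    change T.tauBranch i (T.tauWord w s) = T.tauBranch j (T.tauWord v t) at h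
    have h1 : T.tauWord w s = T.tauWord v t := by
      refine UnitAddCircle.coe_inj (T.tauWord_mem w hs) (T.tauWord_mem v ht) ?_
      rw [← T.apply_tauBranch i, h, T.apply_tauBranch]
    have h2 : i = j := by
      rw [h1] at h
      have := T.strictMono_tau.injective h
      exact Fin.ext (by exact_mod_cast add_left_cancel this)
    rw [h2, ih (by simpa using hw) (by simpa using hv) h1]

theorem tauWord_append (w v : List (Fin T.degree)) (s : ℝ) :
    T.tauWord (w ++ v) s = T.tauWord w (T.tauWord v s) := by
  induction w with
  | nil => rfl
  | cons i w ih => exact congrArg (T.tauBranch i) ih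

/-- An arc of level at least `n` is contained in any arc of level `n` which it meets. -/
theorem arc_subset_of_inter {n k : ℕ} {A B : Set UnitAddCircle} (hA : A ∈ T.arcs (n + k))
    (hB : B ∈ T.arcs n) (h : (A ∩ B).Nonempty) : A ⊆ B := by
  obtain ⟨u, hu, rfl⟩ := hA
  obtain ⟨w, hw, rfl⟩ := hB
  obtain ⟨_, ⟨_, ⟨s, hs, rfl⟩, rfl⟩, ⟨_, ⟨t, ht, rfl⟩, hst⟩⟩ := h
  have hst' := UnitAddCircle.coe_inj (T.tauWord_mem w ht) (T.tauWord_mem u hs) hst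
  have e : u.take n ++ u.drop n = u := List.take_append_drop n u
  rw [← e, tauWord_append] at hst'
  have h2 := arc_eq_of_inter hw (by simp [hu]) ht (T.tauWord_mem _ hs) hst'
  rintro _ ⟨_, ⟨x, hx, rfl⟩, rfl⟩
  refine ⟨_, ⟨T.tauWord (u.drop n) x, T.tauWord_mem _ hx, rfl⟩, ?_⟩
  rw [h2, ← tauWord_append, e]

theorem isPreconnected_of_mem_arcs {n : ℕ} {A : Set UnitAddCircle} (hA : A ∈ T.arcs n) :
    IsPreconnected A := by
  obtain ⟨w, -, rfl⟩ := hA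
  have hc : Continuous (T.tauWord w) := by
    induction w with
    | nil => exact continuous_id
    | cons i w ih => exact (T.continuous_tauBranch i).comp ih
  exact (isPreconnected_Ioo.image _ hc.continuousOn).image _
    UnitAddCircle.continuous_coe.continuousOn

theorem zero_notMem_unitArc : (0 : UnitAddCircle) ∉ UnitAddCircle.unitArc := by
  rintro ⟨s, hs, h⟩
  have := UnitAddCircle.injOn_coe (Ioo_subset_Ico_self hs) (left_mem_Ico.2 one_pos)
    (h.trans (AddCircle.coe_zero (p := (1 : ℝ))).symm)
  exact hs.1.ne' this

/-- If the integer part changed, the lifted iterate would take an integer value on [s, t], and there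
Tⁿ would hit 0. -/
theorem floor_lift_iterate_eq (n : ℕ) {s t : ℝ} (hst : s ≤ t)
    (h : ∀ x ∈ Icc s t, T.toFun^[n] (x : UnitAddCircle) ∈ UnitAddCircle.unitArc) :
    ⌊T.lift^[n] s⌋ = ⌊T.lift^[n] t⌋ := by
  refine le_antisymm (Int.floor_mono (T.strictMono_lift.monotone.iterate n hst)) ?_
  by_contra hcon
  rw [not_le, Int.floor_lt] at hcon
  obtain ⟨x, hx, hxe⟩ := intermediate_value_Icc hst (T.continuous_lift.iterate n).continuousOn
    ⟨hcon.le, Int.floor_le (T.lift^[n] t)⟩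
  refine zero_notMem_unitArc ?_
  have h1 := h x hx
  rw [← T.coe_lift_iterate, hxe] at h1
  have h2 := UnitAddCircle.coe_add_intCast 0 ⌊T.lift^[n] t⌋
  rw [zero_add] at h2
  rwa [h2] at h1

end AnalyticCircleMap

/-! ### The branches and the survivors of a marked frame -/

namespace MarkedFrame

open AnalyticCircleMap

variable {T : AnalyticCircleMap} {p : ℕ} (M : MarkedFrame T p)

theorem isOpen_V : IsOpen M.V := by
  obtain ⟨S, hS, -, h⟩ := M.V_eq
  rw [h]
  exact isOpen_sUnion fun A hA => T.isOpen_of_mem_arcs (hS hA)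

theorem V_subset : M.V ⊆ UnitAddCircle.unitArc := by
  obtain ⟨S, hS, -, h⟩ := M.V_eq
  rw [h]
  exact sUnion_subset fun A hA => T.subset_unitArc_of_mem_arcs (hS hA)

theorem arc_subset_V {k : ℕ} {A : Set UnitAddCircle} (hA : A ∈ T.arcs (M.N + k))
    {x : UnitAddCircle} (hxA : x ∈ A) (hx : x ∈ M.V) : A ⊆ M.V := by
  obtain ⟨S, hS, -, h⟩ := M.V_eq
  rw [h] at hx ⊢
  obtain ⟨B, hB, hxB⟩ := hx
  exact (arc_subset_of_inter hA (hS hB) ⟨x, hxA, hxB⟩).trans (subset_sUnion_of_mem hB)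

theorem subset_V'_of_isPreconnected {S : Set UnitAddCircle} (hS : IsPreconnected S)
    (hSV : T.toFun '' S ⊆ M.V) {x : UnitAddCircle} (hxS : x ∈ S) (hx : x ∈ M.V') : S ⊆ M.V' := by
  obtain ⟨R, hR, h⟩ := M.V'_eq
  rw [h] at hx ⊢
  obtain ⟨B, hB, hxB⟩ := hx
  exact (hS.subset_of_mem_components (hR hB) (image_subset_iff.1 hSV) hxS hxB).trans
    (subset_sUnion_of_mem hB)

theorem survivors_subset (n : ℕ) : M.survivors n ⊆ UnitAddCircle.unitArc := fun _ hx =>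
  M.V_subset (M.V'_subset hx.1)

/-- Pull back along the orbit of x the level-`N` arc that contains Tⁿx. The intermediate images of
the pulled-back arc are arcs of level at least `N` meeting `V`, hence inside `V` by nesting; being
connected, the arc cannot leave `V'` either. -/
theorem exists_arc_subset_survivors {n : ℕ} (hn : 1 ≤ n) {x : UnitAddCircle}
    (hx : x ∈ M.survivors n) : ∃ A ∈ T.arcs (M.N + n), x ∈ A ∧ A ⊆ M.survivors n := by
  obtain ⟨S, hS, -, h⟩ := M.V_eq
  have hxn := hx.2 n ⟨hn, le_rfl⟩
  rw [h] at hxn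
  obtain ⟨B, hB, hxB⟩ := hxn
  obtain ⟨A, hA, hxA⟩ := preimage_mem_arcs (hS hB) n hxB
  have hk : ∀ k ∈ Icc 1 n, T.toFun^[k] '' A ⊆ M.V := by
    intro k hk
    refine M.arc_subset_V (k := n - k) (image_iterate_mem_arcs k _ ?_) (mem_image_of_mem _ hxA)
      (hx.2 k hk)
    rwa [add_assoc, Nat.sub_add_cancel hk.2]
  refine ⟨A, hA, hxA, fun y hy => ⟨?_, fun k hk' => hk k hk' (mem_image_of_mem _ hy)⟩⟩
  exact M.subset_V'_of_isPreconnected (isPreconnected_of_mem_arcs hA)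
    (hk 1 ⟨le_rfl, hn⟩) hxA hx.1 hy

/-- Every component contains an arc of level `N + n`, and there are finitely many words. Without
finiteness, `ncard` would not count the components. -/
theorem finite_components_survivors {n : ℕ} (hn : 1 ≤ n) : (components (M.survivors n)).Finite := by
  refine ((List.finite_length_eq (Fin T.degree) (M.N + n)).image fun w =>
    connectedComponentIn (M.survivors n) ((T.tauWord w (1 / 2) : ℝ) : UnitAddCircle)).subset ?_
  rintro _ ⟨x, hx, rfl⟩
  obtain ⟨A, hA, hxA, hAs⟩ := M.exists_arc_subset_survivors hn hx
  have hc := isPreconnected_of_mem_arcs hA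
  obtain ⟨w, hw, rfl⟩ := hA
  refine ⟨w, hw, (connectedComponentIn_eq (hc.subset_connectedComponentIn hxA hAs ?_)).symm⟩
  exact ⟨_, ⟨1 / 2, by norm_num, rfl⟩, rfl⟩

/-- The union of the unmarked components of `V`. -/
def unmarked : Set UnitAddCircle := M.V \ ⋃ ν, M.mark ν

/-- The inverse branch with values in `V'_{ν,+}`. -/
def plusBranch (ν : Fin p) : ℕ := (T.exists_branch_of_mem_arcs (M.markPlus_mem ν)).choose

/-- The inverse branch with values in `V'_{ν,-}`. -/
def minusBranch (ν : Fin p) : ℕ := (T.exists_branch_of_mem_arcs (M.markMinus_mem ν)).choose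

open Classical in
/-- The inverse branch on an unmarked component with values in `V'`. -/
def freeBranch (U : Set UnitAddCircle) : ℕ :=
  if h : U ∈ components M.unmarked then
    (T.exists_branch_of_mem_arcs (M.preimage_unmarked U h)).choose else 0

open Classical in
/-- The choice of inverse branches determined by the positions `c` of the critical values. -/
def branchChoice (c : Fin p → ℝ) (s : ℝ) : ℕ :=
  if h : ∃ ν, (s : UnitAddCircle) ∈ M.mark ν then
    if c h.choose < s then M.plusBranch h.choose else M.minusBranch h.choose
  else M.freeBranch (connectedComponentIn M.unmarked s)

theorem plusBranch_lt (ν : Fin p) : M.plusBranch ν < T.degree :=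
  (T.exists_branch_of_mem_arcs (M.markPlus_mem ν)).choose_spec.1

theorem minusBranch_lt (ν : Fin p) : M.minusBranch ν < T.degree :=
  (T.exists_branch_of_mem_arcs (M.markMinus_mem ν)).choose_spec.1

theorem freeBranch_lt (U : Set UnitAddCircle) : M.freeBranch U < T.degree := by
  rw [freeBranch]
  split_ifs with h
  · exact (T.exists_branch_of_mem_arcs (M.preimage_unmarked U h)).choose_spec.1
  · exact T.degree_pos

theorem eq_of_mem_markPlus {ν : Fin p} {y : UnitAddCircle} (hy : y ∈ M.markPlus ν) {s : ℝ}
    (hs : s ∈ Ioo (0 : ℝ) 1) (h : T y = (s : UnitAddCircle)) :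
    y = ((T.tauBranch (M.plusBranch ν) s : ℝ) : UnitAddCircle) :=
  (T.exists_branch_of_mem_arcs (M.markPlus_mem ν)).choose_spec.2 y hy s hs h

theorem eq_of_mem_markMinus {ν : Fin p} {y : UnitAddCircle} (hy : y ∈ M.markMinus ν) {s : ℝ}
    (hs : s ∈ Ioo (0 : ℝ) 1) (h : T y = (s : UnitAddCircle)) :
    y = ((T.tauBranch (M.minusBranch ν) s : ℝ) : UnitAddCircle) :=
  (T.exists_branch_of_mem_arcs (M.markMinus_mem ν)).choose_spec.2 y hy s hs h

theorem eq_of_mem_unmarked {U : Set UnitAddCircle} (hU : U ∈ components M.unmarked)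
    {y : UnitAddCircle} (hyV : y ∈ M.V') {s : ℝ} (hs : s ∈ Ioo (0 : ℝ) 1)
    (h : T y = (s : UnitAddCircle)) (hsU : (s : UnitAddCircle) ∈ U) :
    y = ((T.tauBranch (M.freeBranch U) s : ℝ) : UnitAddCircle) := by
  rw [freeBranch, dif_pos hU]
  exact (T.exists_branch_of_mem_arcs (M.preimage_unmarked U hU)).choose_spec.2 y
    ⟨by rwa [mem_preimage, h], hyV⟩ s hs h

theorem mark_eq {ν ν' : Fin p} {x : UnitAddCircle} (h : x ∈ M.mark ν) (h' : x ∈ M.mark ν') :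
    ν = ν' := by
  by_contra hne
  exact disjoint_left.1 (disjoint_of_mem_components (M.mark_mem ν) (M.mark_mem ν')
    fun e => hne (M.mark_injective e)) h h'

theorem branchChoice_of_mem_mark (c : Fin p → ℝ) {s : ℝ} {ν : Fin p}
    (h : (s : UnitAddCircle) ∈ M.mark ν) :
    M.branchChoice c s = if c ν < s then M.plusBranch ν else M.minusBranch ν := by
  have hex : ∃ ν, (s : UnitAddCircle) ∈ M.mark ν := ⟨ν, h⟩
  rw [branchChoice, dif_pos hex, M.mark_eq hex.choose_spec h]

theorem branchChoice_of_notMem_mark (c : Fin p → ℝ) {s : ℝ}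
    (h : ∀ ν, (s : UnitAddCircle) ∉ M.mark ν) :
    M.branchChoice c s = M.freeBranch (connectedComponentIn M.unmarked s) := by
  rw [branchChoice, dif_neg (not_exists.2 h)]

theorem isOpen_mark (ν : Fin p) : IsOpen (M.mark ν) :=
  isOpen_of_mem_components M.isOpen_V (M.mark_mem ν)

/-- The marks are entire components of `V`, so removing them leaves the other components unchanged.
-/
theorem connectedComponentIn_unmarked {x : UnitAddCircle} (hx : x ∈ M.unmarked) :
    connectedComponentIn M.unmarked x = connectedComponentIn M.V x := by
  refine (connectedComponentIn_mono x sdiff_subset).antisymm ?_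
  refine isPreconnected_connectedComponentIn.subset_connectedComponentIn
    (mem_connectedComponentIn hx.1) fun y hy => ⟨connectedComponentIn_subset _ _ hy, fun hy' => ?_⟩
  obtain ⟨ν, hν⟩ := mem_iUnion.1 hy'
  exact hx.2 (mem_iUnion.2 ⟨ν, isPreconnected_connectedComponentIn.subset_of_mem_components
    (M.mark_mem ν) (connectedComponentIn_subset _ _) hy hν (mem_connectedComponentIn hx.1)⟩)

theorem isBranchChoice (c : Fin p → ℝ) : T.IsBranchChoice (M.branchChoice c) := by
  refine ⟨measurable_to_countable' fun i => ?_, fun s => ?_⟩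
  · have hmark : ∀ ν, IsOpen {s : ℝ | (s : UnitAddCircle) ∈ M.mark ν} := fun ν =>
      (M.isOpen_mark ν).preimage UnitAddCircle.continuous_coe
    have hcomp : ∀ s : ℝ, IsOpen {t : ℝ | (t : UnitAddCircle) ∈ connectedComponentIn M.V s} :=
      fun s => M.isOpen_V.connectedComponentIn.preimage UnitAddCircle.continuous_coe
    -- The fibres are cut out of the open marks by half-lines, and are unions of open components on
    -- the unmarked part. Outside `V` the component is empty, so the choice there is the constant
    -- `freeBranch ∅`.
    have e : M.branchChoice c ⁻¹' {i} =
        (⋃ ν, {s : ℝ | (s : UnitAddCircle) ∈ M.mark ν} ∩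
          (Ioi (c ν) ∩ {_s | M.plusBranch ν = i} ∪ Iic (c ν) ∩ {_s | M.minusBranch ν = i})) ∪
        ((⋃ ν, {s : ℝ | (s : UnitAddCircle) ∈ M.mark ν})ᶜ ∩
          ((⋃ s ∈ {s : ℝ | (s : UnitAddCircle) ∈ M.unmarked ∧
              M.freeBranch (connectedComponentIn M.unmarked s) = i},
              {t : ℝ | (t : UnitAddCircle) ∈ connectedComponentIn M.V s}) ∪
            ({s : ℝ | (s : UnitAddCircle) ∈ M.V}ᶜ ∩ {_s | M.freeBranch ∅ = i}))) := by
      ext s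
      by_cases h : ∃ ν, (s : UnitAddCircle) ∈ M.mark ν
      · obtain ⟨ν, hν⟩ := h
        have h1 : ∀ ν', (s : UnitAddCircle) ∈ M.mark ν' ↔ ν' = ν :=
          fun ν' => ⟨fun h' => M.mark_eq h' hν, fun h' => h' ▸ hν⟩
        simp only [mem_preimage, mem_singleton_iff, M.branchChoice_of_mem_mark c hν, mem_union,
          mem_iUnion, mem_inter_iff, mem_ofPred_eq, h1, exists_eq_left, mem_compl_iff, exists_eq,
          not_true, false_and, or_false, mem_Ioi, mem_Iic]
        split_ifs with h2
        · simp [h2]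
        · simp [h2, not_lt.1 h2]
      · push Not at h
        have h1 : s ∉ ⋃ ν, {s : ℝ | (s : UnitAddCircle) ∈ M.mark ν} := by simpa using h
        have h2 : s ∉ ⋃ ν, {s : ℝ | (s : UnitAddCircle) ∈ M.mark ν} ∩
          (Ioi (c ν) ∩ {_s | M.plusBranch ν = i} ∪ Iic (c ν) ∩ {_s | M.minusBranch ν = i}) := by
          simp [h]
        rw [mem_preimage, mem_singleton_iff, M.branchChoice_of_notMem_mark c h, mem_union,
          or_iff_right h2, mem_inter_iff, and_iff_right (mem_compl h1), mem_union]
        by_cases hV : (s : UnitAddCircle) ∈ M.V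
        · have hu : (s : UnitAddCircle) ∈ M.unmarked := ⟨hV, by simpa using h⟩
          rw [or_iff_left (fun h' => h'.1 hV)]
          constructor
          · intro h3
            exact mem_iUnion₂.2 ⟨s, ⟨hu, h3⟩, mem_connectedComponentIn hV⟩
          · intro h3
            obtain ⟨t, ⟨ht, hti⟩, hst⟩ := mem_iUnion₂.1 h3
            rw [← hti, M.connectedComponentIn_unmarked hu, M.connectedComponentIn_unmarked ht,
              connectedComponentIn_eq hst]
        · have hu : (s : UnitAddCircle) ∉ M.unmarked := fun h' => hV h'.1
          rw [connectedComponentIn_eq_empty hu, or_iff_right]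
          · exact ⟨fun h' => ⟨hV, h'⟩, fun h' => h'.2⟩
          · intro h3
            obtain ⟨t, -, hst⟩ := mem_iUnion₂.1 h3
            exact hV (connectedComponentIn_subset _ _ hst)
    rw [e]
    refine MeasurableSet.union (MeasurableSet.iUnion fun ν => (hmark ν).measurableSet.inter
      ((measurableSet_Ioi.inter (MeasurableSet.const _)).union
        (measurableSet_Iic.inter (MeasurableSet.const _)))) ?_
    refine (MeasurableSet.iUnion fun ν => (hmark ν).measurableSet).compl.inter
      (MeasurableSet.union ?_ ?_)
    · exact (isOpen_biUnion fun s _ => hcomp s).measurableSet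
    · exact (M.isOpen_V.preimage UnitAddCircle.continuous_coe).measurableSet.compl.inter
        (MeasurableSet.const _)
  · rw [branchChoice]
    split_ifs with h h'
    · exact M.plusBranch_lt _
    · exact M.minusBranch_lt _
    · exact M.freeBranch_lt _

/-- The cuts enter the choice only through comparisons inside the marks, so two choices disagree at
most between corresponding cuts: a set of measure at most p times the largest displacement. -/
theorem mem_uIcc_of_branchChoice_ne {c c' : Fin p → ℝ} {s : ℝ}
    (h : M.branchChoice c s ≠ M.branchChoice c' s) : s ∈ ⋃ ν, uIcc (c ν) (c' ν) := by
  by_cases hm : ∃ ν, (s : UnitAddCircle) ∈ M.mark ν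
  · obtain ⟨ν, hν⟩ := hm
    rw [M.branchChoice_of_mem_mark c hν, M.branchChoice_of_mem_mark c' hν] at h
    refine mem_iUnion.2 ⟨ν, mem_uIcc.2 ?_⟩
    by_cases h1 : c ν < s <;> by_cases h2 : c' ν < s
    · simp [h1, h2] at h
    · exact Or.inl ⟨h1.le, not_lt.1 h2⟩
    · exact Or.inr ⟨h2.le, not_lt.1 h1⟩
    · simp [h1, h2] at h
  · push Not at hm
    rw [M.branchChoice_of_notMem_mark c hm, M.branchChoice_of_notMem_mark c' hm] at h
    exact absurd rfl h

/-! ### Coverings of the possible critical values -/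

/-- The images of the points which survive forever. -/
def survivorValues : Set ℝ :=
  {s | s ∈ Ioo (0 : ℝ) 1 ∧ ∃ y ∈ Ioo (0 : ℝ) 1, (∀ n, (y : UnitAddCircle) ∈ M.survivors n) ∧
    T (y : UnitAddCircle) = (s : UnitAddCircle)}

theorem eq_fract_of_coe_eq {s x : ℝ} (hs : s ∈ Ioo (0 : ℝ) 1)
    (h : (x : UnitAddCircle) = (s : UnitAddCircle)) : s = Int.fract x := by
  obtain ⟨m, rfl⟩ := UnitAddCircle.coe_eq_coe_iff.1 h.symm
  rw [Int.fract_add_intCast, Int.fract_eq_self.2 ⟨hs.1.le, hs.2⟩]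

/-- On a component of V^n the first n images avoid 0, so the n-th lifted images have the same
integer part and are at most 1 apart; expansion then puts y and y' within O(λ^{-n}). Passing to s
and s' costs one Lipschitz constant of T. -/
theorem _root_.AnalyticCircleMap.IsExpandingWith.exists_abs_sub_le {C lam : ℝ}
    (hT : T.IsExpandingWith C lam) (M : MarkedFrame T p) :
    ∃ R > 0, ∀ n, 1 ≤ n → ∀ y ∈ Ioo (0 : ℝ) 1, ∀ y' ∈ Ioo (0 : ℝ) 1,
      (y : UnitAddCircle) ∈ M.survivors n → (y' : UnitAddCircle) ∈ M.survivors n →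
      connectedComponentIn (M.survivors n) y = connectedComponentIn (M.survivors n) y' →
      ∀ s ∈ Ioo (0 : ℝ) 1, ∀ s' ∈ Ioo (0 : ℝ) 1, T (y : UnitAddCircle) = (s : UnitAddCircle) →
      T (y' : UnitAddCircle) = (s' : UnitAddCircle) → |s - s'| ≤ R * lam⁻¹ ^ n := by
  obtain ⟨Λ, hΛ, hlip⟩ := T.exists_lipschitz_lift
  have hκ := contractionConst_pos C
  have hl : 0 < lam := zero_lt_one.trans hT.2.1
  refine ⟨Λ * contractionConst C, by positivity, ?_⟩
  intro n hn y hy y' hy' hyn hyn' hcc s hs s' hs' hTs hTs'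
  wlog hle : y ≤ y' generalizing y y' s s'
  · rw [abs_sub_comm]
    exact this y' hy' y hy hyn' hyn hcc.symm s' hs' s hs hTs' hTs (le_of_not_ge hle)
  have hcon : ∀ x ∈ Icc y y', (x : UnitAddCircle) ∈ M.survivors n := by
    intro x hx
    have hoc := (isPreconnected_connectedComponentIn (F := M.survivors n)
      (x := (y : UnitAddCircle))).ordConnected_coe_preimage
        ((connectedComponentIn_subset _ _).trans (M.survivors_subset n))
    exact connectedComponentIn_subset _ _ (hoc.out ⟨hy, mem_connectedComponentIn hyn⟩
      ⟨hy', hcc ▸ mem_connectedComponentIn hyn'⟩ hx).2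
  have hfloor : ∀ k ∈ Icc 1 n, ⌊T.lift^[k] y⌋ = ⌊T.lift^[k] y'⌋ := fun k hk =>
    floor_lift_iterate_eq k hle fun x hx => M.V_subset ((hcon x hx).2 k hk)
  have hdiff : T.lift^[n] y' - T.lift^[n] y ≤ 1 := by
    have h1 := Int.lt_floor_add_one (T.lift^[n] y')
    have h2 := Int.floor_le (T.lift^[n] y)
    rw [hfloor n ⟨hn, le_rfl⟩] at h2
    linarith
  have hyy : y' - y ≤ contractionConst C * lam⁻¹ ^ n := by
    refine (hT.sub_le n hle).trans ?_
    rw [inv_pow]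
    exact mul_le_of_le_one_right (by positivity) hdiff
  have h1 := hfloor 1 ⟨le_rfl, hn⟩
  simp only [Function.iterate_one] at h1
  rw [← T.coe_lift] at hTs hTs'
  rw [eq_fract_of_coe_eq hs hTs, eq_fract_of_coe_eq hs' hTs', Int.fract, Int.fract, h1,
    sub_sub_sub_cancel_right, mul_assoc]
  refine (hlip y (Ioo_subset_Icc_self hy) y' (Ioo_subset_Icc_self hy')).trans ?_
  gcongr
  rwa [abs_sub_comm, abs_of_nonneg (sub_nonneg.2 hle)]

/-- The only place where the bound on the complexity enters: the number of p-tuples of components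
grows more slowly than λⁿ, with an exponential margin that absorbs the factor 1 + n². -/
theorem tendsto_card_pow_mul {lam : ℝ} (hl : 1 < lam) (hp : 1 ≤ p)
    (hM : M.complexity < ((1 / (p : ℝ) * Real.log lam : ℝ) : EReal)) :
    Tendsto (fun n : ℕ => (((components (M.survivors n)).ncard : ℝ) ^ p + 1) *
      ((1 + (n : ℝ) ^ 2) * lam⁻¹ ^ n)) atTop (𝓝 0) := by
  obtain ⟨h, hh1, hh2⟩ := EReal.lt_iff_exists_real_btwn.1 hM
  rw [EReal.coe_lt_coe_iff] at hh2
  have hev := eventually_lt_of_limsup_lt hh1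
  have hp0 : (0 : ℝ) < p := by exact_mod_cast hp
  have hlog := Real.log_pos hl
  -- A nonnegative rate makes the exponential at least 1, which covers both an empty V^n and the
  -- additional class.
  set h' := max h 0
  have hh' : h' < 1 / (p : ℝ) * Real.log lam := max_lt hh2 (by positivity)
  set q := Real.exp (p * h') * lam⁻¹
  have hq0 : 0 ≤ q := by positivity
  have hq1 : q < 1 := by
    have h1 : p * h' < Real.log lam := by
      rw [one_div, inv_mul_eq_div, lt_div_iff₀ hp0] at hh'
      linarith
    have h2 : Real.exp (p * h') < lam := by
      rwa [← Real.lt_log_iff_exp_lt (zero_lt_one.trans hl)]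
    rw [show q = Real.exp (p * h') / lam from rfl, div_lt_one (zero_lt_one.trans hl)]
    exact h2
  have hgeo : Tendsto (fun n : ℕ => 2 * (q ^ n + (n : ℝ) ^ 2 * q ^ n)) atTop (𝓝 0) := by
    have h1 := tendsto_pow_atTop_nhds_zero_of_lt_one hq0 hq1
    have h2 := tendsto_pow_const_mul_const_pow_of_lt_one 2 hq0 hq1
    simpa using (h1.add h2).const_mul 2
  refine squeeze_zero' (Eventually.of_forall fun n => by positivity) ?_ hgeo
  filter_upwards [hev, eventually_ge_atTop 1] with n hn hn1
  rw [EReal.coe_lt_coe_iff] at hn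
  have hn0 : (0 : ℝ) < n := by exact_mod_cast hn1
  set k := (components (M.survivors n)).ncard
  have hk : (k : ℝ) ≤ Real.exp (n * h') := by
    rcases Nat.eq_zero_or_pos k with h0 | h0
    · rw [h0, Nat.cast_zero]
      positivity
    · rw [← Real.log_le_iff_le_exp (by exact_mod_cast h0)]
      have h3 : 1 / (n : ℝ) * Real.log k ≤ h' := hn.le.trans (le_max_left _ _)
      rwa [one_div, inv_mul_eq_div, div_le_iff₀ hn0, mul_comm] at h3
  have hkp : (k : ℝ) ^ p + 1 ≤ 2 * Real.exp (p * h') ^ n := by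
    have h3 : (k : ℝ) ^ p ≤ Real.exp (p * h') ^ n := by
      calc (k : ℝ) ^ p ≤ Real.exp (n * h') ^ p := by gcongr
        _ = Real.exp (p * h') ^ n := by
          rw [← Real.exp_nat_mul, ← Real.exp_nat_mul]
          ring_nf
    have h4 : 1 ≤ Real.exp (p * h') ^ n :=
      one_le_pow₀ (Real.one_le_exp (mul_nonneg hp0.le (le_max_right _ _)))
    linarith
  have hl0 : 0 < lam := zero_lt_one.trans hl
  calc ((k : ℝ) ^ p + 1) * ((1 + (n : ℝ) ^ 2) * lam⁻¹ ^ n)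
      ≤ 2 * Real.exp (p * h') ^ n * ((1 + (n : ℝ) ^ 2) * lam⁻¹ ^ n) := by gcongr
    _ = 2 * (q ^ n + (n : ℝ) ^ 2 * q ^ n) := by
      simp only [q, mul_pow]
      ring

/-- The class of c records, for each ν, the component of V^n that contains a chosen preimage of c_ν.
Cuts in one class are O(λ^{-n}) apart, and the modulus of continuity, truncated at the same n, gives
O(n² λ^{-n}). -/
theorem isThinFamily_relationFunctional {C lam : ℝ} (hT : T.IsExpandingWith C lam) (hp : 1 ≤ p)
    (hM : M.complexity < ((1 / (p : ℝ) * Real.log lam : ℝ) : EReal)) {w : ℕ → ℕ}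
    (hw : ∀ k, w k < T.degree) (P Q : ℕ × ℕ) :
    IsThinFamily {c : Fin p → ℝ | ∀ ν, c ν ∈ M.survivorValues}
      (fun c => T.relationFunctional (M.branchChoice c) w (c ⟨0, hp⟩) P Q) := by
  obtain ⟨R, hR, hmod⟩ := hT.norm_relationFunctional_sub_le hw P Q
  obtain ⟨R', hR', hdist⟩ := hT.exists_abs_sub_le M
  have hl : 0 < lam := zero_lt_one.trans hT.2.1
  have hp0 : (0 : ℝ) < p := by exact_mod_cast hp
  refine IsThinFamily.of_classes fun ε hε => ?_
  set K := R * (p * R' + 1)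
  have hK : 0 < K := by positivity
  have htend := (M.tendsto_card_pow_mul hT.2.1 hp hM).const_mul K
  rw [mul_zero] at htend
  obtain ⟨n, hnε, hn⟩ := ((htend.eventually_lt_const hε).and (eventually_ge_atTop 1)).exists
  have hfin := M.finite_components_survivors hn
  have hfin' : Finite (components (M.survivors n)) := hfin
  set A := {c : Fin p → ℝ | ∀ ν, c ν ∈ M.survivorValues}
  choose! y hy hys hyT using fun (s : ℝ) (hs : s ∈ M.survivorValues) => hs.2
  refine ⟨K * ((1 + (n : ℝ) ^ 2) * lam⁻¹ ^ n), by positivity, Fin p → components (M.survivors n),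
    inferInstance, fun c ν => ⟨connectedComponentIn (M.survivors n) (y (c.1 ν) : ℝ),
      ⟨_, hys _ (c.2 ν) n, rfl⟩⟩, ?_, ?_⟩
  · rintro ⟨c, hc⟩ ⟨c', hc'⟩ hcc
    have hcν : ∀ ν, |c ν - c' ν| ≤ R' * lam⁻¹ ^ n := fun ν =>
      hdist n hn _ (hy _ (hc ν)) _ (hy _ (hc' ν)) (hys _ (hc ν) n) (hys _ (hc' ν) n)
        (congrArg Subtype.val (congrFun hcc ν)) _ (hc ν).1 _ (hc' ν).1 (hyT _ (hc ν))
        (hyT _ (hc' ν))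
    set δ := p * (R' * lam⁻¹ ^ n)
    have hvol : volume.real ((⋃ ν, uIcc (c ν) (c' ν)) ∩ Ioo 0 1) ≤ δ := by
      have hfinite : volume (⋃ ν, uIcc (c ν) (c' ν)) ≠ ⊤ := by
        refine ((measure_iUnion_fintype_le _ _).trans_lt (ENNReal.sum_lt_top.2 fun ν _ => ?_)).ne
        rw [Real.volume_interval]
        exact ENNReal.ofReal_lt_top
      refine (measureReal_mono inter_subset_left hfinite).trans
        ((measureReal_iUnion_fintype_le _).trans ?_)
      refine (Finset.sum_le_sum fun ν _ => (?_ : _ ≤ R' * lam⁻¹ ^ n)).trans_eq ?_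
      · rw [measureReal_def, Real.volume_interval, ENNReal.toReal_ofReal (abs_nonneg _),
          abs_sub_comm]
        exact hcν ν
      · rw [Finset.sum_const, Finset.card_univ, Fintype.card_fin, nsmul_eq_mul]
    have h0 : |c ⟨0, hp⟩ - c' ⟨0, hp⟩| ≤ δ := (hcν _).trans
      (le_mul_of_one_le_left (by positivity) (by exact_mod_cast hp))
    refine (hmod _ _ (M.isBranchChoice c) (M.isBranchChoice c') _ δ
      (fun s _ h => M.mem_uIcc_of_branchChoice_ne h)
      (MeasurableSet.iUnion fun ν => measurableSet_uIcc) hvol _ (hc _).1 _ (hc' _).1 h0 n).trans ?_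
    have e : K * ((1 + (n : ℝ) ^ 2) * lam⁻¹ ^ n) =
        R * ((1 + (n : ℝ) ^ 2) * δ + (1 + (n : ℝ) ^ 2) * lam⁻¹ ^ n) := by
      simp only [K, δ]
      ring
    rw [e]
    gcongr
    exact le_mul_of_one_le_left (by positivity) (by nlinarith)
  · rw [Nat.card_fun, Nat.card_fin, Nat.card_coe_set_eq]
    push_cast
    calc _ = K * ((((components (M.survivors n)).ncard : ℝ) ^ p + 1) *
        ((1 + (n : ℝ) ^ 2) * lam⁻¹ ^ n)) := by ring
      _ < ε := hnε

end MarkedFrame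

/-! ### Contact sets of calibrated sub-actions -/

namespace AnalyticCircleMap

variable {T : AnalyticCircleMap} {f g : UnitAddCircle → ℝ}

theorem surjective_toFun : Function.Surjective T.toFun := fun x => by
  refine ⟨((T.tau (UnitAddCircle.coord x) : ℝ) : UnitAddCircle), ?_⟩
  rw [← T.coe_lift, T.lift_tau, UnitAddCircle.coe_coord]

theorem mapsTo_forwardContactSet :
    MapsTo T.toFun (forwardContactSet T f g) (forwardContactSet T f g) := fun x hx n => by
  have h := hx (n + 1)
  rwa [Function.iterate_succ_apply] at h

/-- Calibration says that g + f has supremum g(x) + β on the fibre over x. The fibre is compact, and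
a point attaining the supremum lies in the contact set. -/
theorem exists_preimage_forwardContactSet (hf : Continuous f)
    (hg : IsCalibratedSubAction T f g) {x : UnitAddCircle} (hx : x ∈ forwardContactSet T f g) :
    ∃ y ∈ forwardContactSet T f g, T y = x := by
  have hc : IsCompact (T.toFun ⁻¹' {x}) :=
    (isClosed_singleton.preimage T.continuous_toFun).isCompact
  obtain ⟨y, hy, hmax⟩ := hc.exists_isMaxOn (surjective_toFun x) ((hg.1.1.add hf).continuousOn)
  have hlub := hg.2.2 x
  have h1 : IsLUB ((fun y => g y + f y) '' (T.toFun ⁻¹' {x})) (g y + f y) :=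
    IsGreatest.isLUB ⟨⟨y, hy, rfl⟩, by rintro _ ⟨z, hz, rfl⟩; exact hmax hz⟩
  have hyx : T y = x := hy
  refine ⟨y, fun n => ?_, hyx⟩
  cases n with
  | zero =>
    change g y + f y = g (T y) + maxErgodicAverage T f
    rw [hyx]
    exact h1.unique hlub
  | succ n =>
    rw [Function.iterate_succ_apply, hyx]
    exact hx n

theorem isClosed_forwardContactSet (hf : Continuous f) (hg : Continuous g) :
    IsClosed (forwardContactSet T f g) := by
  have h : IsClosed (contactSet T f g) :=
    isClosed_eq (hg.add hf) ((hg.comp T.continuous_toFun).add continuous_const)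
  have e : forwardContactSet T f g = ⋂ n : ℕ, T.toFun^[n] ⁻¹' contactSet T f g := by
    ext x
    simp [forwardContactSet]
  rw [e]
  exact isClosed_iInter fun n => h.preimage (T.continuous_toFun.iterate n)

/-- For a calibrated g, T maps the forward contact set onto itself, so the intersection of its
images removes nothing. -/
theorem invariantContactSet_eq (hf : Continuous f) (hg : IsCalibratedSubAction T f g) :
    invariantContactSet T f g = forwardContactSet T f g := by
  refine Subset.antisymm (fun x hx => ?_) (subset_iInter fun n => ?_)
  · have h := mem_iInter.1 hx 0
    simpa using h
  · induction n with
    | zero => simp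
    | succ n ih =>
      intro x hx
      obtain ⟨y, hy, rfl⟩ := ih hx
      obtain ⟨z, hz, rfl⟩ := exists_preimage_forwardContactSet hf hg hy
      exact ⟨z, hz, by rw [Function.iterate_succ_apply]⟩

theorem mapsTo_maximizingSet (hf : Continuous f) :
    MapsTo T.toFun (maximizingSet T f) (maximizingSet T f) := by
  intro x hx
  obtain ⟨g, hg, hxg⟩ := mem_iUnion₂.1 hx
  rw [invariantContactSet_eq hf hg] at hxg
  refine mem_iUnion₂.2 ⟨g, hg, ?_⟩
  rw [invariantContactSet_eq hf hg]
  exact mapsTo_forwardContactSet hxg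

theorem lift_iterate_add_natCast (n : ℕ) (x : ℝ) (m : ℕ) :
    T.lift^[n] (x + m) = T.lift^[n] x + m * (T.degree : ℝ) ^ n := by
  induction n generalizing x m with
  | zero => simp
  | succ n ih =>
    rw [Function.iterate_succ_apply, Function.iterate_succ_apply, T.lift_add_natCast]
    have h := ih (T.lift x) (m * T.degree)
    push_cast at h
    rw [h]
    ring

end AnalyticCircleMap

/-! ### Sets adapted to a marked frame -/

namespace MarkedFrame

open AnalyticCircleMap

variable {T : AnalyticCircleMap} {p : ℕ} {M : MarkedFrame T p} {c : Fin p → ℝ}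
  {K : Set UnitAddCircle}

/-- A closed invariant set whose backward dynamics follows the branches of the frame cut at the
points `c`. -/
structure IsAdapted (M : MarkedFrame T p) (c : Fin p → ℝ) (K : Set UnitAddCircle) : Prop where
  isClosed : IsClosed K
  subset_V : K ⊆ M.V
  mapsTo : MapsTo T.toFun K K
  exists_preimage : ∀ x ∈ K, ∃ y ∈ K, T y = x
  cut_mem : ∀ ν, c ν ∈ Ioo (0 : ℝ) 1
  cut_mem_mark : ∀ ν, (c ν : UnitAddCircle) ∈ M.mark ν
  right : ∀ ν, ∀ y ∈ K, T y ∈ rightPart (M.mark ν) (c ν : UnitAddCircle) → y ∈ M.markPlus ν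
  left : ∀ ν, ∀ y ∈ K, T y ∈ leftPart (M.mark ν) (c ν : UnitAddCircle) → y ∈ M.markMinus ν
  free : ∀ U ∈ components M.unmarked, ∀ y ∈ K, T y ∈ U → y ∈ M.V'

/-- The coordinates of the points of a subset of the circle without `0`. -/
def coords (K : Set UnitAddCircle) : Set ℝ := {s | s ∈ Ioo (0 : ℝ) 1 ∧ (s : UnitAddCircle) ∈ K}

theorem mark_subset (ν : Fin p) : M.mark ν ⊆ UnitAddCircle.unitArc :=
  (subset_of_mem_components (M.mark_mem ν)).trans M.V_subset

theorem ordConnected_coords_mark (ν : Fin p) : (coords (M.mark ν)).OrdConnected :=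
  (isPreconnected_of_mem_components (M.mark_mem ν)).ordConnected_coe_preimage (mark_subset ν)

theorem mem_rightPart (hc : ∀ ν, c ν ∈ Ioo (0 : ℝ) 1)
    (hcm : ∀ ν, (c ν : UnitAddCircle) ∈ M.mark ν) {ν : Fin p} {s : ℝ} (hs : s ∈ Ioo (0 : ℝ) 1)
    (hsm : (s : UnitAddCircle) ∈ M.mark ν) (h : c ν < s) :
    (s : UnitAddCircle) ∈ rightPart (M.mark ν) (c ν : UnitAddCircle) := by
  refine ⟨s - c ν, sub_pos.2 h, ?_, fun u hu => ?_⟩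
  · rw [← AddCircle.coe_add, add_sub_cancel]
  · rw [← AddCircle.coe_add]
    exact ((ordConnected_coords_mark ν).out ⟨hc ν, hcm ν⟩ ⟨hs, hsm⟩
      ⟨by linarith [hu.1], by linarith [hu.2]⟩).2

theorem mem_leftPart (hc : ∀ ν, c ν ∈ Ioo (0 : ℝ) 1)
    (hcm : ∀ ν, (c ν : UnitAddCircle) ∈ M.mark ν) {ν : Fin p} {s : ℝ} (hs : s ∈ Ioo (0 : ℝ) 1)
    (hsm : (s : UnitAddCircle) ∈ M.mark ν) (h : s < c ν) :
    (s : UnitAddCircle) ∈ leftPart (M.mark ν) (c ν : UnitAddCircle) := by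
  refine ⟨c ν - s, sub_pos.2 h, ?_, fun u hu => ?_⟩
  · rw [← AddCircle.coe_sub, sub_sub_cancel]
  · rw [← AddCircle.coe_sub]
    exact ((ordConnected_coords_mark ν).out ⟨hs, hsm⟩ ⟨hc ν, hcm ν⟩
      ⟨by linarith [hu.2], by linarith [hu.1]⟩).2

namespace IsAdapted

variable (h : M.IsAdapted c K)
include h

theorem tauBranch_plus_mem {ν : Fin p} {s : ℝ} (hs : s ∈ coords K)
    (hsm : (s : UnitAddCircle) ∈ M.mark ν) (hcs : c ν < s) :
    T.tauBranch (M.plusBranch ν) s ∈ coords K := by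
  obtain ⟨y, hy, hys⟩ := h.exists_preimage _ hs.2
  refine ⟨T.tauBranch_mem (M.plusBranch_lt ν) hs.1, ?_⟩
  rwa [← M.eq_of_mem_markPlus (h.right ν y hy (by
    rw [hys]; exact mem_rightPart h.cut_mem h.cut_mem_mark hs.1 hsm hcs)) hs.1 hys]

theorem tauBranch_minus_mem {ν : Fin p} {s : ℝ} (hs : s ∈ coords K)
    (hsm : (s : UnitAddCircle) ∈ M.mark ν) (hcs : s < c ν) :
    T.tauBranch (M.minusBranch ν) s ∈ coords K := by
  obtain ⟨y, hy, hys⟩ := h.exists_preimage _ hs.2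
  refine ⟨T.tauBranch_mem (M.minusBranch_lt ν) hs.1, ?_⟩
  rwa [← M.eq_of_mem_markMinus (h.left ν y hy (by
    rw [hys]; exact mem_leftPart h.cut_mem h.cut_mem_mark hs.1 hsm hcs)) hs.1 hys]

theorem tauBranch_free_mem {U : Set UnitAddCircle} (hU : U ∈ components M.unmarked) {s : ℝ}
    (hs : s ∈ coords K) (hsU : (s : UnitAddCircle) ∈ U) :
    T.tauBranch (M.freeBranch U) s ∈ coords K := by
  obtain ⟨y, hy, hys⟩ := h.exists_preimage _ hs.2
  refine ⟨T.tauBranch_mem (M.freeBranch_lt U) hs.1, ?_⟩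
  rwa [← M.eq_of_mem_unmarked hU (h.free U hU y hy (by rwa [hys])) hs.1 hys hsU]

/-- If `K` accumulates at a cut point from one side, then it contains the corresponding
preimage. -/
theorem eventually_tauBranch_cut_mem (ν : Fin p) : ∀ᶠ ρ in 𝓝[>] (0 : ℝ),
    (∀ s ∈ coords K, c ν < s → s < c ν + ρ → T.tauBranch (M.plusBranch ν) (c ν) ∈ coords K) ∧
    (∀ s ∈ coords K, s < c ν → c ν - ρ < s →
      T.tauBranch (M.minusBranch ν) (c ν) ∈ coords K) := by
  have hmark : ∀ᶠ s : ℝ in 𝓝 (c ν), (s : UnitAddCircle) ∈ M.mark ν :=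
    UnitAddCircle.continuous_coe.continuousAt.preimage_mem_nhds
      ((M.isOpen_mark ν).mem_nhds (h.cut_mem_mark ν))
  -- Since `K` is closed, a branch that sends the cut outside `K` also sends nearby points outside
  -- `K`.
  have key : ∀ i < T.degree, T.tauBranch i (c ν) ∉ coords K →
      ∀ᶠ s in 𝓝 (c ν), T.tauBranch i s ∉ coords K := by
    intro i hi hK
    have h1 : ((T.tauBranch i (c ν) : ℝ) : UnitAddCircle) ∉ K := fun h' =>
      hK ⟨T.tauBranch_mem hi (h.cut_mem ν), h'⟩
    have h2 := ((UnitAddCircle.continuous_coe.comp (T.continuous_tauBranch i)).tendsto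
      (c ν)).eventually (h.isClosed.isOpen_compl.mem_nhds h1)
    exact h2.mono fun s hs hs' => hs hs'.2
  have key2 : ∀ P : ℝ → Prop, (∀ᶠ s in 𝓝 (c ν), P s) →
      ∀ᶠ ρ in 𝓝[>] (0 : ℝ), ∀ s, |s - c ν| < ρ → P s := by
    intro P hP
    obtain ⟨ε, hε, h1⟩ := Metric.eventually_nhds_iff.1 hP
    filter_upwards [Ioo_mem_nhdsGT hε] with ρ hρ s hs
    exact h1 (by rw [Real.dist_eq]; exact hs.trans hρ.2)
  refine Eventually.and ?_ ?_
  · by_cases hK : T.tauBranch (M.plusBranch ν) (c ν) ∈ coords K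
    · exact Eventually.of_forall fun _ _ _ _ _ => hK
    · filter_upwards [key2 _ (hmark.and (key _ (M.plusBranch_lt ν) hK))] with ρ hρ s hs h1 h2
      have h3 := hρ s (by rw [abs_of_pos (sub_pos.2 h1)]; linarith)
      exact absurd (h.tauBranch_plus_mem hs h3.1 h1) h3.2
  · by_cases hK : T.tauBranch (M.minusBranch ν) (c ν) ∈ coords K
    · exact Eventually.of_forall fun _ _ _ _ _ => hK
    · filter_upwards [key2 _ (hmark.and (key _ (M.minusBranch_lt ν) hK))] with ρ hρ s hs h1 h2
      have h3 := hρ s (by rw [abs_of_neg (sub_neg.2 h1)]; linarith)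
      exact absurd (h.tauBranch_minus_mem hs h3.1 h1) h3.2

omit h in
/-- On `(u, u']` the branch choice is constant, and this branch maps both endpoints into `K`. -/
def IsUnsplit (M : MarkedFrame T p) (c : Fin p → ℝ) (K : Set UnitAddCircle) (u u' : ℝ) : Prop :=
  ∃ i, (∀ s ∈ Ioc u u', M.branchChoice c s = i) ∧ T.tauBranch i u ∈ coords K ∧
    T.tauBranch i u' ∈ coords K

/-- A short segment between points of `K` stays in one component of `V` and meets at most one cut.
If a cut lies strictly inside, `K` has a point close to it on each side; so both one-sided preimages
of the cut belong to `K`, and so does the cut. The segment can then be split there with all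
endpoints in `K`. -/
theorem exists_step : ∃ ρ > 0, ∀ u ∈ coords K, ∀ u' ∈ coords K, u < u' → u' - u < ρ →
    IsUnsplit M c K u u' ∨
      ∃ m ∈ Ioo u u', m ∈ coords K ∧ IsUnsplit M c K u m ∧ IsUnsplit M c K m u' := by
  obtain ⟨δ, hδ, hthick⟩ := h.isClosed.isCompact.exists_thickening_subset_open M.isOpen_V h.subset_V
  obtain ⟨ρ, hcut, hρ0, hρδ⟩ := ((eventually_all.2 h.eventually_tauBranch_cut_mem).and
    (Ioo_mem_nhdsGT hδ)).exists
  refine ⟨ρ, hρ0, fun u hu u' hu' huu' hlt => ?_⟩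
  have hV : ∀ s ∈ Icc u u', (s : UnitAddCircle) ∈ M.V := by
    intro s hs
    refine hthick (Metric.mem_thickening_iff.2 ⟨u, hu.2, ?_⟩)
    refine (UnitAddCircle.dist_coe_le s u).trans_lt ?_
    rw [abs_of_nonneg (sub_nonneg.2 hs.1)]
    linarith [hs.2]
  have himg : (fun s : ℝ => (s : UnitAddCircle)) '' Icc u u' ⊆ M.V := by
    rintro _ ⟨s, hs, rfl⟩
    exact hV s hs
  have hul : u ∈ Icc u u' := left_mem_Icc.2 huu'.le
  by_cases hm : ∃ ν, (u : UnitAddCircle) ∈ M.mark ν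
  · obtain ⟨ν, hν⟩ := hm
    have hmark : ∀ s ∈ Icc u u', (s : UnitAddCircle) ∈ M.mark ν := fun s hs =>
      (isPreconnected_coe_image_Icc u u').subset_of_mem_components (M.mark_mem ν) himg
        (mem_image_of_mem _ hul) hν (mem_image_of_mem _ hs)
    have hright : ∀ v ∈ Icc u u', v ∈ coords K → c ν ≤ v → v < u' → IsUnsplit M c K v u' := by
      intro v hv hvK hcv hvu
      refine ⟨M.plusBranch ν, fun s hs => ?_, ?_, ?_⟩
      · rw [M.branchChoice_of_mem_mark c (hmark s ⟨hv.1.trans hs.1.le, hs.2⟩),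
          if_pos (hcv.trans_lt hs.1)]
      · rcases hcv.eq_or_lt with h1 | h1
        · rw [← h1]
          exact (hcut ν).1 u' hu' (h1.trans_lt hvu) (by linarith [hv.1])
        · exact h.tauBranch_plus_mem hvK (hmark v hv) h1
      · exact h.tauBranch_plus_mem hu' (hmark u' (right_mem_Icc.2 huu'.le)) (hcv.trans_lt hvu)
    have hleft : ∀ v ∈ Icc u u', v ∈ coords K → v ≤ c ν → u < v → IsUnsplit M c K u v := by
      intro v hv hvK hcv hvu
      refine ⟨M.minusBranch ν, fun s hs => ?_, ?_, ?_⟩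
      · rw [M.branchChoice_of_mem_mark c (hmark s ⟨hs.1.le, hs.2.trans hv.2⟩),
          if_neg (not_lt.2 (hs.2.trans hcv))]
      · exact h.tauBranch_minus_mem hu (hmark u hul) (hvu.trans_le hcv)
      · rcases hcv.eq_or_lt with h1 | h1
        · rw [h1]
          exact (hcut ν).2 u hu (hvu.trans_eq h1) (by linarith [hv.2])
        · exact h.tauBranch_minus_mem hvK (hmark v hv) h1
    rcases le_or_gt (c ν) u with h1 | h1
    · exact Or.inl (hright u hul hu h1 huu')
    · rcases le_or_gt u' (c ν) with h2 | h2
      · exact Or.inl (hleft u' (right_mem_Icc.2 huu'.le) hu' h2 huu')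
      · have hcK : c ν ∈ coords K := by
          refine ⟨h.cut_mem ν, ?_⟩
          rw [← T.apply_tauBranch (M.plusBranch ν)]
          exact h.mapsTo ((hcut ν).1 u' hu' h2 (by linarith)).2
        exact Or.inr ⟨c ν, ⟨h1, h2⟩, hcK, hleft _ ⟨h1.le, h2.le⟩ hcK le_rfl h1,
          hright _ ⟨h1.le, h2.le⟩ hcK le_rfl h2⟩
  · push Not at hm
    have hu0 : (u : UnitAddCircle) ∈ M.unmarked := ⟨hV u hul, by simpa using hm⟩
    have hnm : ∀ s ∈ Icc u u', ∀ ν, (s : UnitAddCircle) ∉ M.mark ν := fun s hs ν hν =>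
      hm ν ((isPreconnected_coe_image_Icc u u').subset_of_mem_components (M.mark_mem ν) himg
        (mem_image_of_mem _ hs) hν (mem_image_of_mem _ hul))
    have hunm : (fun s : ℝ => (s : UnitAddCircle)) '' Icc u u' ⊆ M.unmarked := by
      rintro _ ⟨s, hs, rfl⟩
      exact ⟨hV s hs, by simpa using hnm s hs⟩
    set U := connectedComponentIn M.unmarked (u : UnitAddCircle)
    have hU : U ∈ components M.unmarked := ⟨_, hu0, rfl⟩
    have hsU : ∀ s ∈ Icc u u', (s : UnitAddCircle) ∈ U := fun s hs =>
      (isPreconnected_coe_image_Icc u u').subset_connectedComponentIn (mem_image_of_mem _ hul)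
        hunm (mem_image_of_mem _ hs)
    refine Or.inl ⟨M.freeBranch U, fun s hs => ?_, h.tauBranch_free_mem hU hu (hsU u hul),
      h.tauBranch_free_mem hU hu' (hsU u' (right_mem_Icc.2 huu'.le))⟩
    have hs' : s ∈ Icc u u' := ⟨hs.1.le, hs.2⟩
    rw [M.branchChoice_of_notMem_mark c (hnm s hs'), ← connectedComponentIn_eq (hsU s hs')]

theorem exists_backwardOrbit {s : ℝ} (hs : s ∈ coords K) :
    ∃ w : ℕ → ℕ, (∀ k, w k < T.degree) ∧ ∀ k, T.backwardOrbit w s k ∈ coords K := by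
  have hstep : ∀ x : coords K, ∃ i : Fin T.degree, T.tauBranch i x ∈ coords K := by
    rintro ⟨x, hx⟩
    obtain ⟨y, hy, hyx⟩ := h.exists_preimage _ hx.2
    obtain ⟨i, hi, rfl⟩ := T.exists_eq_tauBranch hx.1 hyx
    exact ⟨⟨i, hi⟩, T.tauBranch_mem hi hx.1, hy⟩
  choose i hi using hstep
  set z : ℕ → coords K := fun k => Nat.rec ⟨s, hs⟩ (fun _ x => ⟨_, hi x⟩) k
  have hz : ∀ k, T.backwardOrbit (fun k => i (z k)) s k = z k := by
    intro k
    induction k with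
    | zero => rfl
    | succ k ih => rw [backwardOrbit, ih]
  exact ⟨fun k => i (z k), fun k => (i (z k)).2, fun k => by rw [hz]; exact (z k).2⟩

end IsAdapted

/-! ### The integral formula for calibrated sub-actions -/

section Formula

variable {f : C1Circle} {g : UnitAddCircle → ℝ} {β C lam : ℝ}

/-- The difference of `g` at two points is the sum of the integrals of `f'` over the first `N`
images of the interval between them, up to an error controlled by the measure of the `N`-th
image. -/
def IsApprox (b : ℝ → ℕ) (T : AnalyticCircleMap) (f : C1Circle) (g : UnitAddCircle → ℝ)
    (L : ℝ) (N : ℕ) (u u' : ℝ) : Prop :=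
  |g u' - g u - ∑ k ∈ Finset.range N, ∫ s in (T.selection b)^[k + 1] '' Ioc u u',
    circleDeriv f (s : UnitAddCircle)| ≤ L * volume.real ((T.selection b)^[N] '' Ioc u u')

/-- Iterated selections are injective, so adjacent intervals have disjoint images, and both the
integrals and the error measures add exactly. Stating the error as a measure prevents losses however
many cuts occur in the induction. -/
theorem IsApprox.trans {b : ℝ → ℕ} (hb : T.IsBranchChoice b) {L : ℝ} {N : ℕ} {u m u' : ℝ}
    (hu : u ∈ Ioo (0 : ℝ) 1) (hu' : u' ∈ Ioo (0 : ℝ) 1) (hum : u ≤ m) (hmu : m ≤ u')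
    (h1 : IsApprox b T f g L N u m) (h2 : IsApprox b T f g L N m u') :
    IsApprox b T f g L N u u' := by
  have hm : m ∈ Ioo (0 : ℝ) 1 := ⟨hu.1.trans_le hum, hmu.trans_lt hu'.2⟩
  have hs1 := Ioc_subset_unit hu hm
  have hs2 := Ioc_subset_unit hm hu'
  have hun : Ioc u u' = Ioc u m ∪ Ioc m u' := (Ioc_union_Ioc_eq_Ioc hum hmu).symm
  have hdisj : ∀ k, Disjoint ((T.selection b)^[k] '' Ioc u m)
      ((T.selection b)^[k] '' Ioc m u') := by
    intro k
    refine disjoint_left.2 ?_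
    rintro _ ⟨s, hs, rfl⟩ ⟨t, ht, hst⟩
    have h := hb.injOn k (hs2 ht) (hs1 hs) hst
    exact (h ▸ ht.1).not_ge hs.2
  have hmeas := fun k => hb.measurableSet_image k hs2 measurableSet_Ioc
  have hint : ∀ k, ∫ s in (T.selection b)^[k] '' Ioc u u', circleDeriv f (s : UnitAddCircle) =
      (∫ s in (T.selection b)^[k] '' Ioc u m, circleDeriv f (s : UnitAddCircle)) +
        ∫ s in (T.selection b)^[k] '' Ioc m u', circleDeriv f (s : UnitAddCircle) := by
    intro k
    rw [hun, image_union]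
    exact setIntegral_union (hdisj k) (hmeas k)
      (f.integrableOn_circleDeriv (hb.image_subset k hs1))
      (f.integrableOn_circleDeriv (hb.image_subset k hs2))
  have hvol : volume.real ((T.selection b)^[N] '' Ioc u u') =
      volume.real ((T.selection b)^[N] '' Ioc u m) +
        volume.real ((T.selection b)^[N] '' Ioc m u') := by
    rw [hun, image_union]
    exact measureReal_union (hdisj N) (hmeas N)
      (C1Circle.volume_lt_top_of_subset (hb.image_subset N hs1)).ne
      (C1Circle.volume_lt_top_of_subset (hb.image_subset N hs2)).ne
  unfold IsApprox at h1 h2 ⊢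
  simp only [hint, Finset.sum_add_distrib, hvol, mul_add]
  refine le_trans (le_of_eq ?_) ((abs_add_le _ _).trans (add_le_add h1 h2))
  congr 1
  ring

theorem image_tauBranch_Ioc (i : ℕ) (u u' : ℝ) :
    T.tauBranch i '' Ioc u u' = Ioc (T.tauBranch i u) (T.tauBranch i u') := by
  ext z
  constructor
  · rintro ⟨s, hs, rfl⟩
    exact ⟨T.strictMono_tauBranch i hs.1, (T.strictMono_tauBranch i).monotone hs.2⟩
  · intro hz
    have e : T.tauBranch i (T.lift z - i) = z := by simp [tauBranch, T.tau_lift]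
    refine ⟨T.lift z - i, ⟨?_, ?_⟩, e⟩
    · rw [← (T.strictMono_tauBranch i).lt_iff_lt, e]
      exact hz.1
    · rw [← (T.strictMono_tauBranch i).le_iff_le, e]
      exact hz.2

/-- Subtracting the sub-action relation at the two endpoints cancels β and leaves an increment of f,
which is the integral of f' over the first image. -/
theorem IsApprox.succ {b : ℝ → ℕ} {L : ℝ} {N : ℕ} {u u' : ℝ} {i : ℕ} (huu' : u ≤ u')
    (hi : ∀ s ∈ Ioc u u', b s = i)
    (hg : g u + β = g (T.tauBranch i u : ℝ) + f (T.tauBranch i u : ℝ))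
    (hg' : g u' + β = g (T.tauBranch i u' : ℝ) + f (T.tauBranch i u' : ℝ))
    (h : IsApprox b T f g L N (T.tauBranch i u) (T.tauBranch i u')) :
    IsApprox b T f g L (N + 1) u u' := by
  have himg : T.selection b '' Ioc u u' = Ioc (T.tauBranch i u) (T.tauBranch i u') := by
    rw [← image_tauBranch_Ioc]
    refine image_congr fun s hs => ?_
    rw [selection, hi s hs]
  have himg' : ∀ k, (T.selection b)^[k + 1] '' Ioc u u' =
      (T.selection b)^[k] '' Ioc (T.tauBranch i u) (T.tauBranch i u') := fun k => by
    rw [Function.iterate_succ, image_comp, himg]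
  unfold IsApprox at h ⊢
  rw [Finset.sum_range_succ', himg']
  simp only [himg' _]
  rw [Function.iterate_zero, image_id,
    f.setIntegral_circleDeriv ((T.strictMono_tauBranch i).monotone huu')]
  refine le_trans (le_of_eq ?_) h
  congr 1
  linarith

/-- Induction on `N`: split at a cut if there is one, apply the common branch, and use the estimate
for the image. One step backward may increase distances, so closeness is imposed through some
forward iterate: a branch merely raises that n by one, and κ guarantees an actual distance below ρ
at each stage. -/
theorem IsAdapted.isApprox (h : M.IsAdapted c K) (hT : T.IsExpandingWith C lam)
    (hg : ∀ y ∈ K, g y + f y = g (T y) + β) {L : NNReal} (hL : LipschitzWith L g) :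
    ∃ ρ > 0, ∀ N, ∀ u ∈ coords K, ∀ u' ∈ coords K, u ≤ u' →
      (∃ n, contractionConst C * (T.lift^[n] u' - T.lift^[n] u) < ρ) →
      IsApprox (M.branchChoice c) T f g L N u u' := by
  obtain ⟨ρ, hρ, hstep⟩ := h.exists_step
  refine ⟨ρ, hρ, fun N => ?_⟩
  have hgb : ∀ i s, T.tauBranch i s ∈ coords K →
      g s + β = g (T.tauBranch i s : ℝ) + f (T.tauBranch i s : ℝ) := by
    intro i s hs
    rw [hg _ hs.2, T.apply_tauBranch]
  induction N with
  | zero =>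
    intro u hu u' hu' huu' _
    rw [IsApprox, Finset.sum_range_zero, sub_zero, Function.iterate_zero, image_id,
      Real.volume_real_Ioc_of_le huu']
    have h1 := hL.dist_le_mul (u' : UnitAddCircle) u
    rw [Real.dist_eq] at h1
    refine h1.trans ?_
    have h2 := UnitAddCircle.dist_coe_le u' u
    rw [abs_of_nonneg (sub_nonneg.2 huu')] at h2
    gcongr
  | succ N ih =>
    have hunsplit : ∀ v v', v < v' → IsAdapted.IsUnsplit M c K v v' →
        (∃ n, contractionConst C * (T.lift^[n] v' - T.lift^[n] v) < ρ) →
        IsApprox (M.branchChoice c) T f g L (N + 1) v v' := by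
      rintro v v' hvv' ⟨i, hi, hv, hv'⟩ ⟨n, hn⟩
      refine IsApprox.succ hvv'.le hi (hgb i v hv) (hgb i v' hv') (ih _ hv _ hv'
        ((T.strictMono_tauBranch i).monotone hvv'.le) ⟨n + 1, ?_⟩)
      rw [Function.iterate_succ_apply, Function.iterate_succ_apply, T.lift_tauBranch,
        T.lift_tauBranch, lift_iterate_add_natCast, lift_iterate_add_natCast,
        add_sub_add_right_eq_sub]
      exact hn
    intro u hu u' hu' huu' hn
    rcases huu'.eq_or_lt with rfl | hlt
    · simp [IsApprox]
    have hκ := contractionConst_pos C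
    have hclose : u' - u < ρ := by
      obtain ⟨n, hn⟩ := hn
      refine ((hT.sub_le n huu').trans ?_).trans_lt hn
      have h0 : 0 ≤ T.lift^[n] u' - T.lift^[n] u :=
        sub_nonneg.2 (T.strictMono_lift.monotone.iterate n huu')
      gcongr
      exact mul_le_of_le_one_right hκ.le (hT.inv_pow_le_one n)
    rcases hstep u hu u' hu' hlt hclose with h1 | ⟨m, hm, hmK, h1, h2⟩
    · exact hunsplit u u' hlt h1 hn
    · obtain ⟨n, hn⟩ := hn
      have hmono := T.strictMono_lift.monotone.iterate n
      have hm1 := hmono hm.1.le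
      have hm2 := hmono hm.2.le
      refine IsApprox.trans (M.isBranchChoice c) hu.1 hu'.1 hm.1.le hm.2.le
        (hunsplit u m hm.1 h1 ⟨n, lt_of_le_of_lt ?_ hn⟩)
        (hunsplit m u' hm.2 h2 ⟨n, lt_of_le_of_lt ?_ hn⟩)
      · gcongr
      · gcongr

/-- Let `N` tend to infinity in `IsAdapted.isApprox`: the error is at most L times the measure of an
N-th image, of order λ^{-N}. -/
theorem IsAdapted.hullFunctional_apply (h : M.IsAdapted c K) (hT : T.IsExpandingWith C lam)
    (hg : ∀ y ∈ K, g y + f y = g (T y) + β) {L : NNReal} (hL : LipschitzWith L g) :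
    ∃ ρ > 0, ∀ u ∈ coords K, ∀ u' ∈ coords K, u ≤ u' → u' - u < ρ →
      T.hullFunctional (M.branchChoice c) u u' f = g u' - g u := by
  obtain ⟨ρ, hρ, happ⟩ := h.isApprox hT hg hL
  have hκ := contractionConst_pos C
  refine ⟨ρ / contractionConst C, by positivity, fun u hu u' hu' huu' hlt => ?_⟩
  have hb := M.isBranchChoice c
  have hsum := (hT.hasSum_hullFunctional hb hu.1 hu'.1 f).tendsto_sum_nat
  have hvol : Tendsto (fun N => L * (contractionConst C * (lam ^ N)⁻¹ * volume.real (Ioc u u')))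
      atTop (𝓝 0) := by
    have h1 : Tendsto (fun N : ℕ => (lam ^ N)⁻¹) atTop (𝓝 0) := by
      simpa only [inv_pow] using
        tendsto_pow_atTop_nhds_zero_of_lt_one hT.inv_nonneg hT.inv_lt_one
    simpa using ((h1.const_mul (contractionConst C)).mul_const (volume.real (Ioc u u'))).const_mul
      (L : ℝ)
  have hlim : Tendsto (fun N => g u' - g u - ∑ k ∈ Finset.range N,
      ∫ s in (T.selection (M.branchChoice c))^[k + 1] '' Ioc u u',
        circleDeriv f (s : UnitAddCircle)) atTop (𝓝 0) := by
    refine squeeze_zero_norm (fun N => ?_) hvol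
    have h1 : IsApprox (M.branchChoice c) T f g L N u u' := by
      refine happ N u hu u' hu' huu' ⟨0, ?_⟩
      rw [lt_div_iff₀ hκ] at hlt
      simpa [mul_comm] using hlt
    refine le_trans h1 ?_
    have h2 := hT.volumeReal_image_le hb N (Ioc_subset_unit hu.1 hu'.1) measurableSet_Ioc
    gcongr
  have h3 := tendsto_nhds_unique hlim (hsum.const_sub (g u' - g u))
  linarith

theorem backwardOrbit_cocycle (hg : ∀ y ∈ K, g y + f y = g (T y) + β) {w : ℕ → ℕ} {s : ℝ}
    (hz : ∀ k, T.backwardOrbit w s k ∈ coords K) (k : ℕ) :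
    g (T.backwardOrbit w s k : ℝ) = g s + k * β -
      ∑ i ∈ Finset.range k, f (T.backwardOrbit w s (i + 1) : ℝ) := by
  induction k with
  | zero => simp [backwardOrbit]
  | succ k ih =>
    have h1 := hg _ (hz (k + 1)).2
    rw [backwardOrbit, T.apply_tauBranch, ih] at h1
    rw [Finset.sum_range_succ, backwardOrbit]
    push_cast
    linarith

/-- The increment of g between the two orbit points is computed once through the interval and once
along the orbit; g drops out and only a multiple of β is left. -/
theorem IsAdapted.pairFunctional_apply (h : M.IsAdapted c K) (hT : T.IsExpandingWith C lam)
    (hg : ∀ y ∈ K, g y + f y = g (T y) + β) {L : NNReal} (hL : LipschitzWith L g) :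
    ∃ ρ > 0, ∀ (w : ℕ → ℕ) (s : ℝ), (∀ k, T.backwardOrbit w s k ∈ coords K) → ∀ l r,
      T.backwardOrbit w s l ≤ T.backwardOrbit w s r →
      T.backwardOrbit w s r - T.backwardOrbit w s l < ρ →
      T.pairFunctional (M.branchChoice c) w s l r f = ((r : ℝ) - l) * β := by
  obtain ⟨ρ, hρ, hhull⟩ := h.hullFunctional_apply hT hg hL
  refine ⟨ρ, hρ, fun w s hz l r hlr hlt => ?_⟩
  have h1 := hhull _ (hz l) _ (hz r) hlr hlt
  rw [backwardOrbit_cocycle hg hz l, backwardOrbit_cocycle hg hz r] at h1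
  simp only [pairFunctional, add_apply, sub_apply, sum_apply, h1,
    C1Circle.evalCLM_apply]
  ring

end Formula

/-! ### Compatible functions -/

/-- K(f) is a union over all sub-actions, whereas the integral formula needs a single g; the contact
set of one g inherits the branch conditions from K(f) and is closed. Each critical value has a
preimage in `V'`, whose later images stay in K(f) ⊆ `V`. -/
theorem IsCompatible.exists_isAdapted {f : C1Circle} (hf : M.IsCompatible f) (hp : 1 ≤ p) :
    ∃ (c : Fin p → ℝ) (g : UnitAddCircle → ℝ), (∀ ν, c ν ∈ M.survivorValues) ∧
      IsCalibratedSubAction T f g ∧ M.IsAdapted c (forwardContactSet T f g) ∧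
      c ⟨0, hp⟩ ∈ coords (forwardContactSet T f g) := by
  obtain ⟨hKT, -, -, hmark, hfree⟩ := hf
  have hfc := f.continuous
  have hTV : T.toFun '' M.V' ⊆ M.V := by
    obtain ⟨S, hS, h⟩ := M.V'_eq
    rw [h]
    rintro _ ⟨x, ⟨B, hB, hxB⟩, rfl⟩
    exact subset_of_mem_components (hS hB) hxB
  have hKV : maximizingSet T f ⊆ M.V := hKT.trans hTV
  choose x hx hxr hxl using hmark
  have hxmem : ∀ ν, x ν ∈ M.mark ν ∩ criticalValues T (maximizingSet T f) := fun ν => by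
    rw [hx ν]
    exact mem_singleton _
  have hxK : ∀ ν, x ν ∈ maximizingSet T f := fun ν => (hxmem ν).2.1
  set c : Fin p → ℝ := fun ν => UnitAddCircle.coord (x ν)
  have hc : ∀ ν, (c ν : UnitAddCircle) = x ν := fun ν => UnitAddCircle.coe_coord _
  have hc01 : ∀ ν, c ν ∈ Ioo (0 : ℝ) 1 := fun ν =>
    UnitAddCircle.coord_mem (M.V_subset (hKV (hxK ν)))
  have hsurv : ∀ ν, c ν ∈ M.survivorValues := by
    intro ν
    obtain ⟨y, hy, hyx⟩ := hKT (hxK ν)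
    refine ⟨hc01 ν, UnitAddCircle.coord y,
      UnitAddCircle.coord_mem (M.V_subset (M.V'_subset hy)), ?_, ?_⟩
    · rw [UnitAddCircle.coe_coord]
      refine fun n => ⟨hy, fun k hk => ?_⟩
      obtain ⟨k, rfl⟩ : ∃ j, k = j + 1 := ⟨k - 1, (Nat.sub_add_cancel hk.1).symm⟩
      rw [Function.iterate_succ_apply]
      refine hKV ((mapsTo_maximizingSet hfc).iterate k ?_)
      rw [hyx]
      exact hxK ν
    · rw [UnitAddCircle.coe_coord, hyx, hc]
  -- Backward orbits will start at the first cut, so that the functional has no parameter besides c;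
  -- hence g is taken with this point in its contact set.
  obtain ⟨g, hg, hxg⟩ := mem_iUnion₂.1 (hxK ⟨0, hp⟩)
  have hsub : forwardContactSet T f g ⊆ maximizingSet T f := by
    rw [← invariantContactSet_eq hfc hg]
    exact subset_biUnion_of_mem (u := fun g => invariantContactSet T f g) hg
  rw [invariantContactSet_eq hfc hg] at hxg
  refine ⟨c, g, hsurv, hg, ?_, hc01 _, by rw [hc]; exact hxg⟩
  refine
    { isClosed := isClosed_forwardContactSet hfc hg.1.1
      subset_V := hsub.trans hKV
      mapsTo := mapsTo_forwardContactSet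
      exists_preimage := fun x hx => exists_preimage_forwardContactSet hfc hg hx
      cut_mem := hc01
      cut_mem_mark := fun ν => by rw [hc]; exact (hxmem ν).1
      right := fun ν y hy hT => ?_
      left := fun ν y hy hT => ?_
      free := fun U hU y hy hT => hfree U hU ⟨hT, hsub hy⟩ }
  · rw [hc] at hT
    obtain ⟨y', hy', e⟩ := hxr ν _ ⟨hsub (mapsTo_forwardContactSet hy), hT⟩
    have h1 : y ∈ T.toFun ⁻¹' {T y} ∩ maximizingSet T f := ⟨rfl, hsub hy⟩
    rw [e] at h1
    rwa [mem_singleton_iff.1 h1]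
  · rw [hc] at hT
    obtain ⟨y', hy', e⟩ := hxl ν _ ⟨hsub (mapsTo_forwardContactSet hy), hT⟩
    have h1 : y ∈ T.toFun ⁻¹' {T y} ∩ maximizingSet T f := ⟨rfl, hsub hy⟩
    rw [e] at h1
    rwa [mem_singleton_iff.1 h1]

end MarkedFrame

/-! ### Functions annihilated by all derivatives -/

namespace C1Circle

/-- After subtraction of the mean, the primitive of ψ is periodic. -/
theorem exists_circleDeriv_eq (ψ : C(UnitAddCircle, ℝ)) :
    ∃ φ : C1Circle, ∀ s : ℝ, circleDeriv φ (s : UnitAddCircle) = ψ s - ∫ t in (0 : ℝ)..1, ψ t := by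
  set m := ∫ t in (0 : ℝ)..1, ψ t
  have hc : Continuous fun s : ℝ => ψ (s : UnitAddCircle) - m :=
    (ψ.continuous.comp UnitAddCircle.continuous_coe).sub continuous_const
  have hper : Function.Periodic (fun s : ℝ => ψ (s : UnitAddCircle) - m) 1 := fun s => by
    simp
  have hd : ∀ s : ℝ, HasDerivAt (fun s : ℝ => ∫ t in (0 : ℝ)..s, (ψ (t : UnitAddCircle) - m))
      (ψ (s : UnitAddCircle) - m) s := fun s =>
    intervalIntegral.integral_hasDerivAt_right (hc.intervalIntegrable _ _)
      hc.stronglyMeasurable.stronglyMeasurableAtFilter hc.continuousAt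
  have hmean : ∫ t in (0 : ℝ)..0 + 1, (ψ (t : UnitAddCircle) - m) = 0 := by
    have h1 : IntervalIntegrable (fun t : ℝ => ψ (t : UnitAddCircle)) volume 0 1 :=
      (ψ.continuous.comp UnitAddCircle.continuous_coe).intervalIntegrable _ _
    rw [zero_add, intervalIntegral.integral_sub h1 (continuous_const.intervalIntegrable _ _)]
    simp [m]
  have hper' : Function.Periodic
      (fun s : ℝ => ∫ t in (0 : ℝ)..s, (ψ (t : UnitAddCircle) - m)) 1 := by
    intro s
    have h := hper.intervalIntegral_add_eq s 0
    rw [hmean] at h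
    change (∫ t in (0 : ℝ)..(s + 1), (ψ (t : UnitAddCircle) - m)) = _
    rw [← intervalIntegral.integral_add_adjacent_intervals (hc.intervalIntegrable 0 s)
      (hc.intervalIntegrable s (s + 1)), h, add_zero]
  have hC1 : ContDiff ℝ 1 fun s : ℝ => hper'.lift (s : UnitAddCircle) := by
    refine contDiff_one_iff_deriv.2 ⟨fun s => (hd s).differentiableAt, ?_⟩
    have : deriv (fun s : ℝ => hper'.lift (s : UnitAddCircle)) =
        fun s : ℝ => ψ (s : UnitAddCircle) - m := funext fun s => (hd s).deriv
    rw [this]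
    exact hc
  refine ⟨⟨hper'.lift, hC1⟩, fun s => ?_⟩
  rw [circleDeriv_coe]
  exact (hd s).deriv

/-- An integrable function orthogonal to all derivatives of `C¹` functions on the circle is almost
everywhere constant. -/
theorem exists_ae_eq_const {R : ℝ → ℝ} (hR : IntegrableOn R (Ioo 0 1))
    (h : ∀ φ : C1Circle, ∫ s in Ioo (0 : ℝ) 1, circleDeriv φ (s : UnitAddCircle) * R s = 0) :
    ∃ κ, ∀ᵐ s ∂volume.restrict (Ioo (0 : ℝ) 1), R s = κ := by
  set κ := ∫ s in Ioo (0 : ℝ) 1, R s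
  refine ⟨κ, ?_⟩
  have hRκ : IntegrableOn (fun s => R s - κ) (Ioo 0 1) :=
    hR.sub (integrableOn_const (by simp))
  have key := isOpen_Ioo.ae_eq_zero_of_integral_contDiff_smul_eq_zero (μ := volume)
    hRκ.locallyIntegrableOn (fun g hg _ hsupp => by
      have h0 : ∀ s ∉ Ioo (0 : ℝ) 1, g s = 0 := fun s hs =>
        image_eq_zero_of_notMem_tsupport fun h => hs (hsupp h)
      -- A test function supported in (0, 1) extends to the circle; minus its mean it is a
      -- derivative, and the mean is what turns R into R - κ.
      set ψ : C(UnitAddCircle, ℝ) := ⟨AddCircle.liftIco 1 0 g,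
        AddCircle.liftIco_zero_continuous (by rw [h0 0 (by simp), h0 1 (by simp)])
          hg.continuous.continuousOn⟩
      have hψ : ∀ s ∈ Ioo (0 : ℝ) 1, ψ (s : UnitAddCircle) = g s := fun s hs =>
        AddCircle.liftIco_zero_coe_apply ⟨hs.1.le, hs.2⟩
      obtain ⟨φ, hφ⟩ := exists_circleDeriv_eq ψ
      have h1 : ∫ t in (0 : ℝ)..1, ψ (t : UnitAddCircle) = ∫ t in Ioo (0 : ℝ) 1, g t := by
        rw [intervalIntegral.integral_of_le zero_le_one, integral_Ioc_eq_integral_Ioo]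
        exact setIntegral_congr_fun measurableSet_Ioo hψ
      have h2 : ∫ s, g s • (R s - κ) = ∫ s in Ioo (0 : ℝ) 1, g s * (R s - κ) :=
        (setIntegral_eq_integral_of_forall_compl_eq_zero fun s hs => by
          rw [h0 s hs, zero_smul]).symm
      have hgi : IntegrableOn g (Ioo 0 1) :=
        (hg.continuous.integrableOn_Icc (a := 0) (b := 1)).mono_set Ioo_subset_Icc_self
      have hgR : IntegrableOn (fun s => g s * R s) (Ioo 0 1) := by
        exact hR.continuousOn_mul_of_subset hg.continuous.continuousOn isCompact_Icc
          measurableSet_Ioo Ioo_subset_Icc_self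
      have h3 := h φ
      have h4 : ∫ s in Ioo (0 : ℝ) 1, circleDeriv φ (s : UnitAddCircle) * R s =
          ∫ s in Ioo (0 : ℝ) 1, (g s * R s - (∫ t in Ioo (0 : ℝ) 1, g t) * R s) := by
        refine setIntegral_congr_fun measurableSet_Ioo fun s hs => ?_
        rw [hφ, h1, hψ s hs, sub_mul]
      rw [h4, integral_sub hgR (hR.const_mul _), integral_const_mul] at h3
      rw [h2]
      simp only [mul_sub]
      rw [integral_sub hgR (hgi.mul_const _), integral_mul_const]
      exact h3)
  rw [ae_restrict_iff' measurableSet_Ioo]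
  filter_upwards [key] with s hs hs'
  linarith [hs hs']

end C1Circle

/-! ### Representation of pair functionals by integer valued functions -/

namespace AnalyticCircleMap

variable {T : AnalyticCircleMap} {b : ℝ → ℕ} {C lam : ℝ}

variable (T) in
/-- The number of images of `(x, y]` under the iterates of a selection which contain a point. -/
def hullCount (b : ℝ → ℕ) (x y s : ℝ) : ℝ :=
  ∑' n : ℕ, ((T.selection b)^[n + 1] '' Ioc x y).indicator (1 : ℝ → ℝ) s

/-- Linearity in y - x, with one constant for all intervals, lets Borel–Cantelli apply to a sequence
of intervals of summable lengths. -/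
theorem IsExpandingWith.exists_tsum_volume_image_le (hT : T.IsExpandingWith C lam)
    (hb : T.IsBranchChoice b) : ∃ c : ENNReal, c ≠ ⊤ ∧ ∀ x y,
      ∑' n : ℕ, volume ((T.selection b)^[n + 1] '' Ioc x y) ≤ c * ENNReal.ofReal (y - x) := by
  refine ⟨∑' n : ℕ, ENNReal.ofReal (contractionConst C * lam⁻¹ ^ (n + 1)), ?_, fun x y => ?_⟩
  · have := hT.inv_nonneg
    have := contractionConst_pos C
    rw [← ENNReal.ofReal_tsum_of_nonneg (fun n => by positivity) hT.summable_bound]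
    exact ENNReal.ofReal_ne_top
  · rw [← ENNReal.tsum_mul_right]
    refine ENNReal.tsum_le_tsum fun n => ?_
    rw [inv_pow, ← Real.volume_Ioc]
    exact hT.volume_image_le hb (n + 1) measurableSet_Ioc

variable {x y : ℝ} (hT : T.IsExpandingWith C lam) (hb : T.IsBranchChoice b)
  (hx : x ∈ Ioo (0 : ℝ) 1) (hy : y ∈ Ioo (0 : ℝ) 1)

include hT hb in
theorem IsExpandingWith.tsum_volume_image_ne_top :
    ∑' n : ℕ, volume ((T.selection b)^[n + 1] '' Ioc x y) ≠ ⊤ := by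
  obtain ⟨c, hc, h⟩ := hT.exists_tsum_volume_image_le hb
  exact ((h x y).trans_lt (ENNReal.mul_lt_top hc.lt_top ENNReal.ofReal_lt_top)).ne

theorem hullCount_eq_zero {s : ℝ} (h : s ∉ ⋃ n : ℕ, (T.selection b)^[n + 1] '' Ioc x y) :
    T.hullCount b x y s = 0 := by
  simp only [mem_iUnion, not_exists] at h
  simp only [hullCount, indicator_of_notMem (h _), tsum_zero]

include hT hb in
-- By Borel–Cantelli, almost every point lies in finitely many of the images. Integrality later
-- forces jumps to have size at least 1.
theorem IsExpandingWith.hullCount_eq_natCast : ∀ᵐ s : ℝ, ∃ k : ℕ, T.hullCount b x y s = k := by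
  filter_upwards [ae_finite_setOfPred_mem (hT.tsum_volume_image_ne_top (x := x) (y := y) hb)]
    with s hs
  refine ⟨hs.toFinset.card, ?_⟩
  rw [hullCount, tsum_eq_sum (s := hs.toFinset) (fun n hn => by
    rw [Finite.mem_toFinset] at hn
    exact indicator_of_notMem (s := (T.selection b)^[n + 1] '' Ioc x y) hn _)]
  rw [Finset.sum_congr rfl fun n hn => indicator_of_mem
    (s := (T.selection b)^[n + 1] '' Ioc x y) ((Finite.mem_toFinset hs).1 hn) _]
  simp

include hT hb hx hy in
theorem IsExpandingWith.integrable_hullCount : Integrable (T.hullCount b x y) := by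
  have e : T.hullCount b x y = fun s =>
      (∑' n : ℕ, ((T.selection b)^[n + 1] '' Ioc x y).indicator (1 : ℝ → ENNReal) s).toReal := by
    funext s
    rw [ENNReal.tsum_toReal_eq fun n => ?_]
    · refine tsum_congr fun n => ?_
      by_cases h : s ∈ (T.selection b)^[n + 1] '' Ioc x y <;> simp only [h, indicator_of_mem,
        indicator_of_notMem, not_false_eq_true, Pi.one_apply, ENNReal.toReal_one,
        ENNReal.toReal_zero]
    · exact ((indicator_le_self _ _ s).trans_lt ENNReal.one_lt_top).ne
  have hm : ∀ n : ℕ, MeasurableSet ((T.selection b)^[n + 1] '' Ioc x y) := fun n =>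
    hb.measurableSet_image (n + 1) (Ioc_subset_unit hx hy) measurableSet_Ioc
  have hmi : ∀ n : ℕ, Measurable
      (((T.selection b)^[n + 1] '' Ioc x y).indicator (1 : ℝ → ENNReal)) := fun n =>
    measurable_one.indicator (hm n)
  rw [e]
  refine integrable_toReal_of_lintegral_ne_top (Measurable.tsum hmi).aemeasurable ?_
  rw [lintegral_tsum fun n => (hmi n).aemeasurable]
  simp only [lintegral_indicator_one (hm _)]
  exact hT.tsum_volume_image_ne_top hb

include hT hb hx hy in
theorem IsExpandingWith.hullFunctional_eq_integral (f : C1Circle) :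
    T.hullFunctional b x y f =
      ∫ s in Ioo (0 : ℝ) 1, circleDeriv f (s : UnitAddCircle) * T.hullCount b x y s := by
  have hs := Ioc_subset_unit hx hy
  have hD : ∀ n : ℕ, (T.selection b)^[n + 1] '' Ioc x y ⊆ Ioo 0 1 := fun n => hb.image_subset _ hs
  have hm : ∀ n : ℕ, MeasurableSet ((T.selection b)^[n + 1] '' Ioc x y) := fun n =>
    hb.measurableSet_image (n + 1) hs measurableSet_Ioc
  set F : ℕ → ℝ → ℝ := fun n => ((T.selection b)^[n + 1] '' Ioc x y).indicator
    fun s => circleDeriv f (s : UnitAddCircle)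
  have hF : ∀ n, Integrable (F n) (volume.restrict (Ioo 0 1)) := fun n =>
    (integrable_indicator_iff (hm n)).2 ((f.integrableOn_circleDeriv (hD n)).mono_measure
      Measure.restrict_le_self)
  have hsum : Summable fun n => ∫ s in Ioo (0 : ℝ) 1, ‖F n s‖ := by
    refine Summable.of_nonneg_of_le (fun n => integral_nonneg fun s => norm_nonneg _) (fun n => ?_)
      (hT.summable_bound.mul_right ‖f‖)
    have e : (fun s => ‖F n s‖) = ((T.selection b)^[n + 1] '' Ioc x y).indicator
        fun s => ‖circleDeriv f (s : UnitAddCircle)‖ :=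
      funext fun s => norm_indicator_eq_indicator_norm _ _
    rw [e, setIntegral_indicator (hm n), inter_eq_self_of_subset_right (hD n)]
    have h1 := norm_setIntegral_le_of_norm_le_const (C := ‖f‖) (μ := volume)
      (f := fun s : ℝ => ‖circleDeriv f (s : UnitAddCircle)‖)
      (C1Circle.volume_lt_top_of_subset (hD n))
      (fun s _ => by rw [norm_norm]; exact f.abs_circleDeriv_le (s : UnitAddCircle))
    refine (le_abs_self _).trans (h1.trans ?_)
    rw [mul_comm]
    gcongr
    refine (hT.volumeReal_image_le hb (n + 1) hs measurableSet_Ioc).trans ?_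
    have := contractionConst_pos C
    have := hT.inv_nonneg
    rw [inv_pow]
    refine mul_le_of_le_one_right (by rw [← inv_pow]; positivity) ?_
    calc volume.real (Ioc x y) ≤ volume.real (Ioo (0 : ℝ) 1) := measureReal_mono hs (by simp)
      _ = 1 := by simp
  have h1 := hasSum_integral_of_summable_integral_norm hF hsum
  have h2 : ∀ n, ∫ s in Ioo (0 : ℝ) 1, F n s =
      ∫ s in (T.selection b)^[n + 1] '' Ioc x y, circleDeriv f (s : UnitAddCircle) := fun n => by
    rw [setIntegral_indicator (hm n), inter_eq_self_of_subset_right (hD n)]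
  simp only [h2] at h1
  rw [(hT.hasSum_hullFunctional hb hx hy f).unique h1]
  refine integral_congr_ae (Eventually.of_forall fun s => ?_)
  simp only [hullCount]
  rw [← tsum_mul_left]
  refine tsum_congr fun n => ?_
  by_cases h : s ∈ (T.selection b)^[n + 1] '' Ioc x y <;> simp only [F, h, indicator_of_mem,
    indicator_of_notMem, not_false_eq_true, Pi.one_apply, mul_one, mul_zero]

/-- The signed count of the visits of `z` to the right of a point between the times `l` and `r`. -/
def visitCount (z : ℕ → ℝ) (l r : ℕ) (s : ℝ) : ℝ :=
  ∑ i ∈ Finset.range r, (Iio (z (i + 1))).indicator (1 : ℝ → ℝ) s -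
    ∑ i ∈ Finset.range l, (Iio (z (i + 1))).indicator (1 : ℝ → ℝ) s

/-- Puts evaluations in the same form as interval terms, namely f' integrated against an
integer-valued function. -/
theorem evalCLM_eq_integral {s : ℝ} (hs : s ∈ Ioo (0 : ℝ) 1) (f : C1Circle) :
    C1Circle.evalCLM s f = f 0 + ∫ t in Ioo (0 : ℝ) 1,
      circleDeriv f (t : UnitAddCircle) * (Iio s).indicator (1 : ℝ → ℝ) t := by
  have e : ∀ t : ℝ, circleDeriv f (t : UnitAddCircle) * (Iio s).indicator (1 : ℝ → ℝ) t =
      (Iio s).indicator (fun t : ℝ => circleDeriv f (t : UnitAddCircle)) t := fun t => by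
    by_cases h : t ∈ Iio s <;> simp only [h, indicator_of_mem, indicator_of_notMem,
      not_false_eq_true, Pi.one_apply, mul_one, mul_zero]
  have e2 : Ioo (0 : ℝ) 1 ∩ Iio s = Ioo 0 s := by
    rw [Ioo_inter_Iio, min_eq_right hs.2.le]
  simp only [e]
  rw [setIntegral_indicator measurableSet_Iio, e2, ← integral_Ioc_eq_integral_Ioo,
    f.setIntegral_circleDeriv hs.1.le, C1Circle.evalCLM_apply]
  have : ((0 : ℝ) : UnitAddCircle) = 0 := rfl
  rw [this]
  ring

theorem integrableOn_indicator_Iio (s : ℝ) :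
    IntegrableOn ((Iio s).indicator (1 : ℝ → ℝ)) (Ioo 0 1) :=
  Integrable.indicator (integrableOn_const (by simp)) measurableSet_Iio

theorem integrableOn_visitCount (z : ℕ → ℝ) (l r : ℕ) :
    IntegrableOn (visitCount z l r) (Ioo 0 1) :=
  (integrable_finsetSum _ fun _ _ => integrableOn_indicator_Iio _).sub
    (integrable_finsetSum _ fun _ _ => integrableOn_indicator_Iio _)

theorem integrableOn_circleDeriv_mul (f : C1Circle) {R : ℝ → ℝ} (hR : IntegrableOn R (Ioo 0 1)) :
    IntegrableOn (fun s : ℝ => circleDeriv f (s : UnitAddCircle) * R s) (Ioo 0 1) :=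
  hR.continuousOn_mul_of_subset f.continuous_circleDeriv_coe.continuousOn isCompact_Icc
    measurableSet_Ioo Ioo_subset_Icc_self

include hT hb in
theorem IsExpandingWith.pairFunctional_eq_integral {w : ℕ → ℕ} {s : ℝ}
    (hz : ∀ k, T.backwardOrbit w s k ∈ Ioo (0 : ℝ) 1) (l r : ℕ) (f : C1Circle) :
    T.pairFunctional b w s l r f = ((r : ℝ) - l) * f 0 +
      ∫ t in Ioo (0 : ℝ) 1, circleDeriv f (t : UnitAddCircle) *
        (visitCount (T.backwardOrbit w s) l r t +
          T.hullCount b (T.backwardOrbit w s l) (T.backwardOrbit w s r) t) := by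
  have h1 := fun k => integrableOn_circleDeriv_mul f
    (integrableOn_indicator_Iio (T.backwardOrbit w s (k + 1)))
  have hsum : ∀ m : ℕ, ∑ i ∈ Finset.range m, C1Circle.evalCLM (T.backwardOrbit w s (i + 1)) f =
      m * f 0 + ∫ t in Ioo (0 : ℝ) 1, circleDeriv f (t : UnitAddCircle) *
        ∑ i ∈ Finset.range m, (Iio (T.backwardOrbit w s (i + 1))).indicator (1 : ℝ → ℝ) t := by
    intro m
    simp only [evalCLM_eq_integral (hz _), Finset.mul_sum]
    rw [integral_finsetSum _ fun i _ => h1 i]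
    simp [Finset.sum_add_distrib]
  have hS : ∀ m : ℕ, IntegrableOn (fun t : ℝ => circleDeriv f (t : UnitAddCircle) *
      ∑ i ∈ Finset.range m, (Iio (T.backwardOrbit w s (i + 1))).indicator (1 : ℝ → ℝ) t)
      (Ioo 0 1) := fun m => integrableOn_circleDeriv_mul f
    (integrable_finsetSum _ fun _ _ => integrableOn_indicator_Iio _)
  have h3 : IntegrableOn (fun t : ℝ => circleDeriv f (t : UnitAddCircle) *
      visitCount (T.backwardOrbit w s) l r t) (Ioo 0 1) :=
    integrableOn_circleDeriv_mul f (integrableOn_visitCount _ _ _)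
  have h4 := integrableOn_circleDeriv_mul f
    (hT.integrable_hullCount hb (hz l) (hz r)).integrableOn
  simp only [mul_add]
  rw [integral_add h3 h4]
  simp only [visitCount, mul_sub]
  rw [integral_sub (hS r) (hS l), ← hT.hullFunctional_eq_integral hb (hz l) (hz r)]
  simp only [pairFunctional, add_apply, sub_apply, sum_apply, hsum]
  ring

include hT hb in
-- The weights that eliminate β also cancel the terms in f(0), so what remains is f' tested against
-- one density, orthogonal to all derivatives.
theorem IsExpandingWith.ae_eq_const_of_relationFunctional_eq_zero {w : ℕ → ℕ} {s : ℝ}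
    (hz : ∀ k, T.backwardOrbit w s k ∈ Ioo (0 : ℝ) 1) {P Q : ℕ × ℕ}
    (h : T.relationFunctional b w s P Q = 0) :
    ∃ κ : ℝ, ∀ᵐ t ∂volume.restrict (Ioo (0 : ℝ) 1),
      ((Q.2 : ℝ) - Q.1) * (visitCount (T.backwardOrbit w s) P.1 P.2 t +
          T.hullCount b (T.backwardOrbit w s P.1) (T.backwardOrbit w s P.2) t) -
        ((P.2 : ℝ) - P.1) * (visitCount (T.backwardOrbit w s) Q.1 Q.2 t +
          T.hullCount b (T.backwardOrbit w s Q.1) (T.backwardOrbit w s Q.2) t) = κ := by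
  have hi : ∀ l r, IntegrableOn (fun t => visitCount (T.backwardOrbit w s) l r t +
      T.hullCount b (T.backwardOrbit w s l) (T.backwardOrbit w s r) t) (Ioo 0 1) := fun l r =>
    (integrableOn_visitCount _ l r).add
      (hT.integrable_hullCount hb (hz l) (hz r)).integrableOn
  refine C1Circle.exists_ae_eq_const (((hi _ _).const_mul _).sub ((hi _ _).const_mul _))
    fun φ => ?_
  have h1 := congrArg (fun L : C1Circle →L[ℝ] ℝ => L φ) h
  simp only [relationFunctional, sub_apply, smul_apply, zero_apply,
    smul_eq_mul, hT.pairFunctional_eq_integral hb hz] at h1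
  simp only [mul_sub, mul_left_comm (circleDeriv φ _)]
  rw [integral_sub ((integrableOn_circleDeriv_mul φ (hi _ _)).const_mul _)
    ((integrableOn_circleDeriv_mul φ (hi _ _)).const_mul _), integral_const_mul,
    integral_const_mul]
  linear_combination h1

end AnalyticCircleMap

/-! ### Returns of a sequence -/

/-- Near some point the sequence has returns after a bounded time, at every scale. -/
def HasBoundedReturns (z : ℕ → ℝ) : Prop :=
  ∃ (p : ℝ) (M : ℕ), ∀ ε > 0, ∃ k d, 1 ≤ d ∧ d ≤ M ∧ |z k - p| < ε ∧ |z (k + d) - p| < ε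

/-- Pigeonhole in blocks of length 2N: a set of density at least 1/N has more elements than the
window has blocks, so two elements share a block. -/
theorem exists_lt_of_card_filter {φ : ℕ → Prop} [DecidablePred φ] {e m N : ℕ}
    (hN : 2 * N < m) (h : m ≤ ((Finset.Ico e (e + m)).filter φ).card * N) :
    ∃ i d, 1 ≤ d ∧ d ≤ 2 * N ∧ φ i ∧ φ (i + d) := by
  have hN0 : 0 < N := Nat.pos_of_ne_zero fun h0 => by
    subst h0
    omega
  set S := (Finset.Ico e (e + m)).filter φ
  have hcard : (Finset.range (m / (2 * N) + 1)).card < S.card := by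
    rw [Finset.card_range]
    by_contra! hle
    have h1 : S.card * N ≤ (m / (2 * N) + 1) * N := Nat.mul_le_mul_right N hle
    have h2 : m / (2 * N) * (2 * N) ≤ m := Nat.div_mul_le_self _ _
    nlinarith
  obtain ⟨i, hi, j, hj, hij, hdiv⟩ := Finset.exists_ne_map_eq_of_card_lt_of_maps_to hcard
    (f := fun i => (i - e) / (2 * N)) (fun i hi => by
      have hi' := Finset.mem_Ico.1 (Finset.mem_filter.1 hi).1
      rw [Finset.mem_coe, Finset.mem_range, Nat.lt_succ_iff]
      exact Nat.div_le_div_right (by omega))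
  wlog hlt : i < j generalizing i j
  · exact this j hj i hi hij.symm hdiv.symm (by omega)
  have hi' := Finset.mem_filter.1 hi
  have hj' := Finset.mem_filter.1 hj
  have hie := Finset.mem_Ico.1 hi'.1
  refine ⟨i, j - i, by omega, ?_, hi'.2, by rw [Nat.add_sub_cancel' hlt.le]; exact hj'.2⟩
  have h1 : j - e < 2 * N * ((j - e) / (2 * N)) + 2 * N := by
    have := Nat.lt_mul_div_succ (j - e) (show 0 < 2 * N by omega)
    linarith
  have h2 : 2 * N * ((i - e) / (2 * N)) ≤ i - e := Nat.mul_div_le _ _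
  rw [hdiv] at h2
  omega

/-! ### Visit counts -/

open AnalyticCircleMap

theorem visitCount_swap (z : ℕ → ℝ) (l r : ℕ) (s : ℝ) :
    visitCount z l r s = -visitCount z r l s := by
  rw [visitCount, visitCount, neg_sub]

theorem visitCount_sub_eq_card {z : ℕ → ℝ} {s t : ℝ} (hst : s ≤ t) (e m : ℕ) :
    visitCount z e (e + m) s - visitCount z e (e + m) t =
      ((Finset.Ico e (e + m)).filter fun i => z (i + 1) ∈ Ioc s t).card := by
  rw [visitCount, visitCount, ← Finset.sum_Ico_eq_sub _ (Nat.le_add_right e m),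
    ← Finset.sum_Ico_eq_sub _ (Nat.le_add_right e m), ← Finset.sum_sub_distrib,
    Finset.card_filter, Nat.cast_sum]
  refine Finset.sum_congr rfl fun i _ => ?_
  by_cases h1 : s < z (i + 1) <;> by_cases h2 : t < z (i + 1)
  · simp [h1, h2]
  · simp [h1, h2, not_lt.1 h2]
  · exact absurd (hst.trans_lt h2) h1
  · simp [h1, h2]

theorem abs_visitCount_sub {z : ℕ → ℝ} {s t : ℝ} (hst : s ≤ t) (l r : ℕ) : ∃ e m : ℕ,
    |(r : ℝ) - l| = m ∧ |visitCount z l r s - visitCount z l r t| =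
      ((Finset.Ico e (e + m)).filter fun i => z (i + 1) ∈ Ioc s t).card := by
  rcases le_total l r with h | h <;> obtain ⟨m, rfl⟩ := Nat.exists_eq_add_of_le h
  · refine ⟨l, m, by simp, ?_⟩
    rw [visitCount_sub_eq_card hst, Nat.abs_cast]
  · refine ⟨r, m, by simp, ?_⟩
    rw [visitCount_swap, visitCount_swap z _ _ t, ← neg_add', abs_neg, ← sub_eq_add_neg,
      visitCount_sub_eq_card hst, Nat.abs_cast]

theorem visitCount_of_forall_lt {z : ℕ → ℝ} {s : ℝ} (h : ∀ k, s < z k) (l r : ℕ) :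
    visitCount z l r s = (r : ℝ) - l := by
  simp [visitCount, h]

theorem visitCount_of_forall_le {z : ℕ → ℝ} {s : ℝ} (h : ∀ k, z k ≤ s) (l r : ℕ) :
    visitCount z l r s = 0 := by
  simp [visitCount, h]

theorem exists_intCast_visitCount (z : ℕ → ℝ) (l r : ℕ) (s : ℝ) :
    ∃ k : ℤ, visitCount z l r s = k := by
  refine ⟨(((Finset.range r).filter fun i => s < z (i + 1)).card : ℤ) -
    ((Finset.range l).filter fun i => s < z (i + 1)).card, ?_⟩
  have h : ∀ m : ℕ, ∑ i ∈ Finset.range m, (Iio (z (i + 1))).indicator (1 : ℝ → ℝ) s =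
      ((Finset.range m).filter fun i => s < z (i + 1)).card := fun m => by
    rw [Finset.card_filter, Nat.cast_sum]
    refine Finset.sum_congr rfl fun i _ => ?_
    by_cases h : s < z (i + 1) <;> simp [h]
  rw [visitCount, h, h]
  push_cast
  rfl

/-- If the visit counts over longer and longer windows are asymptotically integer valued, up to a
fixed factor, then the sequence has bounded returns. -/
theorem hasBoundedReturns_of_visitCount {z : ℕ → ℝ} {δ : ℝ} (hδ : 0 < δ)
    (hz : ∀ k, z k ∈ Icc δ (1 - δ)) {l r : ℕ → ℕ}
    (hlr : Tendsto (fun j => |(r j : ℝ) - l j|) atTop atTop) {q : ℝ → ℝ} {n₀ : ℤ} (hn₀ : n₀ ≠ 0)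
    {κ : ℕ → ℝ}
    (h : ∀ᵐ s ∂volume.restrict (Ioo (0 : ℝ) 1), (∃ k : ℤ, q s = k) ∧ ∀ᶠ j in atTop,
      ((r j : ℝ) - l j) * q s = n₀ * visitCount z (l j) (r j) s + κ j) :
    HasBoundedReturns z := by
  set good : ℝ → Prop := fun s => (∃ k : ℤ, q s = k) ∧ ∀ᶠ j in atTop,
    ((r j : ℝ) - l j) * q s = n₀ * visitCount z (l j) (r j) s + κ j
  have hdense : ∀ a b : ℝ, 0 ≤ a → a < b → b ≤ 1 → ∃ s ∈ Ioo a b, good s := by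
    intro a b ha hab hb
    have h1 : ∀ᵐ s ∂volume.restrict (Ioo a b), good s :=
      ae_mono (Measure.restrict_mono (Ioo_subset_Ioo ha hb) le_rfl) h
    have h2 : (ae (volume.restrict (Ioo a b))).NeBot := by
      rw [ae_neBot, Ne, Measure.restrict_eq_zero, Real.volume_Ioo, ENNReal.ofReal_eq_zero]
      linarith
    exact ((ae_restrict_mem measurableSet_Ioo).and h1).exists
  have hdiff : ∀ s t, good s → good t → ∀ᶠ j in atTop, ((r j : ℝ) - l j) * (q s - q t) =
      n₀ * (visitCount z (l j) (r j) s - visitCount z (l j) (r j) t) := by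
    intro s t hs ht
    filter_upwards [hs.2, ht.2] with j h1 h2
    linear_combination h1 - h2
  have hδ1 : δ ≤ 1 - δ := (hz 0).1.trans (hz 0).2
  -- To the left of the whole orbit every visit is counted, to its right none. Hence `q` cannot take
  -- the value q(s₀) beyond 1 - δ, and the supremum `p` of the good points where it does is
  -- interior.
  obtain ⟨s₀, hs₀, hg₀⟩ := hdense 0 δ le_rfl hδ (by linarith)
  set A : Set ℝ := {s | s ∈ Ioo (0 : ℝ) 1 ∧ good s ∧ q s = q s₀}
  have hA₀ : s₀ ∈ A := ⟨⟨hs₀.1, by linarith [hs₀.2]⟩, hg₀, rfl⟩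
  have hAle : ∀ s ∈ A, s ≤ 1 - δ := by
    rintro s ⟨-, hs, hq⟩
    by_contra! hlt
    obtain ⟨j, h1, h2⟩ := ((hdiff s₀ s hg₀ hs).and (hlr.eventually_gt_atTop 0)).exists
    rw [hq, sub_self, mul_zero, visitCount_of_forall_lt fun k => hs₀.2.trans_le (hz k).1,
      visitCount_of_forall_le fun k => (hz k).2.trans hlt.le, sub_zero, eq_comm,
      mul_eq_zero] at h1
    rcases h1 with h1 | h1
    · exact hn₀ (by exact_mod_cast h1)
    · rw [h1, abs_zero] at h2
      exact lt_irrefl _ h2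
  have hbdd : BddAbove A := ⟨1 - δ, hAle⟩
  set p := sSup A
  have hp0 : 0 < p := hs₀.1.trans_le (le_csSup hbdd hA₀)
  have hp1 : p ≤ 1 - δ := csSup_le ⟨_, hA₀⟩ hAle
  refine ⟨p, 2 * n₀.natAbs, fun ε hε => ?_⟩
  obtain ⟨s, hsA, hsp⟩ := exists_lt_of_lt_csSup ⟨_, hA₀⟩ (show p - ε < sSup A by
    change p - ε < p
    linarith)
  -- `q` differs at s and t on the two sides of `p`, hence by at least 1, being integer valued. So
  -- (s, t] receives at least m/|n₀| visits in windows of length m, and the pigeonhole lemma gives a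
  -- return time at most 2|n₀|.
  obtain ⟨t, ht, htg⟩ := hdense p (min (p + ε) 1) hp0.le (lt_min (by linarith) (by linarith))
    (min_le_right _ _)
  have hst : s ≤ t := (le_csSup hbdd hsA).trans ht.1.le
  have hq : q s ≠ q t := fun hq => by
    have : t ∈ A := ⟨⟨hp0.trans ht.1, ht.2.trans_le (min_le_right _ _)⟩, htg,
      hq.symm.trans hsA.2.2⟩
    exact (le_csSup hbdd this).not_gt ht.1
  have hq1 : 1 ≤ |q s - q t| := by
    obtain ⟨a, ha⟩ := hsA.2.1.1
    obtain ⟨c, hc⟩ := htg.1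
    rw [ha, hc] at hq ⊢
    have : a - c ≠ 0 := sub_ne_zero.2 fun h => hq (by rw [h])
    exact_mod_cast Int.one_le_abs this
  obtain ⟨j, h1, h2⟩ := ((hdiff s t hsA.2.1 htg).and
    (hlr.eventually_gt_atTop (2 * n₀.natAbs : ℝ))).exists
  obtain ⟨e, m, hm, hcard⟩ := abs_visitCount_sub (z := z) hst (l j) (r j)
  have h3 := congrArg abs h1
  rw [abs_mul, abs_mul, hm, hcard] at h3
  rw [hm] at h2
  have hn : |(n₀ : ℝ)| = n₀.natAbs := by rw [Nat.cast_natAbs, Int.cast_abs]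
  have h4 : (m : ℝ) ≤ ((Finset.Ico e (e + m)).filter fun i => z (i + 1) ∈ Ioc s t).card *
      n₀.natAbs := by
    rw [← hn, mul_comm, ← h3]
    exact le_mul_of_one_le_right (Nat.cast_nonneg m) hq1
  obtain ⟨i, d, hd1, hd2, hi, hid⟩ := exists_lt_of_card_filter (by exact_mod_cast h2)
    (show m ≤ _ by exact_mod_cast h4)
  have htε : t < p + ε := ht.2.trans_le (min_le_left _ _)
  refine ⟨i + 1, d, hd1, hd2, abs_lt.2 ⟨?_, ?_⟩, abs_lt.2 ⟨?_, ?_⟩⟩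
  · linarith [hi.1]
  · linarith [hi.2]
  · rw [add_right_comm]
    linarith [hid.1]
  · rw [add_right_comm]
    linarith [hid.2]

/-- A sequence without bounded returns has close pairs at large time distances. -/
theorem exists_close_pair {z : ℕ → ℝ} {δ : ℝ} (hz : ∀ k, z k ∈ Icc δ (1 - δ))
    (hret : ¬ HasBoundedReturns z) {ε : ℝ} (hε : 0 < ε) (n : ℕ) :
    ∃ P : ℕ × ℕ, z P.1 < z P.2 ∧ z P.2 - z P.1 < ε ∧ (n : ℝ) < |(P.2 : ℝ) - P.1| := by
  obtain ⟨a, -, ψ, hψ, hlim⟩ := isCompact_Icc.tendsto_subseq hz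
  obtain ⟨N, hN⟩ := Metric.cauchySeq_iff.1 hlim.cauchySeq ε hε
  have hlt : ψ N + n < ψ (N + n + 1) := by
    have h1 := hψ.add_le_nat (n + 1) N
    rw [add_comm (n + 1) N, ← add_assoc] at h1
    omega
  have hd := hN N le_rfl (N + n + 1) (by omega)
  -- An exact coincidence of two terms would already be a bounded return at every scale; strict
  -- inequality then lets the pair be ordered in space.
  have hne : z (ψ N) ≠ z (ψ (N + n + 1)) := fun h => by
    refine hret ⟨z (ψ N), ψ (N + n + 1) - ψ N, fun ε hε =>
      ⟨ψ N, ψ (N + n + 1) - ψ N, by omega, le_rfl, by simpa using hε, ?_⟩⟩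
    rw [Nat.add_sub_cancel' (by omega), ← h]
    simpa using hε
  have hn : (n : ℝ) < (ψ (N + n + 1) : ℝ) - ψ N := by
    rw [lt_sub_iff_add_lt']
    exact_mod_cast hlt
  simp only [Function.comp_apply, Real.dist_eq] at hd
  rcases hne.lt_or_gt with h | h
  · exact ⟨(ψ N, ψ (N + n + 1)), h, by rw [abs_sub_comm] at hd; exact (abs_lt.1 hd).2,
      hn.trans_le (le_abs_self _)⟩
  · exact ⟨(ψ (N + n + 1), ψ N), h, (abs_lt.1 hd).2, by
      rw [abs_sub_comm]; exact hn.trans_le (le_abs_self _)⟩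

/-! ### Nonvanishing of a relation functional -/

namespace AnalyticCircleMap

variable {T : AnalyticCircleMap} {b : ℝ → ℕ} {C lam : ℝ}

/-- Some relation functional between close pairs of a backward orbit without bounded returns does
not vanish. -/
theorem IsExpandingWith.exists_relationFunctional_ne_zero (hT : T.IsExpandingWith C lam)
    (hb : T.IsBranchChoice b) {w : ℕ → ℕ} {s δ ρ : ℝ} (hδ : 0 < δ) (hρ : 0 < ρ)
    (hz : ∀ k, T.backwardOrbit w s k ∈ Icc δ (1 - δ))
    (hret : ¬ HasBoundedReturns (T.backwardOrbit w s)) :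
    ∃ P Q : ℕ × ℕ,
      (∀ R ∈ ({P, Q} : Set (ℕ × ℕ)), T.backwardOrbit w s R.1 ≤ T.backwardOrbit w s R.2 ∧
        T.backwardOrbit w s R.2 - T.backwardOrbit w s R.1 < ρ) ∧
      T.relationFunctional b w s P Q ≠ 0 := by
  by_contra! hzero
  set z := T.backwardOrbit w s
  have hz01 : ∀ k, z k ∈ Ioo (0 : ℝ) 1 := fun k =>
    ⟨hδ.trans_le (hz k).1, (hz k).2.trans_lt (by linarith)⟩
  -- The gaps are below 2^{-j}, hence summable, while the time distances exceed j. `P 0` is the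
  -- fixed pair compared with all the others.
  choose P hP using fun j : ℕ => exists_close_pair hz hret
    (lt_min hρ (pow_pos (half_pos one_pos) j : (0 : ℝ) < (1 / 2) ^ j)) j
  have hrel : ∀ j, T.relationFunctional b w s (P 0) (P j) = 0 := fun j => by
    refine hzero (P 0) (P j) ?_
    rintro R (rfl | rfl)
    · exact ⟨(hP 0).1.le, (hP 0).2.1.trans_le (min_le_left _ _)⟩
    · exact ⟨(hP j).1.le, (hP j).2.1.trans_le (min_le_left _ _)⟩
  choose κ hκ using fun j => hT.ae_eq_const_of_relationFunctional_eq_zero hb hz01 (hrel j)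
  -- Borel–Cantelli: almost every t eventually avoids all images of the j-th interval, so the hull
  -- count of `P j` vanishes there and only its visit count survives.
  have hBC : ∀ᵐ t : ℝ, ∀ᶠ j in atTop,
      t ∉ ⋃ n : ℕ, (T.selection b)^[n + 1] '' Ioc (z (P j).1) (z (P j).2) := by
    refine ae_eventually_notMem ?_
    obtain ⟨c, hc, h⟩ := hT.exists_tsum_volume_image_le hb
    refine ((ENNReal.tsum_le_tsum fun j => (measure_iUnion_le _).trans ((h _ _).trans
      (mul_le_mul_right (ENNReal.ofReal_le_ofReal ((hP j).2.1.le.trans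
        (min_le_right _ _))) c))).trans_lt ?_).ne
    rw [ENNReal.tsum_mul_left, ← ENNReal.ofReal_tsum_of_nonneg (fun j => by positivity)
      summable_geometric_two]
    exact ENNReal.mul_lt_top hc.lt_top ENNReal.ofReal_lt_top
  have hn₀ : ((P 0).2 : ℤ) - (P 0).1 ≠ 0 := fun h0 => by
    have h1 := (hP 0).2.2
    have h2 : ((P 0).2 : ℝ) - (P 0).1 = 0 := by exact_mod_cast h0
    rw [h2] at h1
    simp at h1
  refine hret (hasBoundedReturns_of_visitCount (l := fun j => (P j).1) (r := fun j => (P j).2)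
    (n₀ := ((P 0).2 : ℤ) - (P 0).1) (κ := κ)
    (q := fun t => visitCount z (P 0).1 (P 0).2 t + T.hullCount b (z (P 0).1) (z (P 0).2) t)
    hδ hz (tendsto_atTop_mono (fun j => (hP j).2.2.le) tendsto_natCast_atTop_atTop) hn₀ ?_)
  filter_upwards [ae_all_iff.2 hκ, ae_restrict_of_ae hBC,
    ae_restrict_of_ae (hT.hullCount_eq_natCast (x := z (P 0).1) (y := z (P 0).2) hb)]
    with t h1 h2 h3
  refine ⟨?_, ?_⟩
  · obtain ⟨k, hk⟩ := h3
    obtain ⟨k', hk'⟩ := exists_intCast_visitCount z (P 0).1 (P 0).2 t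
    exact ⟨k' + k, by rw [hk, hk']; push_cast; rfl⟩
  · filter_upwards [h2] with j hj
    have h4 := h1 j
    rw [hullCount_eq_zero hj] at h4
    push_cast
    linear_combination h4

/-! ### Periodic points -/

variable {K : Set UnitAddCircle}

/-- T^d carries z_{k+d} to z_k, and both approach the return point with d bounded. If none of these
finitely many T^d fixed that point, this would persist nearby by continuity. -/
theorem exists_mem_periodicPts_of_hasBoundedReturns (hK : IsClosed K) {w : ℕ → ℕ} {s : ℝ}
    (hz : ∀ k, (T.backwardOrbit w s k : UnitAddCircle) ∈ K)
    (hret : HasBoundedReturns (T.backwardOrbit w s)) :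
    ∃ x ∈ K, x ∈ Function.periodicPts T.toFun := by
  obtain ⟨p, M, h⟩ := hret
  have hiter : ∀ k d, T.toFun^[d] (T.backwardOrbit w s (k + d)) = T.backwardOrbit w s k := by
    intro k d
    induction d with
    | zero => rfl
    | succ d ih =>
      rw [Function.iterate_succ_apply, ← add_assoc, backwardOrbit, T.apply_tauBranch, ih]
  refine ⟨p, ?_, ?_⟩
  · rw [← hK.closure_eq, Metric.mem_closure_iff]
    intro ε hε
    obtain ⟨k, -, -, -, hk, -⟩ := h ε hε
    refine ⟨_, hz k, (UnitAddCircle.dist_coe_le _ _).trans_lt ?_⟩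
    rwa [abs_sub_comm]
  · by_contra hper
    have h1 : ∀ d ∈ Finset.Icc 1 M, ∀ᶠ u : ℝ × ℝ in 𝓝 (p, p),
        T.toFun^[d] (u.2 : UnitAddCircle) ≠ (u.1 : UnitAddCircle) := by
      intro d hd
      have hne : T.toFun^[d] (p : UnitAddCircle) ≠ (p : UnitAddCircle) := fun h0 =>
        hper ⟨d, (Finset.mem_Icc.1 hd).1, h0⟩
      have hc1 : Continuous fun u : ℝ × ℝ => T.toFun^[d] (u.2 : UnitAddCircle) :=
        (T.continuous_toFun.iterate d).comp (UnitAddCircle.continuous_coe.comp continuous_snd)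
      have hc2 : Continuous fun u : ℝ × ℝ => (u.1 : UnitAddCircle) :=
        UnitAddCircle.continuous_coe.comp continuous_fst
      exact (isOpen_ne_fun hc1 hc2).mem_nhds hne
    obtain ⟨ε, hε, h2⟩ := Metric.eventually_nhds_iff.1 ((Finset.eventually_all _).2 h1)
    obtain ⟨k, d, hd1, hd2, hk, hkd⟩ := h ε hε
    refine h2 (y := (T.backwardOrbit w s k, T.backwardOrbit w s (k + d))) ?_ d
      (Finset.mem_Icc.2 ⟨hd1, hd2⟩) (hiter k d)
    rw [Prod.dist_eq, Real.dist_eq, Real.dist_eq]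
    exact max_lt hk hkd

/-- Along an orbit in the contact set f equals β plus a coboundary, which telescopes to zero over a
period; so the uniform measure on the cycle has integral β. -/
theorem hasPeriodicMaximizingMeasure_of_mem_forwardContactSet {f g : UnitAddCircle → ℝ}
    {x : UnitAddCircle} (hx : x ∈ forwardContactSet T f g)
    (hper : x ∈ Function.periodicPts T.toFun) : HasPeriodicMaximizingMeasure T f := by
  obtain ⟨d, hd, hdx⟩ := id hper
  have hd0 : (d : ENNReal) ≠ 0 := by exact_mod_cast hd.ne'
  set ν : Measure UnitAddCircle := ∑ i ∈ Finset.range d, Measure.dirac (T.toFun^[i] x)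
  have hmeas : Measurable T.toFun := T.continuous_toFun.measurable
  have hmap : Measure.map T.toFun ν = ν := by
    have h1 : Measure.map T.toFun ν = ∑ i ∈ Finset.range d, Measure.dirac (T.toFun^[i + 1] x) := by
      simp only [ν]
      rw [← Measure.mapₗ_apply_of_measurable hmeas, map_sum]
      refine Finset.sum_congr rfl fun i _ => ?_
      rw [Measure.mapₗ_apply_of_measurable hmeas, Measure.map_dirac' hmeas,
        Function.iterate_succ_apply']
    obtain ⟨n, rfl⟩ : ∃ n, d = n + 1 := ⟨d - 1, (Nat.sub_add_cancel hd).symm⟩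
    rw [h1, Finset.sum_range_succ]
    simp only [ν]
    rw [Finset.sum_range_succ', hdx]
    rfl
  refine ⟨(d : ENNReal)⁻¹ • ν, ⟨⟨⟨?_⟩, hmeas, ?_⟩, ?_⟩, x, hper, ?_⟩
  · simp [ν, ENNReal.inv_mul_cancel hd0 (ENNReal.natCast_ne_top d)]
  · rw [Measure.map_smul, hmap]
  · have hint : ∫ y, f y ∂ν = ∑ i ∈ Finset.range d, f (T.toFun^[i] x) := by
      simp only [ν]
      rw [integral_finsetSum_measure fun i _ => by
        exact integrable_dirac (by simp)]
      simp
    have hsum : ∀ n, ∑ i ∈ Finset.range n, f (T.toFun^[i] x) =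
        g (T.toFun^[n] x) - g x + n * maxErgodicAverage T f := by
      intro n
      induction n with
      | zero => simp
      | succ n ih =>
        have h1 : g (T.toFun^[n] x) + f (T.toFun^[n] x) =
          g (T.toFun (T.toFun^[n] x)) + maxErgodicAverage T f := hx n
        rw [Finset.sum_range_succ, ih, Function.iterate_succ_apply']
        push_cast
        linarith
    have hd1 : (d : ℝ) ≠ 0 := by exact_mod_cast hd.ne'
    rw [integral_smul_measure, hint, hsum, hdx]
    simp [hd1]
  · simp only [ν, Measure.smul_apply, Measure.finsetSum_apply, smul_eq_mul]
    rw [Finset.sum_eq_zero, mul_zero]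
    intro i _
    simp

end AnalyticCircleMap

/-! ### Almost every function is incompatible -/

theorem IsThinFamily.comp {E E' α : Type*} [NormedAddCommGroup E] [NormedSpace ℝ E]
    [NormedAddCommGroup E'] [NormedSpace ℝ E'] {A : Set α} {L : α → E →L[ℝ] ℝ}
    (h : IsThinFamily A L) (ι : E' →L[ℝ] E) : IsThinFamily A fun a => (L a).comp ι := by
  intro ε hε
  have hι : 0 < ‖ι‖ + 1 := by positivity
  obtain ⟨r, hr, k, cls, h1, h2⟩ := h (ε / (‖ι‖ + 1)) (by positivity)
  refine ⟨r * (‖ι‖ + 1), by positivity, k, cls, fun a ha a' ha' hcls => ?_, ?_⟩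
  · rw [← ContinuousLinearMap.sub_comp]
    refine (ContinuousLinearMap.opNorm_comp_le _ _).trans ?_
    have h3 := h1 a ha a' ha' hcls
    gcongr
    linarith
  · rwa [lt_div_iff₀ hι, mul_assoc] at h2

namespace AnalyticCircleMap

variable {T : AnalyticCircleMap}

theorem backwardOrbit_congr {w w' : ℕ → ℕ} {n : ℕ} (h : ∀ k < n, w k = w' k) (s : ℝ) :
    ∀ k ≤ n, T.backwardOrbit w s k = T.backwardOrbit w' s k := by
  intro k
  induction k with
  | zero => exact fun _ => rfl
  | succ k ih =>
    intro hk
    rw [backwardOrbit, backwardOrbit, h k hk, ih (by omega)]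

theorem pairFunctional_congr {w w' : ℕ → ℕ} {n : ℕ} (h : ∀ k < n, w k = w' k) (b : ℝ → ℕ) (s : ℝ)
    {l r : ℕ} (hl : l ≤ n) (hr : r ≤ n) :
    T.pairFunctional b w s l r = T.pairFunctional b w' s l r := by
  have hz := backwardOrbit_congr (T := T) h s
  have hsum : ∀ m ≤ n, ∑ i ∈ Finset.range m, C1Circle.evalCLM (T.backwardOrbit w s (i + 1)) =
      ∑ i ∈ Finset.range m, C1Circle.evalCLM (T.backwardOrbit w' s (i + 1)) := fun m hm =>
    Finset.sum_congr rfl fun i hi => by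
      rw [hz (i + 1) ((Finset.mem_range.1 hi).trans_le hm)]
  rw [pairFunctional, pairFunctional, hz l hl, hz r hr, hsum l hl, hsum r hr]

/-- Only finitely many letters matter, so finitely supported words suffice and the families are
countable in number. -/
theorem relationFunctional_congr {w w' : ℕ → ℕ} {n : ℕ} (h : ∀ k < n, w k = w' k) (b : ℝ → ℕ)
    (s : ℝ) {P Q : ℕ × ℕ} (hP₁ : P.1 ≤ n) (hP₂ : P.2 ≤ n) (hQ₁ : Q.1 ≤ n) (hQ₂ : Q.2 ≤ n) :
    T.relationFunctional b w s P Q = T.relationFunctional b w' s P Q := by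
  rw [relationFunctional, relationFunctional, pairFunctional_congr h b s hP₁ hP₂,
    pairFunctional_congr h b s hQ₁ hQ₂]

end AnalyticCircleMap

/-! ### Reduction to countably many thin families -/

namespace MarkedFrame

open AnalyticCircleMap

variable {T : AnalyticCircleMap} {p : ℕ} {M : MarkedFrame T p} {c : Fin p → ℝ}
  {K : Set UnitAddCircle}

theorem IsAdapted.exists_coords_subset_Icc (h : M.IsAdapted c K) :
    ∃ δ > 0, coords K ⊆ Icc δ (1 - δ) := by
  have h0 : (0 : UnitAddCircle) ∉ K := fun h0 => by
    obtain ⟨s, hs, hs0⟩ := M.V_subset (h.subset_V h0)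
    obtain ⟨n, hn⟩ := (AddCircle.coe_eq_zero_iff (1 : ℝ)).1 hs0
    rw [zsmul_one] at hn
    rw [← hn] at hs
    have h1 : (0 : ℤ) < n := by exact_mod_cast hs.1
    have h2 : n < (1 : ℤ) := by exact_mod_cast hs.2
    omega
  obtain ⟨δ, hδ, hball⟩ := Metric.isOpen_iff.1 h.isClosed.isOpen_compl 0 h0
  refine ⟨δ, hδ, fun s hs => ⟨?_, ?_⟩⟩
  · by_contra! hlt
    refine hball (a := (s : UnitAddCircle)) ?_ hs.2
    rw [Metric.mem_ball]
    have h1 := UnitAddCircle.dist_coe_le s 0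
    rw [sub_zero, abs_of_pos hs.1.1] at h1
    exact h1.trans_lt hlt
  · by_contra! hlt
    refine hball (a := (s : UnitAddCircle)) ?_ hs.2
    rw [Metric.mem_ball]
    have h1 := UnitAddCircle.dist_coe_le s 1
    rw [abs_sub_comm, abs_of_pos (sub_pos.2 hs.1.2)] at h1
    have h2 : ((1 : ℝ) : UnitAddCircle) = 0 := AddCircle.coe_period 1
    rw [h2] at h1
    exact h1.trans_lt (by linarith)

/-- A compatible function without periodic maximizing measure is annihilated by one of countably
many families of nonzero relation functionals. -/
theorem exists_relationFunctional_apply_eq_zero {C lam : ℝ} (hT : T.IsExpandingWith C lam)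
    (hp : 1 ≤ p) {f : C1Circle} (hf : (f : UnitAddCircle → ℝ) ∈ M.compatibleFunctions) :
    ∃ (w : ℕ →₀ ℕ) (P Q : ℕ × ℕ) (c : Fin p → ℝ), (∀ k, w k < T.degree) ∧
      (∀ ν, c ν ∈ M.survivorValues) ∧
      T.relationFunctional (M.branchChoice c) w (c ⟨0, hp⟩) P Q ≠ 0 ∧
      T.relationFunctional (M.branchChoice c) w (c ⟨0, hp⟩) P Q f = 0 := by
  obtain ⟨-, -, hper, hcomp⟩ := hf
  obtain ⟨c, g, hc, hg, hK, hcK⟩ := hcomp.exists_isAdapted hp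
  obtain ⟨w, hw, hz⟩ := hK.exists_backwardOrbit hcK
  obtain ⟨L, hL⟩ := hg.2.1
  obtain ⟨ρ, hρ, hpair⟩ := hK.pairFunctional_apply hT
    (β := maxErgodicAverage T f) (fun y hy => hy 0) hL
  obtain ⟨δ, hδ, hδK⟩ := hK.exists_coords_subset_Icc
  obtain ⟨P, Q, hclose, hne⟩ := hT.exists_relationFunctional_ne_zero (M.isBranchChoice c) hδ hρ
    (fun k => hδK (hz k)) fun hret => by
      obtain ⟨x, hx, hxp⟩ := exists_mem_periodicPts_of_hasBoundedReturns hK.isClosed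
        (fun k => (hz k).2) hret
      exact hper (hasPeriodicMaximizingMeasure_of_mem_forwardContactSet hx hxp)
  set n := max (max P.1 P.2) (max Q.1 Q.2)
  -- The truncated orbit may leave `K` after time n, but its later points do not enter the
  -- functional; the letter 0 is admissible because the degree is positive.
  set w' : ℕ →₀ ℕ := Finsupp.onFinset (Finset.range n) (fun k => if k < n then w k else 0)
    fun k hk => by
      rw [Finset.mem_range]
      by_contra h
      exact hk (if_neg h)
  have hw' : ∀ k, w' k = if k < n then w k else 0 := fun k => rfl
  have hcongr : T.relationFunctional (M.branchChoice c) w' (c ⟨0, hp⟩) P Q =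
      T.relationFunctional (M.branchChoice c) w (c ⟨0, hp⟩) P Q :=
    relationFunctional_congr (n := n) (fun k hk => by rw [hw', if_pos hk]) _ _ (by simp [n])
      (by simp [n]) (by simp [n]) (by simp [n])
  refine ⟨w', P, Q, c, fun k => ?_, hc, by rwa [hcongr], ?_⟩
  · rw [hw']
    split_ifs
    · exact hw k
    · exact T.degree_pos
  · have hPQ : ∀ R ∈ ({P, Q} : Set (ℕ × ℕ)), T.pairFunctional (M.branchChoice c) w (c ⟨0, hp⟩)
        R.1 R.2 f = ((R.2 : ℝ) - R.1) * maxErgodicAverage T f := fun R hR =>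
      hpair w _ hz R.1 R.2 (hclose R hR).1 (hclose R hR).2
    rw [hcongr, relationFunctional, sub_apply, smul_apply, smul_apply, hPQ P (by simp),
      hPQ Q (by simp), smul_eq_mul, smul_eq_mul]
    ring

end MarkedFrame

theorem mainTheorem6 (T : AnalyticCircleMap) (C lam : ℝ) (hT : T.IsExpandingWith C lam)
    {H : Type*} [NormedAddCommGroup H] [NormedSpace ℝ H] [CompleteSpace H]
    (ι : H →L[ℝ] C1Circle) (hι_inj : Function.Injective ι) (hι_dense : DenseRange ι)
    (hι_analytic : ∀ f : H, IsAnalyticOnCircle (ι f))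
    (p : ℕ) (hp : 1 ≤ p) (M : MarkedFrame T p)
    (hM : M.complexity < ((1 / (p : ℝ) * Real.log lam : ℝ) : EReal))
    (f₀ : H) (hf₀ : (ι f₀ : UnitAddCircle → ℝ) ∈ M.compatibleFunctions) :
    ∃ φ : H, ∃ U : Set C1Circle, IsOpen U ∧ ι f₀ ∈ U ∧
      ∀ F : H, volume {t : ℝ | t ∈ Icc (0 : ℝ) 1 ∧ ι (F + t • φ) ∈ U ∧
        (ι (F + t • φ) : UnitAddCircle → ℝ) ∈ M.compatibleFunctions} = 0 := by
  set R : (ℕ →₀ ℕ) × (ℕ × ℕ) × (ℕ × ℕ) → (Fin p → ℝ) → C1Circle →L[ℝ] ℝ := fun j c =>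
    T.relationFunctional (M.branchChoice c) j.1 (c ⟨0, hp⟩) j.2.1 j.2.2
  set A : (ℕ →₀ ℕ) × (ℕ × ℕ) × (ℕ × ℕ) → Set (Fin p → ℝ) := fun j =>
    {c | (∀ k, j.1 k < T.degree) ∧ (∀ ν, c ν ∈ M.survivorValues) ∧ R j c ≠ 0}
  have hthin : ∀ j, IsThinFamily (A j) fun c => (R j c).comp ι := by
    intro j
    by_cases hw : ∀ k, j.1 k < T.degree
    · exact ((M.isThinFamily_relationFunctional hT hp hM hw j.2.1 j.2.2).mono
        fun c hc => hc.2.1).comp ι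
    · have hA : A j = ∅ := eq_empty_of_forall_notMem fun c hc => hw hc.1
      rw [hA]
      exact fun ε hε => ⟨ε / 2, half_pos hε, 1, fun _ => 0, by simp, by simpa using half_lt_self hε⟩
  -- A continuous functional on C¹ vanishing on the dense image of `ι` is zero.
  have hne : ∀ j, ∀ c ∈ A j, (R j c).comp ι ≠ 0 := fun j c hc h0 => by
    refine hc.2.2 (ContinuousLinearMap.ext fun f => ?_)
    have h1 : (R j c : C1Circle → ℝ) = fun _ => 0 :=
      hι_dense.equalizer (R j c).continuous continuous_const
        (funext fun x => congrArg (fun L : H →L[ℝ] ℝ => L x) h0)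
    exact congrFun h1 f
  obtain ⟨φ, hφ⟩ := exists_forall_thinFamily_apply_ne_zero A (fun j c => (R j c).comp ι) hthin hne
  -- The transversality of φ to the kernels is global, so the neighbourhood can be the whole space.
  refine ⟨φ, univ, isOpen_univ, mem_univ _, fun F => measure_mono_null ?_
    (measure_iUnion_null fun j => (hthin j).volume_kernels (hφ j) F)⟩
  rintro t ⟨ht, -, hf⟩
  obtain ⟨w, P, Q, c, hw, hc, hne, h0⟩ := M.exists_relationFunctional_apply_eq_zero hT hp hf
  exact mem_iUnion.2 ⟨(w, P, Q), ht, c, ⟨hw, hc, hne⟩, h0⟩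

end
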